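/- Let $p$ be a finite-range jump law on $\mathbb Z$: $p(z)\ge 0$, $p(z)=0$ for $|z|>R$ for some $R<\infty$, $\sum_z p(z)=1$, with non-zero drift $b=\sum_z z\,p(z)\neq 0$. The asymmetric exclusion process (AEP) with jump law $p$ is the Markov process on $\{0,1\}^{\mathbb Z}$ with generator $$Lf(\eta)=\sum_{x,z\in\mathbb Z}p(z)\,\eta_x(1-\eta_{x+z})\,\bigl(f(\eta^{x,x+z})-f(\eta)\bigr),$$ where $\eta^{x,y}$ is $\eta$ with the values at $x$ and $y$ interchanged. Fix $\rho\in(0,1)$, put $\chi=\rho(1-\rho)$, and let $\pi_\rho$ be the Bernoulli product measure with density $\rho$. For the stationary AEP $\eta(t)$ started from $\pi_\rho$ define, for $t>0$, $$S(x,t)=E[(\eta_x(t)-\rho)(\eta_0(0)-\rho)],\qquad D(t)=(\chi t)^{-1}\sum_{x\in\mathbb Z}\bigl(x-(1-2\rho)bt\bigr)^2S(x,t),$$ and set $tD(t)=0$ at $t=0$. Let $X(t)$ be the position of a single second-class particle with $X(0)=0$, in an environment of first-class AEP particles $\eta$ that initially occupy the sites $x\ne 0$ independently with probability $\rho$: the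 first-class particles form an AEP that does not notice the second-class particle, exchanging positions with it when one of them jumps onto its site; the second-class particle attempts jumps by $z$ at rate $p(z)$, and these are suppressed if the target site is occupied. Let $\widetilde X(t)=X(t)-(1-2\rho)bt$. Then the sum defining $D(t)$ converges absolutely for every $t>0$, the conditional expectations $E[\widetilde X(t)\mid\eta_z(0)=1]$ ($z\neq0$) are finite for every $t\ge 0$, and for every $t\ge 0$ (with the right derivative at $t=0$) $$\partial_t\bigl(tD(t)\bigr)=\sum_z z^2p(z)-2\rho\sum_{z>0}z\,\bigl(p(z)-p(-z)\bigr)\,E\bigl[\widetilde X(t)\,\big|\,\eta_z(0)=1\bigr].$$ -/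

import Mathlib

open MeasureTheory ProbabilityTheory Filter Topology
open scoped NNReal

noncomputable section

namespace AEP

/-- A jump law on `ℤ` defining an asymmetric exclusion process: a finite-range probability
mass function with non-zero drift. -/
structure IsJumpLaw (p : ℤ → ℝ) : Prop where
  nonneg : ∀ z, 0 ≤ p z
  finite_range : ∃ R : ℤ, ∀ z, R < |z| → p z = 0
  sum_one : ∑' z, p z = 1
  drift_ne_zero : ∑' z : ℤ, (z : ℝ) * p z ≠ 0

/-- The drift `b = ∑ z p(z)`. -/
def drift (p : ℤ → ℝ) : ℝ := ∑' z : ℤ, (z : ℝ) * p z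

/-- Particle configurations on `ℤ` with `k` types per site. The type `0` is an empty site, and a
larger type has higher priority.
* `k = 2`: ordinary configurations `η ∈ {0,1}^ℤ`;
* `k = 3`: `0` is an empty site, `1` a second-class particle, `2` a (first-class) particle. -/
abbrev Config (k : ℕ) := ℤ → Fin k

/-- `ζ^{x,y}`: the configuration `ζ` with the contents of the sites `x` and `y` interchanged. -/
def exchange {k : ℕ} (ζ : Config k) (x y : ℤ) : Config k := ζ ∘ Equiv.swap x y

/-- The generator of the exclusion process with priorities. At rate `p z` the content of `x`
attempts to jump to `x + z`; the attempt succeeds, and the two sites exchange their contents,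
if and only if `x + z` holds a lower type.

For `k = 2` this is `∑_{x,z} p(z) η_x (1 - η_{x+z}) (f(η^{x,x+z}) - f(η))`
(see `generator_two`). For `k = 3` these are the second-class particle dynamics: first-class
particles (type `2`) do not notice second-class ones (type `1`) and exchange positions with them
when jumping onto them, while second-class particles jump only to empty sites.

The sums have only finitely many non-zero terms when `p` has finite range and `f` is local. -/
def generator (p : ℤ → ℝ) {k : ℕ} (f : Config k → ℝ) (ζ : Config k) : ℝ :=
  ∑' (x : ℤ) (z : ℤ), if ζ (x + z) < ζ x then p z * (f (exchange ζ x (x + z)) - f ζ) else 0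

/-- The occupation variable `η_x ∈ {0,1}`, as a real number. -/
def occ (η : Config 2) (x : ℤ) : ℝ := ((η x : ℕ) : ℝ)

theorem generator_two (p : ℤ → ℝ) (f : Config 2 → ℝ) (η : Config 2) :
    generator p f η = ∑' (x : ℤ) (z : ℤ),
      p z * occ η x * (1 - occ η (x + z)) * (f (exchange η x (x + z)) - f η) := by
  unfold generator occ
  refine tsum_congr fun x => tsum_congr fun z => ?_
  generalize f (exchange η x (x + z)) - f η = d
  generalize η x = a
  generalize η (x + z) = c
  fin_cases a <;> fin_cases c <;> simp

/-- `f` is a local (cylinder) function: it depends on finitely many sites. -/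
def IsLocal {k : ℕ} (f : Config k → ℝ) : Prop :=
  ∃ A : Finset ℤ, DependsOn f (A : Set ℤ)

/-- `ζ` is the exclusion process (with priorities) with jump law `p`: an adapted process with
càdlàg paths (for the product of the discrete topologies) that solves the martingale problem for
the generator on local functions. -/
structure IsExclusionProcess (p : ℤ → ℝ) {k : ℕ} {Ω : Type*} [mΩ : MeasurableSpace Ω]
    (μ : Measure Ω) (ℱ : Filtration ℝ≥0 mΩ) (ζ : ℝ≥0 → Ω → Config k) : Prop where
  adapted : ∀ t, Measurable[ℱ t] (ζ t)
  right_continuous : ∀ ω x t, ∀ᶠ s in 𝓝[>] t, ζ s ω x = ζ t ω x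
  left_limits : ∀ ω x t, ∃ a : Fin k, ∀ᶠ s in 𝓝[<] t, ζ s ω x = a
  martingale : ∀ f : Config k → ℝ, IsLocal f →
    Martingale
      (fun (t : ℝ≥0) ω =>
        f (ζ t ω) - f (ζ 0 ω) - ∫ s in (0 : ℝ)..t, generator p f (ζ s.toNNReal ω)) ℱ μ

/-- The Bernoulli product measure `π_ρ` on `{0,1}^ℤ`. -/
def bernoulliProduct (ρ : unitInterval) : Measure (Config 2) :=
  Measure.infinitePi fun _ : ℤ => bernoulliMeasure (1 : Fin 2) 0 ρ

/-- `η` is the stationary exclusion process started from `π_ρ`. -/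
structure IsStationaryProcess (p : ℤ → ℝ) (ρ : unitInterval) {Ω : Type*} [mΩ : MeasurableSpace Ω]
    (μ : Measure Ω) (ℱ : Filtration ℝ≥0 mΩ) (η : ℝ≥0 → Ω → Config 2) : Prop where
  exclusion : IsExclusionProcess p μ ℱ η
  initial : μ.map (η 0) = bernoulliProduct ρ

/-- Put a second-class particle at the origin; elsewhere keep the particles of `η` as
first-class particles. -/
def withSecondClass (η : Config 2) : Config 3 :=
  fun x => if x = 0 then 1 else if η x = 1 then 2 else 0

/-- `ζ` is the exclusion process with one second-class particle, started at the origin, the other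
sites being initially occupied by first-class particles independently with probability `ρ`. -/
structure IsSecondClassProcess (p : ℤ → ℝ) (ρ : unitInterval) {Ω : Type*} [mΩ : MeasurableSpace Ω]
    (μ : Measure Ω) (ℱ : Filtration ℝ≥0 mΩ) (ζ : ℝ≥0 → Ω → Config 3) : Prop where
  exclusion : IsExclusionProcess p μ ℱ ζ
  initial : μ.map (ζ 0) = (bernoulliProduct ρ).map withSecondClass

open Classical in
/-- The position of the second-class particle (`0` by convention if there is not exactly one). -/
def position (ζ : Config 3) : ℤ :=
  if h : ∃! x, ζ x = 1 then h.choose else 0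

/-- The two-point function `S(x,t) = E[(η_x(t) - ρ)(η_0(0) - ρ)]`. -/
def twoPoint (ρ : ℝ) {Ω : Type*} [MeasurableSpace Ω] (μ : Measure Ω) (η : ℝ≥0 → Ω → Config 2)
    (x : ℤ) (t : ℝ≥0) : ℝ :=
  ∫ ω, (occ (η t ω) x - ρ) * (occ (η 0 ω) 0 - ρ) ∂μ

/-- The diffusivity `D(t) = (χ t)⁻¹ ∑_x (x - (1 - 2ρ) b t)² S(x,t)` with `χ = ρ(1-ρ)`. -/
def diffusivity (p : ℤ → ℝ) (ρ : ℝ) {Ω : Type*} [MeasurableSpace Ω] (μ : Measure Ω)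
    (η : ℝ≥0 → Ω → Config 2) (t : ℝ≥0) : ℝ :=
  (ρ * (1 - ρ) * t)⁻¹ *
    ∑' x : ℤ, ((x : ℝ) - (1 - 2 * ρ) * drift p * t) ^ 2 * twoPoint ρ μ η x t

/-- The centered position `X̃(t) = X(t) - (1 - 2ρ) b t` of the second-class particle. -/
def centeredPosition (p : ℤ → ℝ) (ρ : ℝ) {Ω : Type*} (ζ : ℝ≥0 → Ω → Config 3)
    (t : ℝ≥0) (ω : Ω) : ℝ :=
  (position (ζ t ω) : ℝ) - (1 - 2 * ρ) * drift p * t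

/-- The event `η_z(0) = 1` that initially there is a first-class particle at `z`. -/
def initiallyOccupied {Ω : Type*} (ζ : ℝ≥0 → Ω → Config 3) (z : ℤ) : Set Ω :=
  {ω | ζ 0 ω z = 2}

end AEP

end

noncomputable section

namespace AEP

/-! Put `χ = ρ(1-ρ)`, `v = (1-2ρ)b`. Filling or emptying the origin of a Bernoulli configuration and
running both copies under one set of jump attempts leaves a single discrepancy, which moves as the
second-class particle. Hence `S(x,t) = χ P(X(t) = x)`, and more generally correlations with `(η_0(0)
- ρ) g`, for `g` a function of the initial configuration off the origin, are `χ` times expectations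
over `X` weighted by `g`.

The two-point function satisfies a continuity equation. Its `j`-th moment grows at the rate `∑_z
p(z) ∑_x ((x+z)^j - x^j) E[η_x(t)(1-η_{x+z}(t))(η_0(0)-ρ)]` (`IsStationaryProcess.hasSum_moment`),
so the pair correlations `E[η_x(t) η_{x+z}(t) (η_0(0)-ρ)]` are needed. Time reversal of the
stationary process is a reflection of space. Together with a translation it moves the pair to time
`0`, at the sites `0` and `z`; splitting `η_0 = (η_0 - ρ) + ρ` there gives `χ P(X(t) = x+z, η_z(0) =
1) + ρ S(x,t)` (`IsSecondClassProcess.pairCorrelation_eq`). The zeroth and first moments of this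
formula give the velocity `v` and the derivative of the second moment. The symmetry of a pair in its
two sites makes `E[X(t); η_z(0) = 1]` even in `z`, which folds the sum onto `z > 0`.

The processes are given only through a martingale problem on local functions. Expectations are
therefore identified as limits from rings of `2N+1` sites
(`IsExclusionProcess.tendsto_ringSemigroup`). There the generator is bounded, the semigroup is a
Poisson mixture of powers of one operator, and the merging of types and the reversal of the
Bernoulli measure are exact identities checked power by power. The limit is a Duhamel comparison.
Its error is controlled by the influence of single sites, weighted by `2^{-|x|}`, whose growth rate
does not depend on `N`. The same estimate with the weights `2^{|x|}` gives the exponential decay of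
correlations that makes all moments converge. -/

/-! ### Sorting along a bond -/

/-- The attempted jump from `x` to `y`: the contents are interchanged if and only if `y` holds a
lower type. -/
def sortMap {k : ℕ} (x y : ℤ) (ζ : Config k) : Config k :=
  if ζ y < ζ x then exchange ζ x y else ζ

/-- In the min/max form, continuity and compatibility with monotone relabelling are immediate, and
the degenerate bond `x = y` needs no separate treatment. -/
lemma sortMap_apply {k : ℕ} (x y : ℤ) (ζ : Config k) (u : ℤ) :
    sortMap x y ζ u =
      if u = x then min (ζ x) (ζ y) else if u = y then max (ζ x) (ζ y) else ζ u := by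
  unfold sortMap exchange
  split_ifs with h1 h2 h3 h2 h3
  · subst h2; simp [min_eq_right h1.le]
  · subst h3; simp [max_eq_left h1.le]
  · simp [Equiv.swap_apply_of_ne_of_ne h2 h3]
  · subst h2; simp [min_eq_left (not_lt.mp h1)]
  · subst h3; simp [max_eq_right (not_lt.mp h1)]
  · rfl

lemma continuous_sortMap {k : ℕ} (x y : ℤ) : Continuous (sortMap x y : Config k → Config k) := by
  refine continuous_pi fun u => ?_
  simp only [sortMap_apply]
  have h : ∀ F : Fin k × Fin k → Fin k,
      Continuous fun ζ : Config k => F (ζ x, ζ y) := fun F =>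
    continuous_of_discreteTopology.comp ((continuous_apply x).prodMk (continuous_apply y))
  split_ifs
  · exact h fun q => min q.1 q.2
  · exact h fun q => max q.1 q.2
  · exact continuous_apply u

/-- Composition with `sortMap`, as an operator on continuous functions. -/
def sortOp {k : ℕ} (x y : ℤ) : C(Config k, ℝ) →L[ℝ] C(Config k, ℝ) :=
  LinearMap.mkContinuous
    { toFun := fun f => f.comp ⟨sortMap x y, continuous_sortMap x y⟩
      map_add' := fun _ _ => rfl
      map_smul' := fun _ _ => rfl } 1
    fun f => by
      rw [one_mul, ContinuousMap.norm_le _ (norm_nonneg _)]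
      exact fun ζ => f.norm_coe_le_norm _

@[simp]
lemma sortOp_apply {k : ℕ} (x y : ℤ) (f : C(Config k, ℝ)) (ζ : Config k) :
    sortOp x y f ζ = f (sortMap x y ζ) := rfl

/-- A merging of types that respects priorities commutes with sorting. -/
lemma comp_sortMap_of_monotone {k l : ℕ} {m : Fin k → Fin l} (hm : Monotone m) (x y : ℤ)
    (ζ : Config k) : (fun u => m (sortMap x y ζ u)) = sortMap x y fun u => m (ζ u) := by
  funext u
  simp only [sortMap_apply]
  split_ifs
  · exact hm.map_min
  · exact hm.map_max
  · rfl

/-! ### Semigroups with a bounded generator -/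

section Semigroup

variable {E : Type*} [NormedAddCommGroup E] [NormedSpace ℝ E]

/-- The semigroup `exp (t (Q - K))`. -/
def expSemigroup (Q : E →L[ℝ] E) (K t : ℝ) : E →L[ℝ] E :=
  Real.exp (-(K * t)) • NormedSpace.exp (t • Q)

/-- Uniformization: a Poisson mixture of the powers of `Q`. Identities and bounds for the semigroup
are reduced to these powers. -/
lemma hasSum_expSemigroup [CompleteSpace E] (Q : E →L[ℝ] E) (K t : ℝ) (f : E) :
    HasSum (fun n : ℕ => (Real.exp (-(K * t)) * (t ^ n / n.factorial)) • (Q ^ n) f)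
      (expSemigroup Q K t f) := by
  have h := (NormedSpace.exp_series_hasSum_exp' (𝕂 := ℝ) (t • Q)).mapL
    (ContinuousLinearMap.apply ℝ E f)
  have h2 := h.const_smul (Real.exp (-(K * t)))
  have h3 : (fun n : ℕ => (Real.exp (-(K * t)) * (t ^ n / n.factorial)) • (Q ^ n) f) =
      fun n : ℕ => Real.exp (-(K * t)) •
        ContinuousLinearMap.apply ℝ E f ((n.factorial : ℝ)⁻¹ • (t • Q) ^ n) := by
    funext n
    simp [smul_pow, smul_smul, div_eq_inv_mul]
  rw [h3]
  exact h2

lemma expSemigroup_zero (Q : E →L[ℝ] E) (K : ℝ) (f : E) : expSemigroup Q K 0 f = f := by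
  simp [expSemigroup]

lemma hasDerivAt_expSemigroup [CompleteSpace E] (Q : E →L[ℝ] E) (K t : ℝ) (f : E) :
    HasDerivAt (fun s => expSemigroup Q K s f)
      (Q (expSemigroup Q K t f) - K • expSemigroup Q K t f) t := by
  have h1 : HasDerivAt (fun s : ℝ => Real.exp (-(K * s))) (Real.exp (-(K * t)) * (-(K * 1))) t :=
    (((hasDerivAt_id t).const_mul K).neg).exp
  have h2 : HasDerivAt (fun s : ℝ => NormedSpace.exp (s • Q)) (Q * NormedSpace.exp (t • Q)) t :=
    hasDerivAt_exp_smul_const' (𝕂 := ℝ) Q t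
  have h3 := (h1.smul h2).clm_apply (hasDerivAt_const t f)
  refine h3.congr_deriv ?_
  simp [expSemigroup, smul_smul, mul_comm, sub_eq_add_neg]

/-- The coefficients of the series depend on `K` and `t` only, so an identity between functionals of
the powers passes to the semigroups, even on different spaces. -/
lemma expSemigroup_comm [CompleteSpace E] {E' G : Type*} [NormedAddCommGroup E'] [NormedSpace ℝ E']
    [CompleteSpace E'] [NormedAddCommGroup G] [NormedSpace ℝ G]
    {Q : E →L[ℝ] E} {Q' : E' →L[ℝ] E'} (K t : ℝ) (φ : E →L[ℝ] G) (ψ : E' →L[ℝ] G) {f : E} {g : E'}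
    (h : ∀ n : ℕ, φ ((Q ^ n) f) = ψ ((Q' ^ n) g)) :
    φ (expSemigroup Q K t f) = ψ (expSemigroup Q' K t g) := by
  have h1 := (hasSum_expSemigroup Q K t f).mapL φ
  have h2 := (hasSum_expSemigroup Q' K t g).mapL ψ
  simp only [map_smul, h] at h1 h2
  exact h1.unique h2

/-- The factor `exp (-(K t))` removes the rate `K` from the growth `(K + C)^n`. On a ring `K` is of
the order of the volume, and only `C` survives. -/
lemma abs_expSemigroup_le [CompleteSpace E] {Q : E →L[ℝ] E} {K C M t : ℝ} (ht : 0 ≤ t) (φ : E →L[ℝ] ℝ) {f : E}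
    (h : ∀ n : ℕ, |φ ((Q ^ n) f)| ≤ M * (K + C) ^ n) :
    |φ (expSemigroup Q K t f)| ≤ M * Real.exp (C * t) := by
  have h1 := (hasSum_expSemigroup Q K t f).mapL φ
  have h2 : HasSum (fun n : ℕ => Real.exp (-(K * t)) * M * (((K + C) * t) ^ n / n.factorial))
      (Real.exp (-(K * t)) * M * Real.exp ((K + C) * t)) := by
    refine HasSum.mul_left _ ?_
    rw [Real.exp_eq_exp_ℝ]
    exact NormedSpace.expSeries_div_hasSum_exp _
  have h3 : Real.exp (-(K * t)) * M * Real.exp ((K + C) * t) = M * Real.exp (C * t) := by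
    rw [mul_comm (Real.exp _) M, mul_assoc, ← Real.exp_add]
    ring_nf
  rw [h3] at h2
  rw [← h1.tsum_eq, ← h2.tsum_eq, ← Real.norm_eq_abs]
  refine tsum_of_norm_bounded h2.summable.hasSum fun n => ?_
  have hc : 0 ≤ Real.exp (-(K * t)) * (t ^ n / n.factorial) := by positivity
  rw [map_smul, smul_eq_mul, norm_mul, Real.norm_eq_abs, Real.norm_eq_abs, abs_of_nonneg hc]
  refine (mul_le_mul_of_nonneg_left (h n) hc).trans (le_of_eq ?_)
  rw [mul_pow]
  ring

end Semigroup

/-! ### Influence of single sites -/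

/-- Changing the content of a single site `u` changes the value of `f` by at most `M * w u`. -/
def HasInfluence {k : ℕ} (w : ℤ → ℝ) (M : ℝ) (f : C(Config k, ℝ)) : Prop :=
  ∀ u ζ a, |f (Function.update ζ u a) - f ζ| ≤ M * w u

lemma HasInfluence.abs_sub_le {k : ℕ} {w : ℤ → ℝ} {M : ℝ} {f : C(Config k, ℝ)}
    (h : HasInfluence w M f) {x y : ℤ} {ζ ζ' : Config k}
    (hζ : ∀ u, u ≠ x → u ≠ y → ζ' u = ζ u) : |f ζ' - f ζ| ≤ M * (w x + w y) := by
  have h1 : ζ' = Function.update (Function.update ζ x (ζ' x)) y (ζ' y) := by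
    funext u
    by_cases hy : u = y
    · subst hy; simp
    · by_cases hx : u = x
      · subst hx; simp [hy]
      · simp [hx, hy, hζ]
  have h2 := h x ζ (ζ' x)
  have h3 := h y (Function.update ζ x (ζ' x)) (ζ' y)
  rw [← h1] at h3
  have := _root_.abs_sub_le (f ζ') (f (Function.update ζ x (ζ' x))) (f ζ)
  linarith

lemma HasInfluence.abs_sortMap_sub_le {k : ℕ} {w : ℤ → ℝ} {M : ℝ} {f : C(Config k, ℝ)}
    (h : HasInfluence w M f) (x y : ℤ) (ζ : Config k) :
    |f (sortMap x y ζ) - f ζ| ≤ M * (w x + w y) :=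
  h.abs_sub_le fun u hx hy => by simp [sortMap_apply, hx, hy]

/-- Off the bond, updating and sorting commute. On the bond, the discrepancy stays within `{x, y}`,
and the weights of its two ends are comparable. -/
lemma HasInfluence.abs_sortMap_update_le {k : ℕ} {w : ℤ → ℝ} {M C : ℝ} {f : C(Config k, ℝ)}
    (h : HasInfluence w M f) (hM : 0 ≤ M) {x y : ℤ} (hxy : w y ≤ C * w x)
    (hyx : w x ≤ C * w y) (u : ℤ) (ζ : Config k) (a : Fin k) :
    |f (sortMap x y (Function.update ζ u a)) - f (sortMap x y ζ)| ≤
      M * w u * (1 + C * ((if x = u then 1 else 0) + if y = u then 1 else 0)) := by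
  have hw : ∀ v, 0 ≤ M * w v := fun v => (abs_nonneg _).trans (h v ζ (ζ v))
  by_cases hu : u ≠ x ∧ u ≠ y
  · have : sortMap x y (Function.update ζ u a) = Function.update (sortMap x y ζ) u a := by
      funext v
      by_cases hv : v = u
      · subst hv; simp [sortMap_apply, hu.1, hu.2]
      · simp [sortMap_apply, hv, hu.1.symm, hu.2.symm]
    rw [this, if_neg hu.1.symm, if_neg hu.2.symm]
    simpa using h u (sortMap x y ζ) a
  · have h1 : |f (sortMap x y (Function.update ζ u a)) - f (sortMap x y ζ)| ≤ M * (w x + w y) := by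
      refine h.abs_sub_le fun v hx hy => ?_
      have hv : v ≠ u := by rintro rfl; exact hu ⟨hx, hy⟩
      simp [sortMap_apply, hx, hy, hv]
    refine h1.trans ?_
    have hwx := mul_le_mul_of_nonneg_left hxy hM
    have hwy := mul_le_mul_of_nonneg_left hyx hM
    have := hw x
    have := hw y
    by_cases hx : x = u <;> by_cases hy : y = u
    · subst hx; subst hy; simp; nlinarith
    · subst hx; simp [hy]; nlinarith
    · subst hy; simp [hx]; nlinarith
    · exact absurd ⟨Ne.symm hx, Ne.symm hy⟩ hu

/-! ### The exclusion process on a ring -/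

/-- The representative in `[-N, N]` modulo `2 N + 1`. -/
def wrap (N : ℕ) (x : ℤ) : ℤ := x.bmod (2 * N + 1)

lemma wrap_mem (N : ℕ) (x : ℤ) : wrap N x ∈ Finset.Icc (-N : ℤ) N := by
  have h1 := Int.le_bmod (x := x) (m := 2 * N + 1) (by omega)
  have h2 := Int.bmod_lt (x := x) (m := 2 * N + 1) (by omega)
  rw [Finset.mem_Icc, wrap]
  push_cast at *
  omega

lemma wrap_of_mem {N : ℕ} {x : ℤ} (hx : x ∈ Finset.Icc (-N : ℤ) N) : wrap N x = x := by
  rw [Finset.mem_Icc] at hx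
  refine Int.bmod_eq_of_le ?_ ?_ <;> push_cast <;> omega

lemma wrap_wrap_add (N : ℕ) (x z : ℤ) : wrap N (wrap N x + z) = wrap N (x + z) :=
  Int.bmod_add_bmod

lemma wrap_wrap_sub (N : ℕ) (x z : ℤ) : wrap N (wrap N x - z) = wrap N (x - z) :=
  Int.bmod_sub_bmod

lemma wrap_neg (N : ℕ) (x : ℤ) : wrap N (-x) = -wrap N x := by
  have h : wrap N (-wrap N x) = wrap N (-x) := Int.bmod_neg_bmod
  rw [← h]
  refine wrap_of_mem ?_
  have := Finset.mem_Icc.mp (wrap_mem N x)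
  rw [Finset.mem_Icc]
  omega

lemma wrap_of_lt {N : ℕ} {x : ℤ} (h1 : N < x) (h2 : x ≤ 3 * N + 1) :
    wrap N x = x - (2 * N + 1) := by
  have h : wrap N (x - ((2 * N + 1 : ℕ) : ℤ)) = wrap N x := Int.sub_bmod_right x (2 * N + 1)
  rw [← h, wrap_of_mem]
  · push_cast; ring
  · rw [Finset.mem_Icc]; push_cast; omega

lemma wrap_of_gt {N : ℕ} {x : ℤ} (h1 : x < -N) (h2 : -(3 * N + 1) ≤ x) :
    wrap N x = x + (2 * N + 1) := by
  have := wrap_of_lt (N := N) (x := -x) (by omega) (by omega)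
  rw [wrap_neg] at this
  omega

/-- Crossing the seam of the ring is harmless because its two ends `-N` and `N` have the same
absolute value. -/
lemma natAbs_wrap_add {N R : ℕ} (hR : R ≤ N) {x z : ℤ} (hx : x ∈ Finset.Icc (-N : ℤ) N)
    (hz : z ∈ Finset.Icc (-R : ℤ) R) :
    (wrap N (x + z)).natAbs ≤ x.natAbs + R ∧ x.natAbs ≤ (wrap N (x + z)).natAbs + R := by
  rw [Finset.mem_Icc] at hx hz
  rcases lt_or_ge (N : ℤ) (x + z) with h | h
  · rw [wrap_of_lt h (by omega)]; omega
  rcases lt_or_ge (x + z) (-N : ℤ) with h' | h'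
  · rw [wrap_of_gt h' (by omega)]; omega
  rw [wrap_of_mem (Finset.mem_Icc.mpr ⟨h', h⟩)]; omega

/-- Translation modulo `2 N + 1` permutes the ring. -/
lemma sum_wrap_add {M : Type*} [AddCommMonoid M] (N : ℕ) (z : ℤ) (F : ℤ → ℤ → M) :
    ∑ x ∈ Finset.Icc (-N : ℤ) N, F x (wrap N (x + z)) =
      ∑ y ∈ Finset.Icc (-N : ℤ) N, F (wrap N (y - z)) y := by
  refine Finset.sum_bij' (fun x _ => wrap N (x + z)) (fun y _ => wrap N (y - z))
    (fun _ _ => wrap_mem _ _) (fun _ _ => wrap_mem _ _) ?_ ?_ ?_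
  · intro x hx; rw [wrap_wrap_sub, add_sub_cancel_right, wrap_of_mem hx]
  · intro x hx; rw [wrap_wrap_add, sub_add_cancel, wrap_of_mem hx]
  · intro x hx; rw [wrap_wrap_sub, add_sub_cancel_right, wrap_of_mem hx]

/-- The gain part of the generator on the ring. -/
def ringOp (p : ℤ → ℝ) (R N k : ℕ) : C(Config k, ℝ) →L[ℝ] C(Config k, ℝ) :=
  ∑ x ∈ Finset.Icc (-N : ℤ) N, ∑ z ∈ Finset.Icc (-R : ℤ) R, p z • sortOp x (wrap N (x + z))

/-- The total jump rate on the ring. -/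
def ringRate (p : ℤ → ℝ) (R N : ℕ) : ℝ :=
  ∑ _x ∈ Finset.Icc (-N : ℤ) N, ∑ z ∈ Finset.Icc (-R : ℤ) R, p z

lemma ringOp_apply (p : ℤ → ℝ) (R N : ℕ) {k : ℕ} (f : C(Config k, ℝ)) (ζ : Config k) :
    ringOp p R N k f ζ = ∑ x ∈ Finset.Icc (-N : ℤ) N, ∑ z ∈ Finset.Icc (-R : ℤ) R,
      p z * f (sortMap x (wrap N (x + z)) ζ) := by
  simp [ringOp, ContinuousMap.sum_apply]

/-- The semigroup of the exclusion process on the ring. -/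
abbrev ringSemigroup (p : ℤ → ℝ) (R N k : ℕ) (t : ℝ) : C(Config k, ℝ) →L[ℝ] C(Config k, ℝ) :=
  expSemigroup (ringOp p R N k) (ringRate p R N) t

/-- A given site starts attempted jumps at rate `1` and is the target of attempts at rate `1`. Every
attempt contributes the old influence, which adds up to the total rate, and those touching the site
contribute at most `C` more. -/
lemma HasInfluence.ringOp {k : ℕ} {p : ℤ → ℝ} (hp : ∀ z, 0 ≤ p z) {R N : ℕ}
    (hp1 : ∑ z ∈ Finset.Icc (-R : ℤ) R, p z = 1) {w : ℤ → ℝ} {M C : ℝ} {f : C(Config k, ℝ)}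
    (hC : 0 ≤ C)
    (hw : ∀ x ∈ Finset.Icc (-N : ℤ) N, ∀ z ∈ Finset.Icc (-R : ℤ) R,
      w (wrap N (x + z)) ≤ C * w x ∧ w x ≤ C * w (wrap N (x + z)))
    (hM : 0 ≤ M) (h : HasInfluence w M f) :
    HasInfluence w (M * (ringRate p R N + 2 * C)) (ringOp p R N k f) := by
  intro u ζ a
  have hwu : 0 ≤ M * w u := (abs_nonneg _).trans (h u ζ (ζ u))
  rw [ringOp_apply, ringOp_apply, ← Finset.sum_sub_distrib]
  simp only [← Finset.sum_sub_distrib, ← mul_sub]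
  refine (Finset.abs_sum_le_sum_abs _ _).trans ((Finset.sum_le_sum fun x hx =>
    (Finset.abs_sum_le_sum_abs _ _).trans (Finset.sum_le_sum fun z hz => (?_ : _ ≤
      p z * (M * w u * (1 + C * ((if x = u then 1 else 0) +
        if wrap N (x + z) = u then 1 else 0)))))).trans ?_)
  · rw [abs_mul, abs_of_nonneg (hp z)]
    exact mul_le_mul_of_nonneg_left
      (h.abs_sortMap_update_le hM (hw x hx z hz).1 (hw x hx z hz).2 u ζ a) (hp z)
  have e1 : ∑ x ∈ Finset.Icc (-N : ℤ) N, ∑ z ∈ Finset.Icc (-R : ℤ) R,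
      p z * (if x = u then (1 : ℝ) else 0) ≤ 1 := by
    simp_rw [← Finset.sum_mul, hp1, one_mul]
    rw [Finset.sum_ite_eq']
    split_ifs <;> norm_num
  -- For fixed `z`, translation permutes the ring, so exactly one starting point aims at `u`.
  have e2 : ∑ x ∈ Finset.Icc (-N : ℤ) N, ∑ z ∈ Finset.Icc (-R : ℤ) R,
      p z * (if wrap N (x + z) = u then (1 : ℝ) else 0) ≤ 1 := by
    rw [Finset.sum_comm]
    simp_rw [← Finset.mul_sum]
    refine le_of_le_of_eq ?_ hp1
    refine Finset.sum_le_sum fun z hz => ?_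
    rw [sum_wrap_add N z fun _ y => if y = u then (1 : ℝ) else 0, Finset.sum_ite_eq']
    refine mul_le_of_le_one_right (hp z) ?_
    split_ifs <;> norm_num
  have e3 : ∑ x ∈ Finset.Icc (-N : ℤ) N, ∑ z ∈ Finset.Icc (-R : ℤ) R,
      p z * (M * w u * (1 + C * ((if x = u then 1 else 0) +
        if wrap N (x + z) = u then 1 else 0))) = M * w u * (ringRate p R N +
      C * (∑ x ∈ Finset.Icc (-N : ℤ) N, ∑ z ∈ Finset.Icc (-R : ℤ) R,
        p z * (if x = u then (1 : ℝ) else 0) + ∑ x ∈ Finset.Icc (-N : ℤ) N,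
          ∑ z ∈ Finset.Icc (-R : ℤ) R, p z * (if wrap N (x + z) = u then (1 : ℝ) else 0))) := by
    simp only [ringRate, Finset.mul_sum, ← Finset.sum_add_distrib]
    refine Finset.sum_congr rfl fun x _ => Finset.sum_congr rfl fun z _ => ?_
    ring
  rw [e3]
  have : M * (ringRate p R N + 2 * C) * w u = M * w u * (ringRate p R N + 2 * C) := by ring
  rw [this]
  refine mul_le_mul_of_nonneg_left ?_ hwu
  nlinarith

lemma HasInfluence.ringSemigroup {k : ℕ} {p : ℤ → ℝ} (hp : ∀ z, 0 ≤ p z) {R N : ℕ}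
    (hp1 : ∑ z ∈ Finset.Icc (-R : ℤ) R, p z = 1) {w : ℤ → ℝ} {M C : ℝ} {f : C(Config k, ℝ)}
    (hC : 0 ≤ C)
    (hw : ∀ x ∈ Finset.Icc (-N : ℤ) N, ∀ z ∈ Finset.Icc (-R : ℤ) R,
      w (wrap N (x + z)) ≤ C * w x ∧ w x ≤ C * w (wrap N (x + z)))
    (hM : 0 ≤ M) (h : HasInfluence w M f) {t : ℝ} (ht : 0 ≤ t) :
    HasInfluence w (M * Real.exp (2 * C * t)) (ringSemigroup p R N k t f) := by
  have hK : 0 ≤ ringRate p R N :=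
    Finset.sum_nonneg fun _ _ => Finset.sum_nonneg fun z _ => hp z
  have h1 : ∀ n : ℕ, HasInfluence w (M * (ringRate p R N + 2 * C) ^ n)
      ((AEP.ringOp p R N k ^ n) f) := by
    intro n
    induction n with
    | zero => simpa using h
    | succ n ih =>
      rw [pow_succ, pow_succ', ← mul_assoc]
      exact ih.ringOp hp hp1 hC hw (by positivity)
  intro u ζ a
  have h2 := abs_expSemigroup_le (Q := AEP.ringOp p R N k) (K := ringRate p R N) (C := 2 * C)
    (M := M * w u) ht
    (ContinuousMap.evalCLM ℝ (Function.update ζ u a) - ContinuousMap.evalCLM ℝ ζ) (f := f)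
    fun n => by
      have := h1 n u ζ a
      simp only [sub_apply, ContinuousMap.evalCLM_apply]
      linarith
  simp only [sub_apply, ContinuousMap.evalCLM_apply] at h2
  linarith

/-- The weights `r ^ |x|` vary by a bounded factor along the bonds of a ring. -/
lemma pow_natAbs_wrap {N R : ℕ} (hR : R ≤ N) {r c : ℝ} (hr : 0 < r) (hc : 1 ≤ c) (h1 : r ≤ c)
    (h2 : r⁻¹ ≤ c) {x z : ℤ} (hx : x ∈ Finset.Icc (-N : ℤ) N)
    (hz : z ∈ Finset.Icc (-R : ℤ) R) :
    r ^ (wrap N (x + z)).natAbs ≤ c ^ R * r ^ x.natAbs ∧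
      r ^ x.natAbs ≤ c ^ R * r ^ (wrap N (x + z)).natAbs := by
  have key : ∀ a b : ℕ, a ≤ b + R → b ≤ a + R → r ^ a ≤ c ^ R * r ^ b := by
    intro a b hab hba
    rcases le_total a b with h | h
    · obtain ⟨d, rfl⟩ := Nat.exists_eq_add_of_le h
      have : r ^ a = r⁻¹ ^ d * r ^ (a + d) := by
        rw [pow_add, inv_pow]; field_simp
      rw [this]
      refine mul_le_mul_of_nonneg_right ?_ (by positivity)
      exact (pow_le_pow_left₀ (by positivity) h2 d).trans (pow_le_pow_right₀ hc (by omega))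
    · obtain ⟨d, rfl⟩ := Nat.exists_eq_add_of_le h
      rw [pow_add, mul_comm]
      refine mul_le_mul_of_nonneg_right ?_ (by positivity)
      exact (pow_le_pow_left₀ (by positivity) h1 d).trans (pow_le_pow_right₀ hc (by omega))
  have := natAbs_wrap_add hR hx hz
  exact ⟨key _ _ this.1 this.2, key _ _ this.2 this.1⟩

/-! ### Summable weights on `ℤ` -/

lemma summable_natAbs_pow_mul_geometric (j : ℕ) :
    Summable fun x : ℤ => (x.natAbs : ℝ) ^ j * (1 / 2 : ℝ) ^ x.natAbs := by
  have h : Summable fun n : ℕ => (n : ℝ) ^ j * (1 / 2 : ℝ) ^ n :=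
    summable_pow_mul_geometric_of_norm_lt_one j (by norm_num)
  exact Summable.of_nat_of_neg (by simpa using h) (by simpa using h)

lemma summable_geometric_natAbs : Summable fun x : ℤ => (1 / 2 : ℝ) ^ x.natAbs := by
  simpa using summable_natAbs_pow_mul_geometric 0

/-- The mass of the geometric weights outside `[-J, J]`. -/
def geometricTail (J : ℕ) : ℝ :=
  ∑' x : ℤ, if x ∈ Finset.Icc (-J : ℤ) J then 0 else (1 / 2 : ℝ) ^ x.natAbs

lemma geometricTail_summable (J : ℕ) :
    Summable fun x : ℤ => if x ∈ Finset.Icc (-J : ℤ) J then 0 else (1 / 2 : ℝ) ^ x.natAbs := by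
  refine Summable.of_nonneg_of_le (fun x => ?_) (fun x => ?_) summable_geometric_natAbs <;>
  split_ifs <;> first | positivity | exact le_rfl

lemma tendsto_geometricTail : Tendsto geometricTail atTop (𝓝 0) := by
  have h := tendsto_tsum_of_dominated_convergence (𝓕 := atTop)
    (f := fun (J : ℕ) (x : ℤ) => if x ∈ Finset.Icc (-J : ℤ) J then 0 else (1 / 2 : ℝ) ^ x.natAbs)
    (g := fun _ => 0) summable_geometric_natAbs ?_ ?_
  · rw [tsum_zero] at h
    exact h
  · intro x
    refine tendsto_const_nhds.congr' ?_
    filter_upwards [eventually_ge_atTop x.natAbs] with J hJ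
    rw [if_pos]
    rw [Finset.mem_Icc]
    omega
  · refine Eventually.of_forall fun J x => ?_
    split_ifs
    · simp
    · rw [Real.norm_eq_abs, abs_of_nonneg (by positivity)]

/-! ### The generator on local functions -/

lemma ite_exchange_eq_sortMap (p : ℤ → ℝ) {k : ℕ} (f : Config k → ℝ) (ζ : Config k) (x z : ℤ) :
    (if ζ (x + z) < ζ x then p z * (f (exchange ζ x (x + z)) - f ζ) else 0) =
      p z * (f (sortMap x (x + z) ζ) - f ζ) := by
  unfold sortMap
  split_ifs <;> simp

lemma sortMap_congr {k : ℕ} {x y : ℤ} {B : Set ℤ} (hx : x ∈ B) (hy : y ∈ B) {ζ ζ' : Config k}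
    (h : ∀ u ∈ B, ζ u = ζ' u) : ∀ u ∈ B, sortMap x y ζ u = sortMap x y ζ' u := by
  intro u hu
  simp only [sortMap_apply, h x hx, h y hy, h u hu]

/-- The generator restricted to jumps that start in `[-L, L]`. -/
def boxGenerator (p : ℤ → ℝ) (R L : ℕ) {k : ℕ} (f : C(Config k, ℝ)) : C(Config k, ℝ) :=
  ∑ x ∈ Finset.Icc (-L : ℤ) L, ∑ z ∈ Finset.Icc (-R : ℤ) R, p z • (sortOp x (x + z) f - f)

lemma boxGenerator_apply (p : ℤ → ℝ) (R L : ℕ) {k : ℕ} (f : C(Config k, ℝ)) (ζ : Config k) :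
    boxGenerator p R L f ζ = ∑ x ∈ Finset.Icc (-L : ℤ) L, ∑ z ∈ Finset.Icc (-R : ℤ) R,
      p z * (f (sortMap x (x + z) ζ) - f ζ) := by
  simp [boxGenerator, ContinuousMap.sum_apply]

/-- A jump that starts outside `[-(m+R), m+R]` does not reach the sites on which `f` depends. -/
lemma generator_eq_boxGenerator {p : ℤ → ℝ} {R m L : ℕ} {k : ℕ}
    (hR : ∀ z : ℤ, z ∉ Finset.Icc (-R : ℤ) R → p z = 0)
    {f : C(Config k, ℝ)} (hf : DependsOn f (Set.Icc (-m : ℤ) m)) (hL : m + R ≤ L)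
    (ζ : Config k) : generator p f ζ = boxGenerator p R L f ζ := by
  unfold generator
  simp_rw [ite_exchange_eq_sortMap, boxGenerator_apply]
  have h1 : ∀ x : ℤ, ∑' z, p z * (f (sortMap x (x + z) ζ) - f ζ) =
      ∑ z ∈ Finset.Icc (-R : ℤ) R, p z * (f (sortMap x (x + z) ζ) - f ζ) := fun x =>
    tsum_eq_sum fun z hz => by rw [hR z hz, zero_mul]
  simp_rw [h1]
  refine tsum_eq_sum fun x hx => Finset.sum_eq_zero fun z hz => ?_
  rw [Finset.mem_Icc] at hx hz
  have : f (sortMap x (x + z) ζ) = f ζ := by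
    refine hf fun u hu => ?_
    rw [Set.mem_Icc] at hu
    rw [sortMap_apply, if_neg (by omega), if_neg (by omega)]
  rw [this, sub_self, mul_zero]

lemma dependsOn_boxGenerator {p : ℤ → ℝ} {R n L : ℕ} {k : ℕ} {f : C(Config k, ℝ)}
    (hf : DependsOn f (Set.Icc (-n : ℤ) n)) (hn : L + R ≤ n) :
    DependsOn (boxGenerator p R L f) (Set.Icc (-n : ℤ) n) := by
  intro ζ ζ' h
  simp_rw [boxGenerator_apply]
  refine Finset.sum_congr rfl fun x hx => Finset.sum_congr rfl fun z hz => ?_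
  rw [Finset.mem_Icc] at hx hz
  rw [hf h, hf (sortMap_congr (Set.mem_Icc.mpr ⟨by omega, by omega⟩)
    (Set.mem_Icc.mpr ⟨by omega, by omega⟩) h)]

lemma dependsOn_ringOp {p : ℤ → ℝ} {R n N : ℕ} {k : ℕ} {f : C(Config k, ℝ)}
    (hf : DependsOn f (Set.Icc (-n : ℤ) n)) (hn : N ≤ n) :
    DependsOn (ringOp p R N k f) (Set.Icc (-n : ℤ) n) := by
  intro ζ ζ' h
  simp_rw [ringOp_apply]
  refine Finset.sum_congr rfl fun x hx => Finset.sum_congr rfl fun z hz => ?_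
  have hw := Finset.mem_Icc.mp (wrap_mem N (x + z))
  rw [Finset.mem_Icc] at hx
  rw [hf (sortMap_congr (Set.mem_Icc.mpr ⟨by omega, by omega⟩)
    (Set.mem_Icc.mpr ⟨by omega, by omega⟩) h)]

/-- Evolution on the ring keeps a local function local, so the martingale problem can be applied to
the evolved function. -/
lemma dependsOn_ringSemigroup {p : ℤ → ℝ} {R n N : ℕ} {k : ℕ} {f : C(Config k, ℝ)}
    (hf : DependsOn f (Set.Icc (-n : ℤ) n)) (hn : N ≤ n) (t : ℝ) :
    DependsOn (ringSemigroup p R N k t f) (Set.Icc (-n : ℤ) n) := by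
  have h1 : ∀ j : ℕ, DependsOn ((ringOp p R N k ^ j) f) (Set.Icc (-n : ℤ) n) := by
    intro j
    induction j with
    | zero => simpa using hf
    | succ j ih =>
      rw [pow_succ']
      exact dependsOn_ringOp ih hn
  intro ζ ζ' h
  exact expSemigroup_comm (ringRate p R N) t (ContinuousMap.evalCLM ℝ ζ)
    (ContinuousMap.evalCLM ℝ ζ') (Q := ringOp p R N k) (Q' := ringOp p R N k) fun j => h1 j h

/-- The weights are at least `2^{-m}` on the support, which explains the factor `2^m`. -/
lemma DependsOn.hasInfluence {k m : ℕ} {f : C(Config k, ℝ)}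
    (hf : DependsOn f (Set.Icc (-m : ℤ) m)) :
    HasInfluence (fun x : ℤ => (1 / 2 : ℝ) ^ x.natAbs) (2 * ‖f‖ * 2 ^ m) f := by
  intro u ζ a
  by_cases hu : u ∈ Set.Icc (-m : ℤ) m
  · have h1 : |f (Function.update ζ u a) - f ζ| ≤ 2 * ‖f‖ := by
      have h1 := f.norm_coe_le_norm (Function.update ζ u a)
      have h2 := f.norm_coe_le_norm ζ
      rw [Real.norm_eq_abs] at h1 h2
      have := abs_sub (f (Function.update ζ u a)) (f ζ)
      linarith
    refine h1.trans ?_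
    rw [mul_assoc]
    refine le_mul_of_one_le_right (by positivity) ?_
    rw [Set.mem_Icc] at hu
    calc (1 : ℝ) = 2 ^ m * (1 / 2) ^ m := by rw [← mul_pow]; norm_num
      _ ≤ 2 ^ m * (1 / 2) ^ u.natAbs := mul_le_mul_of_nonneg_left
          (pow_le_pow_of_le_one (by norm_num) (by norm_num) (by omega)) (by positivity)
  · have h1 : f (Function.update ζ u a) = f ζ :=
      hf fun v hv => Function.update_of_ne (ne_of_mem_of_not_mem hv hu) _ _
    rw [h1, sub_self, abs_zero]
    positivity

/-- The generators on the line and on the ring differ little on functions that hardly depend on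
far away sites. -/
lemma norm_boxGenerator_sub_le {p : ℤ → ℝ} (hp : ∀ z, 0 ≤ p z) {R N n k : ℕ} (hRN : R ≤ N)
    (hn : N ≤ n) (hp1 : ∑ z ∈ Finset.Icc (-R : ℤ) R, p z = 1) {M : ℝ} (hM : 0 ≤ M)
    {f : C(Config k, ℝ)} (hf : HasInfluence (fun x : ℤ => (1 / 2 : ℝ) ^ x.natAbs) M f) :
    ‖boxGenerator p R (n + R) f - (ringOp p R N k f - ringRate p R N • f)‖ ≤
      2 * (M * (1 + 2 ^ R)) * geometricTail (N - R) := by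
  have htail : 0 ≤ geometricTail (N - R) := tsum_nonneg fun x => by split_ifs <;> positivity
  rw [ContinuousMap.norm_le _ (by positivity)]
  intro ζ
  set c := M * (1 + 2 ^ R : ℝ) with hc
  have hc0 : 0 ≤ c := by positivity
  have hw : ∀ x y : ℤ, x.natAbs ≤ y.natAbs + R →
      (1 / 2 : ℝ) ^ y.natAbs ≤ 2 ^ R * (1 / 2) ^ x.natAbs := by
    intro x y h
    calc (1 / 2 : ℝ) ^ y.natAbs = 2 ^ R * (1 / 2) ^ (y.natAbs + R) := by
          rw [pow_add, mul_comm, mul_assoc, ← mul_pow]; norm_num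
      _ ≤ _ := mul_le_mul_of_nonneg_left
          (pow_le_pow_of_le_one (by norm_num) (by norm_num) h) (by positivity)
  have hab : ∀ x : ℤ, ∀ y : ℤ → ℤ,
      (∀ z ∈ Finset.Icc (-R : ℤ) R, x.natAbs ≤ (y z).natAbs + R) →
      |∑ z ∈ Finset.Icc (-R : ℤ) R, p z * (f (sortMap x (y z) ζ) - f ζ)| ≤
        c * (1 / 2) ^ x.natAbs := by
    intro x y h
    calc _ ≤ ∑ z ∈ Finset.Icc (-R : ℤ) R, p z * (c * (1 / 2) ^ x.natAbs) := by
          refine (Finset.abs_sum_le_sum_abs _ _).trans (Finset.sum_le_sum fun z hz => ?_)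
          rw [abs_mul, abs_of_nonneg (hp z)]
          refine mul_le_mul_of_nonneg_left ((hf.abs_sortMap_sub_le x (y z) ζ).trans ?_) (hp z)
          have := mul_le_mul_of_nonneg_left (hw x (y z) (h z hz)) hM
          rw [hc]
          linarith
      _ = _ := by rw [← Finset.sum_mul, hp1, one_mul]
  have e : (boxGenerator p R (n + R) f - (ringOp p R N k f - ringRate p R N • f)) ζ =
      ∑ x ∈ Finset.Icc (-(n + R : ℕ) : ℤ) (n + R : ℕ),
        (∑ z ∈ Finset.Icc (-R : ℤ) R, p z * (f (sortMap x (x + z) ζ) - f ζ) -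
          if x ∈ Finset.Icc (-N : ℤ) N then
            ∑ z ∈ Finset.Icc (-R : ℤ) R, p z * (f (sortMap x (wrap N (x + z)) ζ) - f ζ)
          else 0) := by
    rw [Finset.sum_sub_distrib, Finset.sum_ite_mem, Finset.inter_eq_right.mpr]
    · simp only [ContinuousMap.sub_apply, ContinuousMap.smul_apply, boxGenerator_apply,
        ringOp_apply, ringRate, smul_eq_mul, Finset.sum_mul, ← Finset.sum_sub_distrib, mul_sub]
    · intro x hx
      rw [Finset.mem_Icc] at hx ⊢
      push_cast
      omega
  rw [e, Real.norm_eq_abs]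
  refine (Finset.abs_sum_le_sum_abs _ _).trans ?_
  -- From a start in `[-(N-R), N-R]` the jumps on the line and on the ring coincide. Elsewhere each
  -- of the two generators contributes at most `c 2^{-|x|}`.
  have hterm : ∀ x ∈ Finset.Icc (-(n + R : ℕ) : ℤ) (n + R : ℕ),
      |∑ z ∈ Finset.Icc (-R : ℤ) R, p z * (f (sortMap x (x + z) ζ) - f ζ) -
          if x ∈ Finset.Icc (-N : ℤ) N then
            ∑ z ∈ Finset.Icc (-R : ℤ) R, p z * (f (sortMap x (wrap N (x + z)) ζ) - f ζ)
          else 0| ≤ 2 * c *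
        if x ∈ Finset.Icc (-(N - R : ℕ) : ℤ) (N - R : ℕ) then 0 else (1 / 2 : ℝ) ^ x.natAbs := by
    intro x _
    by_cases hx : x ∈ Finset.Icc (-(N - R : ℕ) : ℤ) (N - R : ℕ)
    · rw [if_pos hx]
      rw [Finset.mem_Icc] at hx
      rw [if_pos (Finset.mem_Icc.mpr ⟨by omega, by omega⟩), mul_zero]
      refine (abs_eq_zero.mpr (sub_eq_zero.mpr (Finset.sum_congr rfl fun z hz => ?_))).le
      rw [Finset.mem_Icc] at hz
      rw [wrap_of_mem (Finset.mem_Icc.mpr ⟨by omega, by omega⟩)]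
    · rw [if_neg hx]
      have h1 := hab x (fun z => x + z) fun z hz => by
        rw [Finset.mem_Icc] at hz; omega
      have h2 : |if x ∈ Finset.Icc (-N : ℤ) N then
            ∑ z ∈ Finset.Icc (-R : ℤ) R, p z * (f (sortMap x (wrap N (x + z)) ζ) - f ζ)
          else 0| ≤ c * (1 / 2) ^ x.natAbs := by
        split_ifs with hxN
        · exact hab x (fun z => wrap N (x + z)) fun z hz => (natAbs_wrap_add hRN hxN hz).2
        · rw [abs_zero]; positivity
      refine (abs_sub _ _).trans ?_
      linarith
  refine (Finset.sum_le_sum hterm).trans ?_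
  rw [← Finset.mul_sum]
  refine mul_le_mul_of_nonneg_left ?_ (by positivity)
  exact (geometricTail_summable (N - R)).sum_le_tsum _ fun x _ => by split_ifs <;> positivity

/-! ### Comparing evolutions -/

section Duhamel

variable {E : Type*} [NormedAddCommGroup E] [NormedSpace ℝ E]

/-- The product rule for `r ↦ Φ r (h r)` when `Φ` is bounded and strongly differentiable. -/
lemma hasDerivWithinAt_clm_apply_of_bounded {Φ : ℝ → E →L[ℝ] ℝ} {C : ℝ} (hC : ∀ s, ‖Φ s‖ ≤ C)
    {h : ℝ → E} {h' : E} {φ' s : ℝ} {S : Set ℝ} (hh : HasDerivWithinAt h h' S s)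
    (hΦ : HasDerivWithinAt (fun r => Φ r (h s)) φ' S s)
    (hc : ContinuousWithinAt (fun r => Φ r h') S s) :
    HasDerivWithinAt (fun r => Φ r (h r)) (φ' + Φ s h') S s := by
  rw [hasDerivWithinAt_iff_isLittleO] at *
  have h1 : (fun r => Φ r (h r - h s - (r - s) • h')) =o[𝓝[S] s] fun r => r - s := by
    refine Asymptotics.IsBigO.trans_isLittleO (Asymptotics.IsBigO.of_bound C ?_) hh
    exact Eventually.of_forall fun r => (Φ r).le_of_opNorm_le (hC r) _
  have h2 : (fun r => (r - s) * (Φ r h' - Φ s h')) =o[𝓝[S] s] fun r => r - s := by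
    have h3 : (fun r => Φ r h' - Φ s h') =o[𝓝[S] s] fun _ => (1 : ℝ) := by
      rw [Asymptotics.isLittleO_one_iff]
      exact tendsto_sub_nhds_zero_iff.mpr hc
    simpa using (Asymptotics.isBigO_refl (fun r => r - s) (𝓝[S] s)).mul_isLittleO h3
  refine ((h1.add h2).add hΦ).congr_left fun r => ?_
  simp only [map_sub, map_smul, smul_eq_mul]
  ring

/-- Duhamel's comparison of a path of functionals with generator `A` on a class `D` with the
semigroup generated by `Q - K`. -/
lemma abs_sub_expSemigroup_le [CompleteSpace E] {Φ : ℝ → E →L[ℝ] ℝ} {C : ℝ}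
    (hC : ∀ s, ‖Φ s‖ ≤ C) {D : Set E} {A : E → E} (hcont : ∀ h ∈ D, Continuous fun s => Φ s h)
    (hderiv : ∀ h ∈ D, ∀ s, 0 ≤ s →
      HasDerivWithinAt (fun r => Φ r h) (Φ s (A h)) (Set.Ici s) s)
    {Q : E →L[ℝ] E} {K : ℝ} {f : E} (hD : ∀ r, expSemigroup Q K r f ∈ D)
    (hD' : ∀ r, Q (expSemigroup Q K r f) - K • expSemigroup Q K r f ∈ D) {t ε : ℝ} (ht : 0 ≤ t)
    (hε : ∀ r ∈ Set.Icc 0 t,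
      ‖A (expSemigroup Q K r f) - (Q (expSemigroup Q K r f) - K • expSemigroup Q K r f)‖ ≤ ε) :
    |Φ t f - Φ 0 (expSemigroup Q K t f)| ≤ C * ε * t := by
  -- The interpolation `s ↦ Φ s (P_{t-s} f)` runs from `Φ 0 (P_t f)` to `Φ t f`. Its derivative is
  -- `Φ s` applied to the difference of the two generators on `P_{t-s} f`.
  have hP : ∀ s, HasDerivAt (fun r => expSemigroup Q K (t - r) f)
      (-(Q (expSemigroup Q K (t - s) f) - K • expSemigroup Q K (t - s) f)) s := fun s => by
    have h := (hasDerivAt_expSemigroup Q K (t - s) f).scomp s ((hasDerivAt_id s).const_sub t)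
    rw [neg_one_smul] at h
    exact h
  have hF : ContinuousOn (fun s => Φ s (expSemigroup Q K (t - s) f)) (Set.Icc 0 t) := by
    refine Continuous.continuousOn (continuous_iff_continuousAt.mpr fun s => ?_)
    have h1 : Tendsto (fun r => Φ r (expSemigroup Q K (t - r) f - expSemigroup Q K (t - s) f))
        (𝓝 s) (𝓝 0) := by
      have h2 : Tendsto (fun r => C * ‖expSemigroup Q K (t - r) f - expSemigroup Q K (t - s) f‖)
          (𝓝 s) (𝓝 0) := by
        have := (tendsto_sub_nhds_zero_iff.mpr (hP s).continuousAt).norm.const_mul C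
        simpa using this
      exact squeeze_zero_norm (fun r => (Φ r).le_of_opNorm_le (hC r) _) h2
    have h3 := h1.add ((hcont _ (hD (t - s))).tendsto s)
    simpa [ContinuousAt] using h3
  have hF' : ∀ s ∈ Set.Ico 0 t, HasDerivWithinAt (fun s => Φ s (expSemigroup Q K (t - s) f))
      (Φ s (A (expSemigroup Q K (t - s) f) - (Q (expSemigroup Q K (t - s) f) -
        K • expSemigroup Q K (t - s) f))) (Set.Ici s) s := by
    intro s hs
    have h := hasDerivWithinAt_clm_apply_of_bounded hC (hP s).hasDerivWithinAt
      (hderiv _ (hD (t - s)) s hs.1)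
      (by
        simp only [map_neg]
        exact (hcont _ (hD' (t - s))).neg.continuousWithinAt)
    refine h.congr_deriv ?_
    simp only [map_sub, map_neg]
    ring
  have key := norm_image_sub_le_of_norm_deriv_right_le_segment hF hF' (C := C * ε)
    (fun s hs => (Φ s).le_of_opNorm_le_of_le (hC s)
      (hε _ ⟨by linarith [hs.2], by linarith [hs.1]⟩)) t ⟨ht, le_rfl⟩
  simpa [expSemigroup_zero] using key

end Duhamel

/-! ### Path functionals of the exclusion process -/

section PathFunctional

variable {k : ℕ} {Ω : Type*} [mΩ : MeasurableSpace Ω] {ζ : ℝ≥0 → Ω → Config k}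

lemma measurable_sampled_process (hm : ∀ t, Measurable (ζ t)) (f : C(Config k, ℝ))
    (a : ℕ → ℝ≥0) {g : ℝ≥0 → ℕ} (hg : Measurable g) :
    Measurable fun q : ℝ≥0 × Ω => f (ζ (a (g q.1)) q.2) := by
  have h1 : Measurable fun q : ℕ × Ω => f (ζ (a q.1) q.2) :=
    measurable_from_prod_countable_right fun j => f.continuous.measurable.comp (hm (a j))
  exact h1.comp ((hg.comp measurable_fst).prodMk measurable_snd)

lemma measurable_uncurry_process (hm : ∀ t, Measurable (ζ t))
    (hr : ∀ ω x t, ∀ᶠ s in 𝓝[>] t, ζ s ω x = ζ t ω x) (f : C(Config k, ℝ)) :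
    Measurable fun q : ℝ≥0 × Ω => f (ζ q.1 q.2) := by
  -- The first grid point strictly after `s`: the `+ 1` makes the sampling times approach `s` from
  -- the right, where the paths are continuous.
  let a : ℕ → ℕ → ℝ≥0 := fun n j => (j + 1) / (n + 1)
  have ha : ∀ n : ℕ, Measurable fun q : ℝ≥0 × Ω => f (ζ (a n ⌊q.1 * ((n : ℝ≥0) + 1)⌋₊) q.2) :=
    fun n => measurable_sampled_process hm f (a n)
      (g := fun s => ⌊s * ((n : ℝ≥0) + 1)⌋₊) (measurable_id.mul_const _).nat_floor
  refine measurable_of_tendsto_metrizable ha (tendsto_pi_nhds.mpr fun q => ?_)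
  obtain ⟨s, ω⟩ := q
  suffices h : Tendsto (fun n : ℕ => ζ (a n ⌊s * (n + 1)⌋₊) ω) atTop (𝓝 (ζ s ω)) from
    (f.continuous.tendsto _).comp h
  refine tendsto_pi_nhds.mpr fun x => ?_
  have hpos : ∀ n : ℕ, (0 : ℝ≥0) < n + 1 := fun n => by positivity
  have hlim : Tendsto (fun n : ℕ => a n ⌊s * (n + 1)⌋₊) atTop (𝓝[>] s) := by
    refine tendsto_nhdsWithin_iff.mpr ⟨?_, Eventually.of_forall fun n => ?_⟩
    · have h0 : Tendsto (fun n : ℕ => s + 1 / ((n : ℝ≥0) + 1)) atTop (𝓝 s) := by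
        simpa using tendsto_const_nhds.add (tendsto_one_div_add_atTop_nhds_zero_nat (𝕜 := ℝ≥0))
      refine tendsto_of_tendsto_of_tendsto_of_le_of_le tendsto_const_nhds h0 (fun n => ?_)
        fun n => ?_
      · change s ≤ _ / _
        rw [le_div_iff₀ (hpos n)]
        exact (Nat.lt_floor_add_one _).le
      · change _ / _ ≤ _
        rw [div_le_iff₀ (hpos n), add_mul, one_div, inv_mul_cancel₀ (hpos n).ne']
        gcongr
        exact Nat.floor_le (by positivity)
    · change s < _ / _
      rw [lt_div_iff₀ (hpos n)]
      exact Nat.lt_floor_add_one _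
  refine tendsto_const_nhds.congr' ?_
  filter_upwards [hlim.eventually (hr ω x s)] with n hn using hn.symm

variable {μ : Measure Ω} [IsProbabilityMeasure μ]

lemma integrable_comp_mul {ξ : Ω → Config k} (hξ : Measurable ξ) {G : Ω → ℝ} {C : ℝ}
    (hG : Measurable G) (hb : ∀ ω, |G ω| ≤ C) (f : C(Config k, ℝ)) :
    Integrable (fun ω => f (ξ ω) * G ω) μ := by
  refine Integrable.of_bound
    (((f.continuous.measurable.comp hξ).mul hG).aestronglyMeasurable) (‖f‖ * C)
    (Eventually.of_forall fun ω => ?_)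
  rw [norm_mul]
  exact mul_le_mul (f.norm_coe_le_norm _) (hb ω) (abs_nonneg _) (norm_nonneg _)

/-- The functional `f ↦ E[f(ξ) G]`. -/
def weightedLaw (μ : Measure Ω) [IsProbabilityMeasure μ] {ξ : Ω → Config k} (hξ : Measurable ξ)
    {G : Ω → ℝ} {C : ℝ} (hG : Measurable G) (hb : ∀ ω, |G ω| ≤ C) : C(Config k, ℝ) →L[ℝ] ℝ :=
  LinearMap.mkContinuous
    { toFun := fun f => ∫ ω, f (ξ ω) * G ω ∂μ
      map_add' := fun f g => by
        simp only [ContinuousMap.add_apply, add_mul]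
        exact integral_add (integrable_comp_mul hξ hG hb f) (integrable_comp_mul hξ hG hb g)
      map_smul' := fun c f => by
        simp only [ContinuousMap.smul_apply, smul_eq_mul, mul_assoc, RingHom.id_apply]
        exact integral_const_mul _ _ } C
    fun f => by
      have h := norm_integral_le_of_norm_le_const (μ := μ) (f := fun ω => f (ξ ω) * G ω)
        (C := C * ‖f‖) (Eventually.of_forall fun ω => by
          rw [norm_mul, mul_comm C]
          exact mul_le_mul (f.norm_coe_le_norm _) (hb ω) (abs_nonneg _) (norm_nonneg _))
      simpa using h

lemma weightedLaw_apply {ξ : Ω → Config k} (hξ : Measurable ξ)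
    {G : Ω → ℝ} {C : ℝ} (hG : Measurable G) (hb : ∀ ω, |G ω| ≤ C) (f : C(Config k, ℝ)) :
    weightedLaw μ hξ hG hb f = ∫ ω, f (ξ ω) * G ω ∂μ := rfl

lemma norm_weightedLaw_le {ξ : Ω → Config k} (hξ : Measurable ξ)
    {G : Ω → ℝ} {C : ℝ} (hG : Measurable G) (hb : ∀ ω, |G ω| ≤ C) (hC : 0 ≤ C) :
    ‖weightedLaw μ hξ hG hb‖ ≤ C :=
  LinearMap.mkContinuous_norm_le _ hC _

end PathFunctional

section PathFunctional

variable {k : ℕ} {Ω : Type*} [mΩ : MeasurableSpace Ω] {ζ : ℝ≥0 → Ω → Config k} {p : ℤ → ℝ}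
  {μ : Measure Ω} {ℱ : Filtration ℝ≥0 mΩ}

lemma IsExclusionProcess.measurable (h : IsExclusionProcess p μ ℱ ζ) (t : ℝ≥0) :
    Measurable (ζ t) :=
  (h.adapted t).mono (ℱ.le t) le_rfl

lemma IsExclusionProcess.measurable_uncurry (h : IsExclusionProcess p μ ℱ ζ)
    (f : C(Config k, ℝ)) : Measurable fun q : ℝ × Ω => f (ζ q.1.toNNReal q.2) :=
  (measurable_uncurry_process h.measurable h.right_continuous f).comp
    ((measurable_real_toNNReal.comp measurable_fst).prodMk measurable_snd)

variable [IsProbabilityMeasure μ]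

lemma IsExclusionProcess.intervalIntegrable (h : IsExclusionProcess p μ ℱ ζ)
    (f : C(Config k, ℝ)) {G : Ω → ℝ} {C : ℝ} (hG : Measurable G) (hb : ∀ ω, |G ω| ≤ C) (a b : ℝ) :
    IntervalIntegrable (fun s => ∫ ω, f (ζ s.toNNReal ω) * G ω ∂μ) volume a b := by
  have hm : StronglyMeasurable fun q : ℝ × Ω => f (ζ q.1.toNNReal q.2) * G q.2 :=
    ((h.measurable_uncurry f).mul (hG.comp measurable_snd)).stronglyMeasurable
  refine (intervalIntegrable_const (c := ‖f‖ * C)).mono_fun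
    hm.integral_prod_right'.aestronglyMeasurable (Eventually.of_forall fun s => ?_)
  refine le_trans ?_ (le_abs_self _)
  have h1 := norm_integral_le_of_norm_le_const (μ := μ)
    (f := fun ω => f (ζ s.toNNReal ω) * G ω) (C := ‖f‖ * C) (Eventually.of_forall fun ω => by
      rw [norm_mul]
      exact mul_le_mul (f.norm_coe_le_norm _) (hb ω) (abs_nonneg _) (norm_nonneg _))
  simpa using h1

/-- The integrated forward equation. -/
lemma IsExclusionProcess.integral_eq (h : IsExclusionProcess p μ ℱ ζ) {f g : C(Config k, ℝ)}
    (hf : IsLocal f) (hg : ∀ ξ, generator p f ξ = g ξ) {G : Ω → ℝ} {C : ℝ}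
    (hG : Measurable[ℱ 0] G) (hb : ∀ ω, |G ω| ≤ C) (t : ℝ≥0) :
    ∫ ω, f (ζ t ω) * G ω ∂μ = ∫ ω, f (ζ 0 ω) * G ω ∂μ +
      ∫ s in (0 : ℝ)..t, ∫ ω, g (ζ s.toNNReal ω) * G ω ∂μ := by
  have hG' : Measurable G := hG.mono (ℱ.le 0) le_rfl
  have hM := h.martingale f hf
  simp only [hg] at hM
  set M : ℝ≥0 → Ω → ℝ := fun t ω =>
    f (ζ t ω) - f (ζ 0 ω) - ∫ s in (0 : ℝ)..t, g (ζ s.toNNReal ω) with hMdef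
  have hGM : Integrable (M t * G) μ := by
    refine ((hM.integrable t).mul_bdd (c := C) hG'.aestronglyMeasurable
      (Eventually.of_forall fun ω => ?_))
    exact hb ω
  -- `G` is known at time `0`, and the martingale `M` starts from `0`.
  have h0 : ∫ ω, (M t * G) ω ∂μ = 0 := by
    rw [← integral_condExp (ℱ.le 0)]
    have h1 := condExp_mul_of_stronglyMeasurable_right (m := ℱ 0) (μ := μ)
      (Measurable.stronglyMeasurable hG) hGM (hM.integrable t)
    have h2 := hM.condExp_ae_eq (zero_le (a := t))
    rw [integral_congr_ae (g := fun _ => 0), integral_zero]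
    filter_upwards [h1, h2] with ω hω hω'
    rw [hω, Pi.mul_apply, hω']
    simp [hMdef]
  have : IsFiniteMeasure ((volume : Measure ℝ).restrict (Set.uIoc 0 (t : ℝ))) :=
    ⟨by simp⟩
  have hsw : ∫ s in (0 : ℝ)..t, ∫ ω, g (ζ s.toNNReal ω) * G ω ∂μ =
      ∫ ω, (∫ s in (0 : ℝ)..t, g (ζ s.toNNReal ω) * G ω) ∂μ := by
    refine intervalIntegral_integral_swap (Integrable.of_bound
      (C := ‖g‖ * C) ((h.measurable_uncurry g).mul
        (hG'.comp measurable_snd)).aestronglyMeasurable (Eventually.of_forall fun q => ?_))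
    rw [Function.uncurry, norm_mul]
    exact mul_le_mul (g.norm_coe_le_norm _) (hb _) (abs_nonneg _) (norm_nonneg _)
  have i1 := integrable_comp_mul (μ := μ) (h.measurable t) hG' hb f
  have i2 := integrable_comp_mul (μ := μ) (h.measurable 0) hG' hb f
  have e : (fun ω => ∫ s in (0 : ℝ)..t, g (ζ s.toNNReal ω) * G ω) =
      fun ω => f (ζ t ω) * G ω - f (ζ 0 ω) * G ω - (M t * G) ω := by
    funext ω
    rw [intervalIntegral.integral_mul_const]
    simp only [hMdef, Pi.mul_apply]
    ring
  have e1 : ∫ ω, (f (ζ t ω) * G ω - f (ζ 0 ω) * G ω - (M t * G) ω) ∂μ =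
      ∫ ω, (f (ζ t ω) * G ω - f (ζ 0 ω) * G ω) ∂μ - ∫ ω, (M t * G) ω ∂μ :=
    integral_sub (i1.sub i2) hGM
  rw [hsw, e, e1, integral_sub i1 i2, h0]
  ring

/-- The forward equation presents the expectation as a primitive. Applied to the image of `f` under
the generator, which is local again, this yields the continuity assumed in
`IsExclusionProcess.hasDerivWithinAt_integral`. -/
lemma IsExclusionProcess.continuous_integral (h : IsExclusionProcess p μ ℱ ζ)
    {f g : C(Config k, ℝ)} (hf : IsLocal f) (hg : ∀ ξ, generator p f ξ = g ξ) {G : Ω → ℝ}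
    {C : ℝ} (hG : Measurable[ℱ 0] G) (hb : ∀ ω, |G ω| ≤ C) :
    Continuous fun s : ℝ => ∫ ω, f (ζ s.toNNReal ω) * G ω ∂μ := by
  have hG' : Measurable G := hG.mono (ℱ.le 0) le_rfl
  have h1 := intervalIntegral.continuous_primitive (h.intervalIntegrable g hG' hb) 0
  have h2 : Continuous fun s : ℝ => ((s.toNNReal : ℝ≥0) : ℝ) := by fun_prop
  refine ((continuous_const (y := ∫ ω, f (ζ 0 ω) * G ω ∂μ)).add (h1.comp h2)).congr fun s => ?_
  exact (h.integral_eq hf hg hG hb s.toNNReal).symm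

lemma IsExclusionProcess.hasDerivWithinAt_integral (h : IsExclusionProcess p μ ℱ ζ)
    {f g : C(Config k, ℝ)} (hf : IsLocal f) (hg : ∀ ξ, generator p f ξ = g ξ) {G : Ω → ℝ}
    {C : ℝ} (hG : Measurable[ℱ 0] G) (hb : ∀ ω, |G ω| ≤ C)
    (hc : Continuous fun s : ℝ => ∫ ω, g (ζ s.toNNReal ω) * G ω ∂μ) {s : ℝ} (hs : 0 ≤ s) :
    HasDerivWithinAt (fun s : ℝ => ∫ ω, f (ζ s.toNNReal ω) * G ω ∂μ)
      (∫ ω, g (ζ s.toNNReal ω) * G ω ∂μ) (Set.Ici s) s := by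
  have h1 := (intervalIntegral.integral_hasDerivAt_right (hc.intervalIntegrable 0 s)
    (hc.stronglyMeasurableAtFilter _ _) hc.continuousAt).const_add (∫ ω, f (ζ 0 ω) * G ω ∂μ)
  refine h1.hasDerivWithinAt.congr_of_mem (fun r hr => ?_) (Set.mem_Ici.mpr le_rfl)
  have := h.integral_eq hf hg hG hb r.toNNReal
  rwa [Real.coe_toNNReal r (hs.trans hr)] at this

lemma DependsOn.isLocal {m : ℕ} {f : C(Config k, ℝ)}
    (hf : DependsOn f (Set.Icc (-m : ℤ) m)) : IsLocal f :=
  ⟨Finset.Icc (-m : ℤ) m, by simpa using hf⟩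

/-- Expectations of local functions are limits of expectations for the processes on rings. -/
theorem IsExclusionProcess.tendsto_ringSemigroup (h : IsExclusionProcess p μ ℱ ζ)
    (hp : ∀ z, 0 ≤ p z) {R m : ℕ} (hR : ∀ z : ℤ, z ∉ Finset.Icc (-R : ℤ) R → p z = 0)
    (hp1 : ∑ z ∈ Finset.Icc (-R : ℤ) R, p z = 1) {f : C(Config k, ℝ)}
    (hf : DependsOn f (Set.Icc (-m : ℤ) m)) {G : Ω → ℝ} {C : ℝ} (hG : Measurable[ℱ 0] G)
    (hb : ∀ ω, |G ω| ≤ C) (t : ℝ≥0) :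
    Tendsto (fun N => ∫ ω, ringSemigroup p R N k t f (ζ 0 ω) * G ω ∂μ) atTop
      (𝓝 (∫ ω, f (ζ t ω) * G ω ∂μ)) := by
  have hG' : Measurable G := hG.mono (ℱ.le 0) le_rfl
  have hC : 0 ≤ C := by
    obtain ⟨ω⟩ : Nonempty Ω := μ.nonempty_of_neZero
    exact (abs_nonneg _).trans (hb ω)
  let Φ : ℝ → C(Config k, ℝ) →L[ℝ] ℝ := fun s => weightedLaw μ (h.measurable s.toNNReal) hG' hb
  have hgen : ∀ {n L : ℕ} {u : C(Config k, ℝ)}, DependsOn u (Set.Icc (-n : ℤ) n) → n + R ≤ L →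
      ∀ ξ, generator p u ξ = boxGenerator p R L u ξ := fun hu hL ξ =>
    generator_eq_boxGenerator hR hu hL ξ
  have hmono : ∀ {n n' : ℕ} {u : C(Config k, ℝ)}, DependsOn u (Set.Icc (-n : ℤ) n) → n ≤ n' →
      DependsOn u (Set.Icc (-n' : ℤ) n') := fun hu hn =>
    hu.mono (Set.Icc_subset_Icc (by omega) (by omega))
  have hcont : ∀ {n : ℕ} {u : C(Config k, ℝ)}, DependsOn u (Set.Icc (-n : ℤ) n) →
      Continuous fun s => Φ s u := fun hu =>
    h.continuous_integral (DependsOn.isLocal hu) (hgen hu le_rfl) hG hb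
  -- A bound, uniform in `N` and in times up to `t`, for the influence constant of `f` evolved on
  -- the ring.
  set M : ℝ := 2 * ‖f‖ * 2 ^ m * Real.exp (2 * 2 ^ R * t)
  have hM : 0 ≤ M := by positivity
  have hbound : ∀ N, R ≤ N → |Φ t f - Φ 0 (ringSemigroup p R N k t f)| ≤
      C * (2 * (M * (1 + 2 ^ R)) * geometricTail (N - R)) * t := by
    intro N hN
    have hP : ∀ r, DependsOn (ringSemigroup p R N k r f)
        (Set.Icc (-(N + m : ℕ) : ℤ) (N + m : ℕ)) := fun r =>
      dependsOn_ringSemigroup (hmono hf (by omega)) (by omega) r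
    -- The class consists of the functions of the sites in `[-(N+m), N+m]`. It contains `f` and the
    -- whole ring, is preserved by the ring evolution, and on it the box generator is the true one.
    refine abs_sub_expSemigroup_le (Φ := Φ) (C := C)
      (D := {u | DependsOn u (Set.Icc (-(N + m : ℕ) : ℤ) (N + m : ℕ))})
      (A := boxGenerator p R (N + m + R)) (fun s => norm_weightedLaw_le _ _ _ hC)
      (fun u hu => hcont hu) (fun u hu s hs => ?_) hP (fun r => ?_) t.2 (fun r hr => ?_)
    · have hu' : DependsOn (boxGenerator p R (N + m + R) u)
          (Set.Icc (-(N + m + R + R : ℕ) : ℤ) (N + m + R + R : ℕ)) :=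
        dependsOn_boxGenerator (hmono hu (by omega)) le_rfl
      exact h.hasDerivWithinAt_integral (DependsOn.isLocal hu) (hgen hu le_rfl) hG hb
        (hcont hu') hs
    · intro ξ ξ' hξ
      have h1 := dependsOn_ringOp (p := p) (R := R) (N := N) (hP r) (by omega) hξ
      have h2 := hP r hξ
      simp only [ContinuousMap.sub_apply, ContinuousMap.smul_apply]
      rw [h1, h2]
    · refine norm_boxGenerator_sub_le hp hN (by omega) hp1 hM ?_
      have hI := HasInfluence.ringSemigroup hp hp1 (R := R) (N := N) (C := 2 ^ R) (by positivity)
        (fun x hx z hz => pow_natAbs_wrap hN (r := 1 / 2) (c := 2) (by norm_num) (by norm_num)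
          (by norm_num) (by norm_num) hx hz) (by positivity) (DependsOn.hasInfluence hf) hr.1
      intro u ξ a
      refine (hI u ξ a).trans (mul_le_mul_of_nonneg_right ?_ (by positivity))
      refine mul_le_mul_of_nonneg_left (Real.exp_le_exp.mpr ?_) (by positivity)
      exact mul_le_mul_of_nonneg_left hr.2 (by positivity)
  have hlim : Tendsto (fun N : ℕ => C * (2 * (M * (1 + 2 ^ R)) * geometricTail (N - R)) * t)
      atTop (𝓝 0) := by
    have h1 := ((tendsto_geometricTail.comp (tendsto_sub_atTop_nat R)).const_mul
      (2 * (M * (1 + 2 ^ R)))).const_mul C |>.mul_const (t : ℝ)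
    simpa using h1
  have hfin : Tendsto (fun N => Φ 0 (ringSemigroup p R N k t f)) atTop (𝓝 (Φ t f)) := by
    refine tendsto_iff_dist_tendsto_zero.mpr (squeeze_zero' (Eventually.of_forall fun _ =>
      dist_nonneg) ?_ hlim)
    filter_upwards [eventually_ge_atTop R] with N hN
    rw [dist_comm]
    exact hbound N hN
  simpa [Φ, weightedLaw_apply] using hfin

end PathFunctional

/-! ### The Bernoulli product measure -/

instance (ρ : unitInterval) : IsProbabilityMeasure (bernoulliProduct ρ) := by
  unfold bernoulliProduct; infer_instance

lemma continuous_apply_comp {k : ℕ} (F : Fin k → ℝ) (x : ℤ) :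
    Continuous fun ζ : Config k => F (ζ x) :=
  continuous_of_discreteTopology.comp (continuous_apply x)

/-- The occupation variable as a continuous function. -/
def occMap (x : ℤ) : C(Config 2, ℝ) := 
  ⟨fun η => occ η x, continuous_apply_comp (fun b : Fin 2 => ((b : ℕ) : ℝ)) x⟩

@[simp] lemma occMap_apply (x : ℤ) (η : Config 2) : occMap x η = occ η x := rfl

/-- The indicator of the type `a` at `x`. -/
def typeMap {k : ℕ} (a : Fin k) (x : ℤ) : C(Config k, ℝ) :=
  ⟨fun ζ => if ζ x = a then 1 else 0, continuous_apply_comp (fun b => if b = a then 1 else 0) x⟩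

@[simp] lemma typeMap_apply {k : ℕ} (a : Fin k) (x : ℤ) (ζ : Config k) :
    typeMap a x ζ = if ζ x = a then 1 else 0 := rfl

lemma integrable_of_continuous {k : ℕ} {π : Measure (Config k)} [IsProbabilityMeasure π]
    {f : Config k → ℝ} (hf : Continuous f) : Integrable f π := by
  simpa using integrable_comp_mul (μ := π) measurable_id (G := fun _ => 1) (C := 1)
    measurable_const (by simp) ⟨f, hf⟩

lemma map_comp_perm_bernoulliProduct (ρ : unitInterval) (e : Equiv.Perm ℤ) :
    (bernoulliProduct ρ).map (fun η : Config 2 => η ∘ e) = bernoulliProduct ρ := by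
  have hm : Measurable fun η : Config 2 => η ∘ e :=
    measurable_pi_lambda _ fun x => measurable_pi_apply (e x)
  refine Measure.eq_infinitePi _ fun s t ht => ?_
  rw [Measure.map_apply hm (MeasurableSet.pi s.countable_toSet fun i _ => ht i)]
  have h1 : (fun η : Config 2 => η ∘ e) ⁻¹' ((s : Set ℤ).pi t) =
      ((s.map e.toEmbedding : Finset ℤ) : Set ℤ).pi fun j => t (e.symm j) := by
    ext η
    simp only [Set.mem_preimage, Set.mem_pi, Finset.mem_coe, Function.comp_apply,
      Finset.mem_map_equiv]
    exact ⟨fun h i hi => by simpa using h _ hi, fun h i hi => by simpa using h (e i) (by simpa)⟩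
  rw [h1, bernoulliProduct, Measure.infinitePi_pi _ fun i _ => ht _, Finset.prod_map]
  simp

lemma continuous_comp_perm {k : ℕ} (e : Equiv.Perm ℤ) :
    Continuous fun η : Config k => η ∘ e :=
  continuous_pi fun x => continuous_apply (e x)

lemma integral_comp_perm (ρ : unitInterval) (e : Equiv.Perm ℤ) {f : Config 2 → ℝ}
    (hf : Continuous f) :
    ∫ η, f (η ∘ e) ∂bernoulliProduct ρ = ∫ η, f η ∂bernoulliProduct ρ := by
  conv_rhs => rw [← map_comp_perm_bernoulliProduct ρ e]
  rw [integral_map (continuous_comp_perm e).measurable.aemeasurable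
    hf.measurable.aestronglyMeasurable]

lemma continuous_update_const {k : ℕ} (a : ℤ) (v : Fin k) :
    Continuous fun η : Config k => Function.update η a v :=
  continuous_id.update a continuous_const

lemma measurable_update_const {k : ℕ} (a : ℤ) (v : Fin k) :
    Measurable fun η : Config k => Function.update η a v :=
  (continuous_update_const a v).measurable

/-- Resampling the content of the site `a`. -/
lemma bernoulliProduct_eq_add (ρ : unitInterval) (a : ℤ) :
    bernoulliProduct ρ =
      unitInterval.toNNReal ρ •
          (bernoulliProduct ρ).map (fun η : Config 2 => Function.update η a 1) +
        unitInterval.toNNReal (unitInterval.symm ρ) •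
          (bernoulliProduct ρ).map (fun η : Config 2 => Function.update η a 0) := by
  classical
  refine (Measure.eq_infinitePi _ fun s t ht => ?_).symm
  have hmp : MeasurableSet ((s : Set ℤ).pi t) := MeasurableSet.pi s.countable_toSet fun i _ => ht i
  simp only [Measure.add_apply, Measure.smul_apply]
  rw [Measure.map_apply (measurable_update_const a 1) hmp,
    Measure.map_apply (measurable_update_const a 0) hmp]
  have hpre : ∀ v : Fin 2, (fun η : Config 2 => Function.update η a v) ⁻¹' ((s : Set ℤ).pi t) =
      if a ∈ s → v ∈ t a then ((s.erase a : Finset ℤ) : Set ℤ).pi t else ∅ := by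
    intro v
    ext η
    by_cases ha : a ∈ s
    · simp only [ha, true_imp_iff]
      split_ifs with hv
      · simp only [Set.mem_preimage, Set.mem_pi, Finset.mem_coe, Finset.mem_erase]
        refine ⟨fun h i hi => by simpa [hi.1] using h i hi.2, fun h i hi => ?_⟩
        by_cases hia : i = a
        · subst hia; simpa using hv
        · simpa [hia] using h i ⟨hia, hi⟩
      · simp only [Set.mem_empty_iff_false, iff_false]
        intro h
        exact hv (by simpa using h a ha)
    · simp only [ha, false_imp_iff, if_true, Finset.erase_eq_of_notMem ha]
      simp only [Set.mem_preimage, Set.mem_pi, Finset.mem_coe]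
      refine forall₂_congr fun i hi => ?_
      have : i ≠ a := by rintro rfl; exact ha hi
      simp [this]
  have hπ : ∀ s' : Finset ℤ, bernoulliProduct ρ ((s' : Set ℤ).pi t) =
      ∏ i ∈ s', bernoulliMeasure (1 : Fin 2) 0 ρ (t i) := fun s' =>
    Measure.infinitePi_pi _ fun i _ => ht i
  have hone : ((unitInterval.toNNReal ρ : ℝ≥0) : ENNReal) +
      (unitInterval.toNNReal (unitInterval.symm ρ) : ℝ≥0) = 1 := by
    rw [← ENNReal.coe_add, ← ENNReal.coe_one, ENNReal.coe_inj]
    ext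
    simp
  rw [hpre, hpre]
  by_cases ha : a ∈ s
  · rw [← Finset.mul_prod_erase s _ ha, ← hπ]
    generalize ((s.erase a : Finset ℤ) : Set ℤ).pi t = B
    rw [bernoulliMeasure_def]
    simp only [ha, true_imp_iff, Measure.add_apply, Measure.smul_apply,
      Measure.dirac_apply' _ (ht a), Set.indicator]
    split_ifs <;> simp [ENNReal.smul_def, add_mul]
  · simp only [ha, false_imp_iff, if_true, Finset.erase_eq_of_notMem ha, hπ]
    rw [ENNReal.smul_def, ENNReal.smul_def, smul_eq_mul, smul_eq_mul, ← add_mul, hone, one_mul]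

lemma integral_bernoulliProduct_eq (ρ : unitInterval) (a : ℤ) {f : Config 2 → ℝ}
    (hf : Continuous f) :
    ∫ η, f η ∂bernoulliProduct ρ =
      ρ * ∫ η, f (Function.update η a 1) ∂bernoulliProduct ρ +
        (1 - ρ) * ∫ η, f (Function.update η a 0) ∂bernoulliProduct ρ := by
  have hi : ∀ v : Fin 2, Integrable f
      ((bernoulliProduct ρ).map fun η : Config 2 => Function.update η a v) := fun v => by
    have := Measure.isProbabilityMeasure_map (μ := bernoulliProduct ρ)
      (measurable_update_const (k := 2) a v).aemeasurable
    exact integrable_of_continuous hf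
  have hs : ∀ c : ℝ≥0, ∀ m : Measure (Config 2), ∫ η, f η ∂(c • m) = (c : ℝ) * ∫ η, f η ∂m :=
    fun c m => integral_smul_nnreal_measure f c
  conv_lhs => rw [bernoulliProduct_eq_add ρ a]
  rw [integral_add_measure ((hi 1).smul_measure_nnreal) ((hi 0).smul_measure_nnreal), hs, hs,
    integral_map (measurable_update_const a 1).aemeasurable hf.measurable.aestronglyMeasurable,
    integral_map (measurable_update_const a 0).aemeasurable hf.measurable.aestronglyMeasurable]
  simp

/-! ### Reversibility of the ring process up to reflection -/

/-- The reflection `x ↦ -x` of a configuration. -/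
def reflect {k : ℕ} (ζ : Config k) : Config k := ζ ∘ Equiv.neg ℤ

lemma reflect_apply {k : ℕ} (ζ : Config k) (x : ℤ) : reflect ζ x = ζ (-x) := rfl

lemma reflect_reflect {k : ℕ} (ζ : Config k) : reflect (reflect ζ) = ζ := by
  funext x; simp [reflect_apply]

lemma continuous_reflect {k : ℕ} : Continuous (reflect : Config k → Config k) :=
  continuous_comp_perm _

lemma reflect_sortMap {k : ℕ} (x y : ℤ) (ζ : Config k) :
    reflect (sortMap x y ζ) = sortMap (-x) (-y) (reflect ζ) := by
  funext u
  simp only [reflect_apply, sortMap_apply, neg_neg, neg_eq_iff_eq_neg]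

/-- Reversing a single bond. -/
lemma integral_sortMap_mul (ρ : unitInterval) {f h : Config 2 → ℝ} (hf : Continuous f)
    (hh : Continuous h) (x y : ℤ) :
    ∫ η, f (sortMap x y η) * h η ∂bernoulliProduct ρ =
      ∫ η, f η * h (sortMap y x η) ∂bernoulliProduct ρ +
        (∫ η, f η * h η * occ η y ∂bernoulliProduct ρ -
          ∫ η, f η * h η * occ η x ∂bernoulliProduct ρ) := by
  -- The exchange term on configurations with `x` occupied and `y` empty. Its exchanged copy is the
  -- term with the jump reversed and has the same integral. The probabilities of no exchange on the
  -- two sides differ through `η_y - η_x`.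
  let F : Config 2 → ℝ := fun η =>
    occ η x * (1 - occ η y) * (f (exchange η x y) * h η)
  have ho : ∀ u, Continuous fun η : Config 2 => occ η u := fun u => (occMap u).continuous
  have hex : Continuous fun η : Config 2 => exchange η x y := continuous_comp_perm _
  have hF : Continuous F := by
    have := hf.comp hex
    have := ho x
    have := ho y
    fun_prop
  have hFe : Continuous fun η : Config 2 => F (exchange η x y) := hF.comp hex
  have hinv : ∫ η, F (exchange η x y) ∂bernoulliProduct ρ = ∫ η, F η ∂bernoulliProduct ρ :=
    integral_comp_perm ρ (Equiv.swap x y) hF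
  have hpt : ∀ η : Config 2, f (sortMap x y η) * h η = f η * h (sortMap y x η) +
      (f η * h η * occ η y - f η * h η * occ η x) + (F η - F (exchange η x y)) := by
    intro η
    have e1 : exchange (exchange η x y) x y = η := by
      funext u; simp [exchange]
    have e2 : exchange η y x = exchange η x y := by
      unfold exchange; rw [Equiv.swap_comm]
    have e3 : occ (exchange η x y) x = occ η y := by simp [occ, exchange]
    have e4 : occ (exchange η x y) y = occ η x := by simp [occ, exchange]
    simp only [F, e1, e3, e4]
    have hx : η x = 0 ∨ η x = 1 := by
      generalize η x = a
      fin_cases a <;> simp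
    have hy : η y = 0 ∨ η y = 1 := by
      generalize η y = a
      fin_cases a <;> simp
    rcases hx with hx | hx <;> rcases hy with hy | hy <;>
      simp [sortMap, e2, occ, hx, hy]
  have c1 : Continuous fun η : Config 2 => f η * h (sortMap y x η) :=
    hf.mul (hh.comp (continuous_sortMap y x))
  have c2 : ∀ u, Continuous fun η : Config 2 => f η * h η * occ η u := fun u =>
    (hf.mul hh).mul (ho u)
  simp_rw [hpt]
  rw [integral_add, integral_add, integral_sub, integral_sub, hinv, sub_self, add_zero]
  all_goals
    refine integrable_of_continuous ?_
    first
      | exact c1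
      | exact c2 _
      | exact hF
      | exact hFe
      | exact (c2 _).sub (c2 _)
      | exact c1.add ((c2 _).sub (c2 _))
      | exact hF.sub hFe

/-- The adjoint of a jump by `z` is a jump by `-z`, up to a term with `η_y - η_x` on each bond.
Summed over the ring for fixed `z`, these terms cancel, which is the gain over a box with boundary;
the reflection turns `-z` back into `z`. -/
lemma integral_ringOp_mul_reflect (p : ℤ → ℝ) (R N : ℕ) (ρ : unitInterval)
    (f g : C(Config 2, ℝ)) :
    ∫ η, ringOp p R N 2 f η * g (reflect η) ∂bernoulliProduct ρ =
      ∫ η, ringOp p R N 2 g (reflect η) * f η ∂bernoulliProduct ρ := by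
  have hh : Continuous fun η : Config 2 => g (reflect η) := g.continuous.comp continuous_reflect
  simp_rw [ringOp_apply, Finset.sum_mul, mul_assoc]
  have cl : ∀ x y : ℤ, Continuous fun η : Config 2 => f (sortMap x y η) * g (reflect η) :=
    fun x y => (f.continuous.comp (continuous_sortMap x y)).mul hh
  have cr : ∀ x y : ℤ, Continuous fun η : Config 2 => g (sortMap x y (reflect η)) * f η :=
    fun x y => ((g.continuous.comp (continuous_sortMap x y)).comp continuous_reflect).mul
      f.continuous
  rw [integral_finsetSum _ fun x _ => integrable_of_continuous
      (continuous_finsetSum _ fun z _ => (cl _ _).const_mul _),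
    integral_finsetSum _ fun x _ => integrable_of_continuous
      (continuous_finsetSum _ fun z _ => (cr _ _).const_mul _)]
  have e1 : ∀ x : ℤ, ∫ η, ∑ z ∈ Finset.Icc (-R : ℤ) R,
      p z * (f (sortMap x (wrap N (x + z)) η) * g (reflect η)) ∂bernoulliProduct ρ =
      ∑ z ∈ Finset.Icc (-R : ℤ) R, p z *
        ∫ η, f (sortMap x (wrap N (x + z)) η) * g (reflect η) ∂bernoulliProduct ρ := fun x => by
    rw [integral_finsetSum _ fun z _ => integrable_of_continuous ((cl _ _).const_mul _)]
    simp_rw [integral_const_mul]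
  have e2 : ∀ x : ℤ, ∫ η, ∑ z ∈ Finset.Icc (-R : ℤ) R,
      p z * (g (sortMap x (wrap N (x + z)) (reflect η)) * f η) ∂bernoulliProduct ρ =
      ∑ z ∈ Finset.Icc (-R : ℤ) R, p z *
        ∫ η, g (sortMap x (wrap N (x + z)) (reflect η)) * f η ∂bernoulliProduct ρ := fun x => by
    rw [integral_finsetSum _ fun z _ => integrable_of_continuous ((cr _ _).const_mul _)]
    simp_rw [integral_const_mul]
  simp_rw [e1, e2]
  rw [Finset.sum_comm]
  conv_rhs => rw [Finset.sum_comm]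
  refine Finset.sum_congr rfl fun z _ => ?_
  rw [← Finset.mul_sum, ← Finset.mul_sum]
  congr 1
  simp_rw [integral_sortMap_mul ρ f.continuous hh]
  rw [Finset.sum_add_distrib, Finset.sum_sub_distrib,
    sum_wrap_add N z fun _ y => ∫ η, f η * g (reflect η) * occ η y ∂bernoulliProduct ρ,
    sub_self, add_zero,
    sum_wrap_add N z fun x y => ∫ η, f η * g (reflect (sortMap y x η)) ∂bernoulliProduct ρ]
  refine Finset.sum_equiv (Equiv.neg ℤ) (fun y => ?_) fun y _ => ?_
  · simp only [Finset.mem_Icc, Equiv.neg_apply]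
    omega
  · simp only [reflect_sortMap, ← wrap_neg, Equiv.neg_apply, neg_sub, mul_comm (f _)]
    rw [sub_eq_add_neg, add_comm z]

lemma integral_ringSemigroup_mul_reflect (p : ℤ → ℝ) (R N : ℕ) (ρ : unitInterval)
    (f g : C(Config 2, ℝ)) (t : ℝ) :
    ∫ η, ringSemigroup p R N 2 t f η * g (reflect η) ∂bernoulliProduct ρ =
      ∫ η, ringSemigroup p R N 2 t g (reflect η) * f η ∂bernoulliProduct ρ := by
  have hpow : ∀ (n : ℕ) (g : C(Config 2, ℝ)),
      ∫ η, (ringOp p R N 2 ^ n) f η * g (reflect η) ∂bernoulliProduct ρ =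
        ∫ η, (ringOp p R N 2 ^ n) g (reflect η) * f η ∂bernoulliProduct ρ := by
    intro n
    induction n with
    | zero => intro g; simp [mul_comm]
    | succ n ih =>
      intro g
      have h1 := integral_ringOp_mul_reflect p R N ρ ((ringOp p R N 2 ^ n) f) g
      have h2 := ih (ringOp p R N 2 g)
      rw [pow_succ' (ringOp p R N 2) n, mul_apply_eq_comp, h1,
        ← pow_succ', pow_succ, mul_apply_eq_comp, ← h2]
      simp only [mul_comm]
  have hφ := (g.continuous.comp continuous_reflect).measurable
  exact expSemigroup_comm (ringRate p R N) t
    (weightedLaw (bernoulliProduct ρ) measurable_id hφ (C := ‖g‖) fun η => g.norm_coe_le_norm _)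
    (weightedLaw (bernoulliProduct ρ) continuous_reflect.measurable f.continuous.measurable
      (C := ‖f‖) fun η => f.norm_coe_le_norm _) (Q := ringOp p R N 2) (Q' := ringOp p R N 2)
    (fun n => hpow n g)

/-! ### Symmetries of the stationary process -/

/-- `p` is a probability mass function supported in `[-R, R]`. -/
structure HasRange (p : ℤ → ℝ) (R : ℕ) : Prop where
  nonneg : ∀ z, 0 ≤ p z
  eq_zero : ∀ z : ℤ, z ∉ Finset.Icc (-R : ℤ) R → p z = 0
  sum_eq_one : ∑ z ∈ Finset.Icc (-R : ℤ) R, p z = 1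

lemma IsJumpLaw.exists_hasRange {p : ℤ → ℝ} (hp : IsJumpLaw p) : ∃ R, HasRange p R := by
  obtain ⟨R, hR⟩ := hp.finite_range
  have h0 : ∀ z : ℤ, z ∉ Finset.Icc (-(R.toNat : ℤ)) R.toNat → p z = 0 := by
    intro z hz
    refine hR z ?_
    rw [Finset.mem_Icc] at hz
    rcases abs_cases z with h | h <;> omega
  refine ⟨R.toNat, hp.nonneg, h0, ?_⟩
  rw [← hp.sum_one, tsum_eq_sum h0]

section Stationary

variable {p : ℤ → ℝ} {R : ℕ} {ρ : unitInterval} {Ω : Type*} [mΩ : MeasurableSpace Ω]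
  {μ : Measure Ω} {ℱ : Filtration ℝ≥0 mΩ} {η : ℝ≥0 → Ω → Config 2}

lemma IsStationaryProcess.integral_initial (h : IsStationaryProcess p ρ μ ℱ η)
    {F : Config 2 → ℝ} (hF : Continuous F) :
    ∫ ω, F (η 0 ω) ∂μ = ∫ ξ, F ξ ∂bernoulliProduct ρ := by
  rw [← h.initial, integral_map (h.exclusion.measurable 0).aemeasurable
    hF.measurable.aestronglyMeasurable]

/-- The translation of a configuration by `-a`. -/
def translate {k : ℕ} (a : ℤ) (ζ : Config k) : Config k := ζ ∘ Equiv.addRight a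

lemma translate_apply {k : ℕ} (a : ℤ) (ζ : Config k) (x : ℤ) : translate a ζ x = ζ (x + a) := rfl

lemma continuous_translate {k : ℕ} (a : ℤ) : Continuous (translate a : Config k → Config k) :=
  continuous_comp_perm _

/-- The rates are homogeneous in space, so a translated process solves the same martingale problem.
-/
lemma generator_comp_translate {k : ℕ} (p : ℤ → ℝ) (a : ℤ) (f : Config k → ℝ) (ζ : Config k) :
    generator p (fun ξ => f (translate a ξ)) ζ = generator p f (translate a ζ) := by
  unfold generator
  rw [← (Equiv.addRight a).tsum_eq]
  refine tsum_congr fun x => tsum_congr fun z => ?_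
  have e : translate a (exchange ζ (x + a) (x + a + z)) =
      exchange (translate a ζ) x (x + z) := by
    funext u
    simp only [translate_apply, exchange, Function.comp_apply, Equiv.swap_apply_def]
    congr 1
    split_ifs <;> omega
  simp only [Equiv.coe_addRight, translate_apply, e, add_right_comm x z a]

lemma IsExclusionProcess.translate {k : ℕ} {ζ : ℝ≥0 → Ω → Config k}
    (h : IsExclusionProcess p μ ℱ ζ) (a : ℤ) :
    IsExclusionProcess p μ ℱ fun t ω => translate a (ζ t ω) where
  adapted t := (continuous_translate a).measurable.comp (h.adapted t)
  right_continuous ω x t := h.right_continuous ω (x + a) t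
  left_limits ω x t := h.left_limits ω (x + a) t
  martingale f hf := by
    obtain ⟨A, hA⟩ := hf
    have hloc : IsLocal fun ξ : Config k => f (AEP.translate a ξ) := by
      refine ⟨A.image (· + a), fun ξ ξ' hξ => hA fun u hu => hξ _ ?_⟩
      exact Finset.mem_coe.mpr (Finset.mem_image_of_mem _ hu)
    have := h.martingale _ hloc
    simpa only [generator_comp_translate] using this

lemma IsStationaryProcess.translate (h : IsStationaryProcess p ρ μ ℱ η) (a : ℤ) :
    IsStationaryProcess p ρ μ ℱ fun t ω => translate a (η t ω) where
  exclusion := h.exclusion.translate a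
  initial := by
    have h1 := Measure.map_map (μ := μ) (continuous_translate a).measurable
      (h.exclusion.measurable 0)
    rw [h.initial] at h1
    exact h1.symm.trans (map_comp_perm_bernoulliProduct ρ _)

variable [IsProbabilityMeasure μ]

/-- The approximating sequence involves only `p`, `R` and `ρ`: two-time correlations do not depend
on the realization of the process. -/
lemma IsStationaryProcess.tendsto_ringSemigroup (h : IsStationaryProcess p ρ μ ℱ η)
    (hp : HasRange p R) {m : ℕ} {f g : C(Config 2, ℝ)}
    (hf : DependsOn f (Set.Icc (-m : ℤ) m)) (t : ℝ≥0) :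
    Tendsto (fun N => ∫ ξ, ringSemigroup p R N 2 t f ξ * g ξ ∂bernoulliProduct ρ) atTop
      (𝓝 (∫ ω, f (η t ω) * g (η 0 ω) ∂μ)) := by
  refine (h.exclusion.tendsto_ringSemigroup hp.nonneg hp.eq_zero hp.sum_eq_one hf
    (g.continuous.measurable.comp (h.exclusion.adapted 0)) (C := ‖g‖)
    (fun ω => g.norm_coe_le_norm _) t).congr fun N => ?_
  exact h.integral_initial ((ContinuousMap.continuous _).mul g.continuous)

/-- Time reversal of the stationary process amounts to a reflection of space. -/
theorem IsStationaryProcess.integral_mul_reflect (h : IsStationaryProcess p ρ μ ℱ η)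
    (hp : HasRange p R) {m : ℕ} {f g : C(Config 2, ℝ)}
    (hf : DependsOn f (Set.Icc (-m : ℤ) m)) (hg : DependsOn g (Set.Icc (-m : ℤ) m)) (t : ℝ≥0) :
    ∫ ω, f (η t ω) * g (reflect (η 0 ω)) ∂μ = ∫ ω, g (η t ω) * f (reflect (η 0 ω)) ∂μ := by
  have h1 := h.tendsto_ringSemigroup hp (g := g.comp ⟨reflect, continuous_reflect⟩) hf t
  have h2 := h.tendsto_ringSemigroup hp (g := f.comp ⟨reflect, continuous_reflect⟩) hg t
  refine tendsto_nhds_unique h1 (h2.congr fun N => ?_)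
  -- The duality on the ring, followed by the substitution `ξ ↦ reflect ξ`, under which the product
  -- measure is invariant.
  have h3 := integral_ringSemigroup_mul_reflect p R N ρ f g t
  have h4 := integral_comp_perm ρ (Equiv.neg ℤ)
    (f := fun ξ => ringSemigroup p R N 2 t g ξ * f (reflect ξ))
    ((ContinuousMap.continuous _).mul (f.continuous.comp continuous_reflect))
  simp only [ContinuousMap.comp_apply, ContinuousMap.coe_mk] at h3 ⊢
  rw [h3, ← h4]
  refine integral_congr_ae (Eventually.of_forall fun ξ => ?_)
  change ringSemigroup p R N 2 t g (reflect ξ) * f (reflect (reflect ξ)) = _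
  rw [reflect_reflect]

/-- Translation invariance of the stationary process. -/
theorem IsStationaryProcess.integral_translate (h : IsStationaryProcess p ρ μ ℱ η)
    (hp : HasRange p R) (a : ℤ) {m : ℕ} {f g : C(Config 2, ℝ)}
    (hf : DependsOn f (Set.Icc (-m : ℤ) m)) (t : ℝ≥0) :
    ∫ ω, f (AEP.translate a (η t ω)) * g (AEP.translate a (η 0 ω)) ∂μ =
      ∫ ω, f (η t ω) * g (η 0 ω) ∂μ :=
  -- The translated process is stationary for the same `p` and `ρ`, so both sides are limits of one
  -- sequence.
  tendsto_nhds_unique ((h.translate a).tendsto_ringSemigroup hp hf t)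
    (h.tendsto_ringSemigroup hp hf t)

/-- Correlations with the initial content of the origin measure the influence of the origin. -/
lemma IsStationaryProcess.tendsto_influence (h : IsStationaryProcess p ρ μ ℱ η)
    (hp : HasRange p R) {m : ℕ} {f u : C(Config 2, ℝ)}
    (hf : DependsOn f (Set.Icc (-m : ℤ) m)) (hu : ∀ ξ a, u (Function.update ξ 0 a) = u ξ)
    (t : ℝ≥0) :
    Tendsto (fun N => ρ * (1 - ρ) * ∫ ξ,
        (ringSemigroup p R N 2 t f (Function.update ξ 0 1) -
          ringSemigroup p R N 2 t f (Function.update ξ 0 0)) * u ξ ∂bernoulliProduct ρ) atTop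
      (𝓝 (∫ ω, f (η t ω) * ((occ (η 0 ω) 0 - ρ) * u (η 0 ω)) ∂μ)) := by
  refine (h.tendsto_ringSemigroup hp (g := (occMap 0 - ContinuousMap.const (Config 2) (ρ : ℝ)) * u)
    hf t).congr fun N => ?_
  set P := ringSemigroup p R N 2 t f with hP
  have hc : ∀ v : Fin 2, Continuous fun ξ => P (Function.update ξ 0 v) * u ξ := fun v =>
    (P.continuous.comp (continuous_update_const 0 v)).mul u.continuous
  -- Resampling the origin: `η_0 - ρ` equals `1 - ρ` with probability `ρ` and `-ρ` with probability
  -- `1 - ρ`, so both values carry the weight `±ρ(1-ρ)`.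
  have hres := integral_bernoulliProduct_eq ρ 0
    (P.continuous.mul ((occMap 0 - ContinuousMap.const (Config 2) (ρ : ℝ)) * u).continuous)
  simp only [Pi.mul_apply] at hres
  rw [hres]
  have e1 : ∀ ξ : Config 2, P (Function.update ξ 0 1) *
      ((occMap 0 - ContinuousMap.const (Config 2) (ρ : ℝ)) * u) (Function.update ξ 0 1) =
      (1 - ρ) * (P (Function.update ξ 0 1) * u ξ) := fun ξ => by
    simp [hu, occ]; ring
  have e0 : ∀ ξ : Config 2, P (Function.update ξ 0 0) *
      ((occMap 0 - ContinuousMap.const (Config 2) (ρ : ℝ)) * u) (Function.update ξ 0 0) =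
      -ρ * (P (Function.update ξ 0 0) * u ξ) := fun ξ => by
    simp [hu, occ]; ring
  simp_rw [e1, e0, sub_mul (P _) (P _)]
  rw [integral_const_mul, integral_const_mul,
    integral_sub (integrable_of_continuous (hc 1)) (integrable_of_continuous (hc 0))]
  ring

/-- With weights growing away from the origin, a function of distant sites has a small constant,
while the origin has weight `1`. The constant thus bounds the influence of the origin directly. -/
lemma hasInfluence_of_dependsOn_pair {k : ℕ} {f : C(Config k, ℝ)} {x y : ℤ}
    (hf : DependsOn f {x, y}) (h1 : ∀ ξ ξ', |f ξ - f ξ'| ≤ 1) :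
    HasInfluence (fun u : ℤ => (2 : ℝ) ^ u.natAbs)
      ((1 / 2) ^ x.natAbs + (1 / 2) ^ y.natAbs) f := by
  intro u ξ a
  have hone : ∀ v : ℤ, (1 / 2 : ℝ) ^ v.natAbs * 2 ^ v.natAbs = 1 := fun v => by
    rw [← mul_pow]; norm_num
  have hpos : ∀ v : ℤ, 0 ≤ (1 / 2 : ℝ) ^ v.natAbs * 2 ^ u.natAbs := fun v => by positivity
  by_cases hu : u = x ∨ u = y
  · refine (h1 _ _).trans ?_
    rw [add_mul]
    rcases hu with rfl | rfl
    · linarith [hone u, hpos y]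
    · linarith [hone u, hpos x]
  · have h2 : f (Function.update ξ u a) = f ξ := by
      refine hf fun v hv => Function.update_of_ne ?_ _ _
      rintro rfl
      exact hu (by simpa using hv)
    rw [h2, sub_self, abs_zero]
    positivity

/-- Correlations decay exponentially with the distance. -/
lemma IsStationaryProcess.abs_integral_le (h : IsStationaryProcess p ρ μ ℱ η)
    (hp : HasRange p R) {f u : C(Config 2, ℝ)} {x y : ℤ}
    (hf : DependsOn f {x, y}) (hf1 : ∀ ξ ξ', |f ξ - f ξ'| ≤ 1)
    (hu : ∀ ξ a, u (Function.update ξ 0 a) = u ξ) (hu1 : ∀ ξ, |u ξ| ≤ 1) (t : ℝ≥0) :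
    |∫ ω, f (η t ω) * ((occ (η 0 ω) 0 - ρ) * u (η 0 ω)) ∂μ| ≤
      ((1 / 2) ^ x.natAbs + (1 / 2) ^ y.natAbs) * Real.exp (2 * 2 ^ R * t) := by
  have hf' : DependsOn f (Set.Icc (-(x.natAbs + y.natAbs : ℕ) : ℤ) (x.natAbs + y.natAbs : ℕ)) := by
    refine hf.mono ?_
    rintro v (rfl | rfl) <;> exact Set.mem_Icc.mpr ⟨by omega, by omega⟩
  refine le_of_tendsto (h.tendsto_influence hp hf' hu t).abs ?_
  filter_upwards [eventually_ge_atTop R] with N hN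
  set M : ℝ := ((1 / 2) ^ x.natAbs + (1 / 2) ^ y.natAbs) * Real.exp (2 * 2 ^ R * t)
  have hI := (hasInfluence_of_dependsOn_pair hf hf1).ringSemigroup hp.nonneg hp.sum_eq_one
    (N := N) (C := 2 ^ R) (by positivity)
    (fun v hv z hz => pow_natAbs_wrap hN (r := 2) (c := 2) (by norm_num) (by norm_num)
      (by norm_num) (by norm_num) hv hz) (by positivity) t.2
  have hI' : ∀ ξ : Config 2, |(ringSemigroup p R N 2 t f (Function.update ξ 0 1) -
      ringSemigroup p R N 2 t f (Function.update ξ 0 0)) * u ξ| ≤ M := by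
    intro ξ
    have h1 := hI 0 (Function.update ξ 0 0) 1
    rw [Function.update_idem] at h1
    have h1' : |ringSemigroup p R N 2 t f (Function.update ξ 0 1) -
        ringSemigroup p R N 2 t f (Function.update ξ 0 0)| ≤ M := by
      simp only [Int.natAbs_zero, pow_zero, mul_one] at h1
      exact h1
    rw [abs_mul]
    calc _ ≤ M * 1 := mul_le_mul h1' (hu1 ξ) (abs_nonneg _)
          (by positivity)
      _ = M := mul_one M
  have h2 := norm_integral_le_of_norm_le_const (μ := bernoulliProduct ρ)
    (f := fun ξ => (ringSemigroup p R N 2 t f (Function.update ξ 0 1) -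
      ringSemigroup p R N 2 t f (Function.update ξ 0 0)) * u ξ) (C := M)
    (Eventually.of_forall hI')
  simp only [probReal_univ, mul_one, Real.norm_eq_abs] at h2
  rw [abs_mul]
  have h3 : |(ρ : ℝ) * (1 - ρ)| ≤ 1 := by
    have h4 := ρ.2.1
    have h5 := ρ.2.2
    rw [abs_of_nonneg (by nlinarith)]
    nlinarith
  calc _ ≤ 1 * M := mul_le_mul h3 h2 (abs_nonneg _) zero_le_one
    _ = M := one_mul M

end Stationary

/-! ### The second-class particle as a discrepancy -/

lemma continuous_withSecondClass : Continuous withSecondClass := by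
  refine continuous_pi fun x => ?_
  exact continuous_of_discreteTopology.comp (continuous_apply x)
    (g := fun b : Fin 2 => if x = 0 then (1 : Fin 3) else if b = 1 then 2 else 0)

/-- The basic coupling: merging adjacent types does not disturb the dynamics, because sorting
commutes with monotone maps. -/
lemma ringSemigroup_comp_monotone {k l : ℕ} {c : Fin k → Fin l} (hc : Monotone c) (p : ℤ → ℝ)
    (R N : ℕ) (t : ℝ) {f : C(Config l, ℝ)} {F : C(Config k, ℝ)}
    (hF : ∀ ζ : Config k, F ζ = f fun u => c (ζ u)) (ζ : Config k) :
    ringSemigroup p R N k t F ζ = ringSemigroup p R N l t f fun u => c (ζ u) := by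
  have h1 : ∀ (n : ℕ) (ζ : Config k),
      (ringOp p R N k ^ n) F ζ = (ringOp p R N l ^ n) f fun u => c (ζ u) := by
    intro n
    induction n with
    | zero => exact hF
    | succ n ih =>
      intro ζ
      rw [pow_succ', pow_succ', mul_apply_eq_comp, mul_apply_eq_comp,
        ringOp_apply, ringOp_apply]
      simp only [ih, comp_sortMap_of_monotone hc]
  exact expSemigroup_comm (ringRate p R N) t (ContinuousMap.evalCLM ℝ ζ)
    (ContinuousMap.evalCLM ℝ fun u => c (ζ u)) (Q := ringOp p R N k) (Q' := ringOp p R N l)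
    fun n => h1 n ζ

/-- Counting the second-class particle as a particle (`c₁`) or as a hole (`c₂`) gives two exclusion
processes that initially differ at the origin only. Their difference in occupation marks the
second-class particle. -/
lemma ringSemigroup_typeMap_one (p : ℤ → ℝ) (R N : ℕ) (t : ℝ) (x : ℤ) (ξ : Config 2) :
    ringSemigroup p R N 3 t (typeMap 1 x) (withSecondClass ξ) =
      ringSemigroup p R N 2 t (occMap x) (Function.update ξ 0 1) -
        ringSemigroup p R N 2 t (occMap x) (Function.update ξ 0 0) := by
  let c₁ : Fin 3 → Fin 2 := ![0, 1, 1]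
  let c₂ : Fin 3 → Fin 2 := ![0, 0, 1]
  have hc : ∀ c : Fin 3 → Fin 2, Continuous fun ζ : Config 3 => occMap x fun u => c (ζ u) :=
    fun c => continuous_apply_comp (fun b => ((c b : ℕ) : ℝ)) x
  have h12 : (typeMap 1 x : C(Config 3, ℝ)) =
      (⟨_, hc c₁⟩ : C(Config 3, ℝ)) - (⟨_, hc c₂⟩ : C(Config 3, ℝ)) := by
    ext ζ
    simp only [typeMap_apply, ContinuousMap.sub_apply, ContinuousMap.coe_mk, occMap_apply, occ,
      c₁, c₂]
    generalize ζ x = a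
    fin_cases a <;> simp
  have e1 : (fun u => c₁ (withSecondClass ξ u)) = Function.update ξ 0 1 := by
    funext u
    by_cases hu : u = 0
    · subst hu; simp [withSecondClass, c₁]
    · simp only [withSecondClass, hu, if_false, Function.update_of_ne hu, c₁]
      generalize ξ u = a
      fin_cases a <;> simp
  have e2 : (fun u => c₂ (withSecondClass ξ u)) = Function.update ξ 0 0 := by
    funext u
    by_cases hu : u = 0
    · subst hu; simp [withSecondClass, c₂]
    · simp only [withSecondClass, hu, if_false, Function.update_of_ne hu, c₂]
      generalize ξ u = a
      fin_cases a <;> simp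
  rw [h12, map_sub, ContinuousMap.sub_apply,
    ringSemigroup_comp_monotone (c := c₁) (by decide) p R N t (f := occMap x) (fun _ => rfl),
    ringSemigroup_comp_monotone (c := c₂) (by decide) p R N t (f := occMap x) (fun _ => rfl), e1, e2]

lemma dependsOn_of_eq_apply {k : ℕ} {f : C(Config k, ℝ)} {x : ℤ} (F : Fin k → ℝ)
    (hF : ∀ ξ, f ξ = F (ξ x)) : DependsOn f {x} := fun ξ ξ' h => by
  rw [hF, hF, h x rfl]

section SecondClass

variable {p : ℤ → ℝ} {R : ℕ} {ρ : unitInterval} {Ω : Type*} [mΩ : MeasurableSpace Ω]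
  {μ : Measure Ω} {ℱ : Filtration ℝ≥0 mΩ} {η : ℝ≥0 → Ω → Config 2}
  {Ω' : Type*} [mΩ' : MeasurableSpace Ω'] {ν : Measure Ω'}
  {𝒢 : Filtration ℝ≥0 mΩ'} {ζ : ℝ≥0 → Ω' → Config 3}

lemma IsSecondClassProcess.integral_initial (hζ : IsSecondClassProcess p ρ ν 𝒢 ζ)
    {F : Config 3 → ℝ} (hF : Continuous F) :
    ∫ ω, F (ζ 0 ω) ∂ν = ∫ ξ, F (withSecondClass ξ) ∂bernoulliProduct ρ := by
  rw [← integral_map (φ := withSecondClass) continuous_withSecondClass.measurable.aemeasurable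
    hF.measurable.aestronglyMeasurable, ← hζ.initial,
    integral_map (hζ.exclusion.measurable 0).aemeasurable hF.measurable.aestronglyMeasurable]

variable [IsProbabilityMeasure ν]

lemma IsSecondClassProcess.tendsto_ringSemigroup (hζ : IsSecondClassProcess p ρ ν 𝒢 ζ)
    (hp : HasRange p R) {m : ℕ} {f g : C(Config 3, ℝ)}
    (hf : DependsOn f (Set.Icc (-m : ℤ) m)) (t : ℝ≥0) :
    Tendsto (fun N => ∫ ξ, ringSemigroup p R N 3 t f (withSecondClass ξ) *
      g (withSecondClass ξ) ∂bernoulliProduct ρ) atTop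
      (𝓝 (∫ ω, f (ζ t ω) * g (ζ 0 ω) ∂ν)) := by
  refine (hζ.exclusion.tendsto_ringSemigroup hp.nonneg hp.eq_zero hp.sum_eq_one hf
    (g.continuous.measurable.comp (hζ.exclusion.adapted 0)) (C := ‖g‖)
    (fun ω => g.norm_coe_le_norm _) t).congr fun N => ?_
  exact hζ.integral_initial ((ContinuousMap.continuous _).mul g.continuous)

/-- The law of the second-class particle in terms of correlations of the stationary process. -/
theorem IsSecondClassProcess.integral_typeMap_one [IsProbabilityMeasure μ]
    (hζ : IsSecondClassProcess p ρ ν 𝒢 ζ)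
    (hη : IsStationaryProcess p ρ μ ℱ η) (hp : HasRange p R) (g : C(Config 3, ℝ)) (x : ℤ)
    (t : ℝ≥0) :
    ρ * (1 - ρ) * ∫ ω, typeMap 1 x (ζ t ω) * g (ζ 0 ω) ∂ν =
      ∫ ω, occ (η t ω) x * ((occ (η 0 ω) 0 - ρ) * g (withSecondClass (η 0 ω))) ∂μ := by
  have hsub : ({x} : Set ℤ) ⊆ Set.Icc (-(x.natAbs : ℕ) : ℤ) (x.natAbs : ℕ) := by
    rintro v rfl; exact Set.mem_Icc.mpr ⟨by omega, by omega⟩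
  have h1 := hζ.tendsto_ringSemigroup hp (g := g) (f := typeMap 1 x)
    ((dependsOn_of_eq_apply (fun b => if b = 1 then 1 else 0) fun _ => rfl).mono hsub) t
  have h2 := hη.tendsto_influence hp (f := occMap x)
    (u := g.comp ⟨_, continuous_withSecondClass⟩)
    ((dependsOn_of_eq_apply (fun b => ((b : ℕ) : ℝ)) fun _ => rfl).mono hsub)
    (fun ξ a => by
      have : withSecondClass (Function.update ξ 0 a) = withSecondClass ξ := by
        funext u
        by_cases hu : u = 0 <;> simp [withSecondClass, hu]
      simp [this]) t
  -- For every `N` the two ring expressions now coincide, so their limits do.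
  simp only [ringSemigroup_typeMap_one] at h1
  exact tendsto_nhds_unique (h1.const_mul _) h2

/-- There is never more than one second-class particle. -/
lemma IsSecondClassProcess.integral_typeMap_mul_eq_zero (hζ : IsSecondClassProcess p ρ ν 𝒢 ζ)
    (hp : HasRange p R) {x y : ℤ} (hxy : x ≠ y) (t : ℝ≥0) :
    ∫ ω, typeMap 1 x (ζ t ω) * typeMap 1 y (ζ t ω) ∂ν = 0 := by
  have hsub : ({x, y} : Set ℤ) ⊆
      Set.Icc (-(x.natAbs + y.natAbs : ℕ) : ℤ) (x.natAbs + y.natAbs : ℕ) := by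
    rintro v (rfl | rfl) <;> exact Set.mem_Icc.mpr ⟨by omega, by omega⟩
  have hf : DependsOn ((typeMap 1 x * typeMap 1 y : C(Config 3, ℝ)))
      (Set.Icc (-(x.natAbs + y.natAbs : ℕ) : ℤ) (x.natAbs + y.natAbs : ℕ)) := by
    intro ξ ξ' h
    have hx := h x (hsub (by simp))
    have hy := h y (hsub (by simp))
    simp [hx, hy]
  have h1 := hζ.tendsto_ringSemigroup hp (g := 1) hf t
  -- Sorting permutes sites, so it cannot create a second site of type `1`.
  have h2 : ∀ N (n : ℕ) (ξ : Config 3), (∀ u v, u ≠ v → ¬(ξ u = 1 ∧ ξ v = 1)) →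
      (ringOp p R N 3 ^ n) (typeMap 1 x * typeMap 1 y) ξ = 0 := by
    intro N n
    induction n with
    | zero =>
      intro ξ hξ
      have := hξ x y hxy
      simp only [pow_zero, one_apply_eq_self, ContinuousMap.mul_apply, typeMap_apply]
      split_ifs with ha hb <;> simp_all
    | succ n ih =>
      intro ξ hξ
      rw [pow_succ', mul_apply_eq_comp, ringOp_apply]
      refine Finset.sum_eq_zero fun a _ => Finset.sum_eq_zero fun z _ => ?_
      rw [ih, mul_zero]
      unfold sortMap
      split_ifs
      · exact fun u v huv => hξ _ _ ((Equiv.injective _).ne huv)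
      · exact hξ
  have h3 : ∀ N (ξ : Config 2),
      ringSemigroup p R N 3 t (typeMap 1 x * typeMap 1 y) (withSecondClass ξ) = 0 := by
    intro N ξ
    have := expSemigroup_comm (ringRate p R N) t
      (ContinuousMap.evalCLM ℝ (withSecondClass ξ)) (0 : C(Config 3, ℝ) →L[ℝ] ℝ)
      (Q := ringOp p R N 3) (Q' := ringOp p R N 3) (f := typeMap 1 x * typeMap 1 y) (g := 0)
      fun n => by
        refine h2 N n _ fun u v huv hc => ?_
        have key : ∀ w, withSecondClass ξ w = 1 → w = 0 := by
          intro w hw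
          by_contra hw0
          simp only [withSecondClass, hw0, if_false] at hw
          split_ifs at hw <;> simp_all
        exact huv ((key u hc.1).trans (key v hc.2).symm)
    simpa using this
  simp only [h3, zero_mul, integral_zero] at h1
  have := tendsto_nhds_unique h1 tendsto_const_nhds
  simpa using this

end SecondClass

/-! ### Correlation functions -/

/-- `P(X(t) = y, η_z(0) = 1)` for the second-class particle `X` and the first-class particles `η`. -/
def jointWeight {Ω : Type*} [MeasurableSpace Ω] (ν : Measure Ω) (ζ : ℝ≥0 → Ω → Config 3)
    (z y : ℤ) (t : ℝ≥0) : ℝ :=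
  ∫ ω, typeMap 1 y (ζ t ω) * typeMap 2 z (ζ 0 ω) ∂ν

/-- `E[η_x(t) η_{x+z}(t) (η_0(0) - ρ)]`. -/
def pairCorrelation (ρ : ℝ) {Ω : Type*} [MeasurableSpace Ω] (μ : Measure Ω)
    (η : ℝ≥0 → Ω → Config 2) (z x : ℤ) (t : ℝ≥0) : ℝ :=
  ∫ ω, (occMap x * occMap (x + z)) (η t ω) * (occ (η 0 ω) 0 - ρ) ∂μ

/-- `E[η_x(t) (1 - η_{x+z}(t)) (η_0(0) - ρ)]`. -/
def fluxCorrelation (ρ : ℝ) {Ω : Type*} [MeasurableSpace Ω] (μ : Measure Ω)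
    (η : ℝ≥0 → Ω → Config 2) (z x : ℤ) (t : ℝ≥0) : ℝ :=
  ∫ ω, (occMap x - occMap x * occMap (x + z)) (η t ω) * (occ (η 0 ω) 0 - ρ) ∂μ

lemma occ_eq_zero_or_one (ξ : Config 2) (x : ℤ) : occ ξ x = 0 ∨ occ ξ x = 1 := by
  unfold occ
  generalize ξ x = a
  fin_cases a <;> simp

lemma dependsOn_occMap_pair (x y : ℤ) : DependsOn (occMap x * occMap y : C(Config 2, ℝ)) {x, y} :=
  fun ξ ξ' h => by
    have hx := h x (by simp)
    have hy := h y (by simp)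
    simp [occ, hx, hy]

lemma dependsOn_occMap (x y : ℤ) : DependsOn (occMap x : C(Config 2, ℝ)) {x, y} :=
  (dependsOn_of_eq_apply (fun b => ((b : ℕ) : ℝ)) fun _ => rfl).mono (by simp)

lemma pair_subset_Icc (x y : ℤ) : ({x, y} : Set ℤ) ⊆
    Set.Icc (-(x.natAbs + y.natAbs : ℕ) : ℤ) (x.natAbs + y.natAbs : ℕ) := by
  rintro v (rfl | rfl) <;> exact Set.mem_Icc.mpr ⟨by omega, by omega⟩

lemma abs_occ_sub_le (ξ : Config 2) (x : ℤ) (ρ : unitInterval) : |occ ξ x - ρ| ≤ 1 := by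
  have h1 := ρ.2.1
  have h2 := ρ.2.2
  rw [abs_le]
  rcases occ_eq_zero_or_one ξ x with h | h <;> rw [h] <;> constructor <;> linarith

/-- The generator on an occupation variable is a difference of currents. -/
lemma generator_occMap {p : ℤ → ℝ} {R : ℕ} (hp : HasRange p R) (x : ℤ) (ξ : Config 2) :
    generator p (occMap x) ξ =
      (∑ z ∈ Finset.Icc (-R : ℤ) R, p z • ((occMap (x - z) - occMap (x - z) * occMap (x - z + z)) -
        (occMap x - occMap x * occMap (x + z))) : C(Config 2, ℝ)) ξ := by
  have hf : DependsOn (occMap x : C(Config 2, ℝ)) (Set.Icc (-(x.natAbs : ℕ) : ℤ) x.natAbs) :=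
    (dependsOn_of_eq_apply (fun b => ((b : ℕ) : ℝ)) fun _ => rfl).mono (by
      rintro v rfl; exact Set.mem_Icc.mpr ⟨by omega, by omega⟩)
  rw [generator_eq_boxGenerator hp.eq_zero hf (L := x.natAbs + R) le_rfl, boxGenerator_apply,
    Finset.sum_comm]
  simp only [ContinuousMap.sum_apply, ContinuousMap.smul_apply, smul_eq_mul, ← Finset.mul_sum]
  refine Finset.sum_congr rfl fun z hz => ?_
  congr 1
  -- Gain by a jump from `x - z`, loss by a jump from `x`. For `z = 0` the two cancel.
  have hpt : ∀ y : ℤ, occMap x (sortMap y (y + z) ξ) - occMap x ξ =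
      (if y = x - z then occ ξ y * (1 - occ ξ (y + z)) else 0) -
        if y = x then occ ξ y * (1 - occ ξ (y + z)) else 0 := by
    intro y
    simp only [occMap_apply, occ, sortMap_apply]
    by_cases h1 : x = y
    · subst h1
      by_cases hz0 : z = 0
      · subst hz0; simp
      · have : x ≠ x - z := by omega
        simp only [if_true, if_neg this]
        generalize ξ x = a
        generalize ξ (x + z) = c
        fin_cases a <;> fin_cases c <;> simp
    · rw [if_neg h1, if_neg (Ne.symm h1)]
      by_cases h2 : x = y + z
      · have h3 : y = x - z := by omega
        rw [if_pos h2, if_pos h3, ← h2]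
        generalize ξ x = a
        generalize ξ y = c
        fin_cases a <;> fin_cases c <;> simp
      · have h3 : ¬ y = x - z := by omega
        rw [if_neg h2, if_neg h3]; simp
  simp_rw [hpt, Finset.sum_sub_distrib, Finset.sum_ite_eq']
  rw [Finset.mem_Icc] at hz
  rw [if_pos (Finset.mem_Icc.mpr ⟨by omega, by omega⟩),
    if_pos (Finset.mem_Icc.mpr ⟨by omega, by omega⟩)]
  simp only [ContinuousMap.sub_apply, ContinuousMap.mul_apply, occMap_apply]
  ring

section Correlations

variable {p : ℤ → ℝ} {R : ℕ} {ρ : unitInterval} {Ω : Type*} [mΩ : MeasurableSpace Ω]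
  {μ : Measure Ω} {ℱ : Filtration ℝ≥0 mΩ} {η : ℝ≥0 → Ω → Config 2}

lemma IsStationaryProcess.measurable_initial (h : IsStationaryProcess p ρ μ ℱ η) :
    Measurable[ℱ 0] fun ω => occ (η 0 ω) 0 - (ρ : ℝ) :=
  (((occMap 0).continuous.measurable.comp (h.exclusion.adapted 0)).sub_const _)

/-- A function of the initial configuration off the origin is uncorrelated with the origin. -/
lemma integral_mul_occ_sub_eq_zero {u : Config 2 → ℝ} (hu : Continuous u)
    (hu0 : ∀ ξ a, u (Function.update ξ 0 a) = u ξ) :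
    ∫ ξ, u ξ * (occ ξ 0 - ρ) ∂bernoulliProduct ρ = 0 := by
  rw [integral_bernoulliProduct_eq ρ 0 (f := fun ξ => u ξ * (occ ξ 0 - (ρ : ℝ)))
    (hu.mul ((occMap 0).continuous.sub continuous_const))]
  simp only [hu0, occ, Function.update_self]
  rw [integral_mul_const, integral_mul_const]
  simp
  ring

lemma IsStationaryProcess.integral_initial_mul (h : IsStationaryProcess p ρ μ ℱ η)
    {u : Config 2 → ℝ} (hu : Continuous u) (hu0 : ∀ ξ a, u (Function.update ξ 0 a) = u ξ) :
    ∫ ω, u (η 0 ω) * (occ (η 0 ω) 0 - ρ) ∂μ = 0 := by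
  rw [h.integral_initial (F := fun ξ => u ξ * (occ ξ 0 - ρ))
    (hu.mul ((occMap 0).continuous.sub continuous_const)), integral_mul_occ_sub_eq_zero hu hu0]

lemma IsStationaryProcess.integral_initial_sub (h : IsStationaryProcess p ρ μ ℱ η) :
    ∫ ω, (occ (η 0 ω) 0 - ρ) ∂μ = 0 := by
  simpa using h.integral_initial_mul (u := fun _ => 1) continuous_const (by simp)

/-- A pair has no preferred site. This is the source of the evenness in `z` of `positionMoment`. -/
lemma pairCorrelation_neg (x z : ℤ) (t : ℝ≥0) :
    pairCorrelation ρ μ η (-z) (x + z) t = pairCorrelation ρ μ η z x t := by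
  unfold pairCorrelation
  rw [add_neg_cancel_right, mul_comm (occMap (x + z))]

variable [IsProbabilityMeasure μ]

lemma IsStationaryProcess.integrable_mul_initial (h : IsStationaryProcess p ρ μ ℱ η)
    (f : C(Config 2, ℝ)) (t : ℝ≥0) :
    Integrable (fun ω => f (η t ω) * (occ (η 0 ω) 0 - (ρ : ℝ))) μ :=
  integrable_comp_mul (h.exclusion.measurable t) (h.measurable_initial.mono (ℱ.le 0) le_rfl)
    (fun ω => abs_occ_sub_le (η 0 ω) 0 ρ) f

lemma IsStationaryProcess.continuous_correlation (h : IsStationaryProcess p ρ μ ℱ η)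
    (hp : HasRange p R) {m : ℕ} {f : C(Config 2, ℝ)} (hf : DependsOn f (Set.Icc (-m : ℤ) m)) :
    Continuous fun s : ℝ => ∫ ω, f (η s.toNNReal ω) * (occ (η 0 ω) 0 - (ρ : ℝ)) ∂μ :=
  h.exclusion.continuous_integral (DependsOn.isLocal hf)
    (generator_eq_boxGenerator hp.eq_zero hf le_rfl) h.measurable_initial
    fun ω => abs_occ_sub_le (η 0 ω) 0 ρ

/-- The density is preserved. -/
lemma IsStationaryProcess.integral_occ_sub (h : IsStationaryProcess p ρ μ ℱ η)
    (hp : HasRange p R) (x : ℤ) (t : ℝ≥0) : ∫ ω, (occ (η t ω) x - ρ) ∂μ = 0 := by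
  have hd : DependsOn ((occMap x - ContinuousMap.const (Config 2) (ρ : ℝ) : C(Config 2, ℝ)))
      (Set.Icc (-(x.natAbs : ℕ) : ℤ) x.natAbs) := by
    intro ξ ξ' hξ
    have := hξ x (Set.mem_Icc.mpr ⟨by omega, by omega⟩)
    simp [occ, this]
  -- Reversal against the constant `1` carries the one-time expectation back to time `0`.
  have h1 := h.integral_mul_reflect hp hd (g := 1) (fun _ _ _ => rfl) t
  simp only [ContinuousMap.one_apply, mul_one, one_mul, ContinuousMap.sub_apply, occMap_apply,
    ContinuousMap.const_apply] at h1
  rw [h1]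
  have h2 := h.integral_initial (F := fun ξ => occ (reflect ξ) x - ρ)
    (((occMap x).continuous.comp continuous_reflect).sub continuous_const)
  have h3 := integral_comp_perm ρ (Equiv.swap 0 (-x)) (f := fun ξ => occ ξ 0 - (ρ : ℝ))
    ((occMap 0).continuous.sub continuous_const)
  have h4 := h.integral_initial (F := fun ξ => occ ξ 0 - (ρ : ℝ))
    ((occMap 0).continuous.sub continuous_const)
  rw [h2, ← h.integral_initial_sub, h4, ← h3]
  simp [occ, reflect_apply]

/-- The centring at time `t` can be dropped because the initial factor has mean zero. -/
lemma IsStationaryProcess.twoPoint_eq (h : IsStationaryProcess p ρ μ ℱ η) (x : ℤ) (t : ℝ≥0) :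
    twoPoint ρ μ η x t = ∫ ω, occMap x (η t ω) * (occ (η 0 ω) 0 - ρ) ∂μ := by
  unfold twoPoint
  have i1 := h.integrable_mul_initial (occMap x) t
  have i2 := h.integrable_mul_initial (ContinuousMap.const _ (ρ : ℝ)) t
  simp only [ContinuousMap.const_apply] at i2
  simp only [sub_mul (occ _ x), occMap_apply] at i1 ⊢
  rw [integral_sub i1 i2, integral_const_mul, h.integral_initial_sub]
  simp

lemma IsStationaryProcess.fluxCorrelation_eq (h : IsStationaryProcess p ρ μ ℱ η) (z x : ℤ)
    (t : ℝ≥0) : fluxCorrelation ρ μ η z x t =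
      twoPoint ρ μ η x t - pairCorrelation ρ μ η z x t := by
  rw [h.twoPoint_eq, fluxCorrelation, pairCorrelation, ← integral_sub
    (h.integrable_mul_initial _ t) (h.integrable_mul_initial _ t)]
  simp only [ContinuousMap.sub_apply, sub_mul]

lemma IsStationaryProcess.abs_correlation_le (h : IsStationaryProcess p ρ μ ℱ η)
    (hp : HasRange p R) {f : C(Config 2, ℝ)} {x z : ℤ} (hz : z ∈ Finset.Icc (-R : ℤ) R)
    (hf : DependsOn f {x, x + z}) (hf1 : ∀ ξ ξ', |f ξ - f ξ'| ≤ 1) (t : ℝ≥0) :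
    |∫ ω, f (η t ω) * (occ (η 0 ω) 0 - ρ) ∂μ| ≤
      (1 + 2 ^ R) * Real.exp (2 * 2 ^ R * t) * (1 / 2) ^ x.natAbs := by
  have h1 := h.abs_integral_le hp hf hf1 (u := 1) (fun _ _ => rfl) (by simp) t
  simp only [ContinuousMap.one_apply, mul_one] at h1
  refine h1.trans ?_
  have h2 : (1 / 2 : ℝ) ^ (x + z).natAbs ≤ 2 ^ R * (1 / 2) ^ x.natAbs := by
    rw [Finset.mem_Icc] at hz
    calc (1 / 2 : ℝ) ^ (x + z).natAbs = 2 ^ R * (1 / 2) ^ ((x + z).natAbs + R) := by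
          rw [pow_add, mul_comm, mul_assoc, ← mul_pow]; norm_num
      _ ≤ _ := mul_le_mul_of_nonneg_left
          (pow_le_pow_of_le_one (by norm_num) (by norm_num) (by omega)) (by positivity)
  calc _ ≤ ((1 / 2) ^ x.natAbs + 2 ^ R * (1 / 2) ^ x.natAbs) * Real.exp (2 * 2 ^ R * t) :=
        mul_le_mul_of_nonneg_right (by linarith) (by positivity)
    _ = _ := by ring

lemma abs_occ_sub_occ_le (ξ ξ' : Config 2) (x : ℤ) : |occ ξ x - occ ξ' x| ≤ 1 := by
  rcases occ_eq_zero_or_one ξ x with h1 | h1 <;> rcases occ_eq_zero_or_one ξ' x with h2 | h2 <;>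
    simp [h1, h2]

lemma IsStationaryProcess.abs_twoPoint_le (h : IsStationaryProcess p ρ μ ℱ η)
    (hp : HasRange p R) (x : ℤ) (t : ℝ≥0) : |twoPoint ρ μ η x t| ≤
      (1 + 2 ^ R) * Real.exp (2 * 2 ^ R * t) * (1 / 2) ^ x.natAbs := by
  rw [h.twoPoint_eq]
  exact h.abs_correlation_le hp (z := 0) (by simp) (dependsOn_occMap _ _)
    (fun ξ ξ' => abs_occ_sub_occ_le ξ ξ' x) t

lemma IsStationaryProcess.abs_pairCorrelation_le (h : IsStationaryProcess p ρ μ ℱ η)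
    (hp : HasRange p R) {z : ℤ} (hz : z ∈ Finset.Icc (-R : ℤ) R) (x : ℤ) (t : ℝ≥0) :
    |pairCorrelation ρ μ η z x t| ≤
      (1 + 2 ^ R) * Real.exp (2 * 2 ^ R * t) * (1 / 2) ^ x.natAbs := by
  refine h.abs_correlation_le hp hz (dependsOn_occMap_pair _ _) (fun ξ ξ' => ?_) t
  simp only [ContinuousMap.mul_apply, occMap_apply]
  rcases occ_eq_zero_or_one ξ x with h1 | h1 <;> rcases occ_eq_zero_or_one ξ' x with h2 | h2 <;>
  rcases occ_eq_zero_or_one ξ (x + z) with h3 | h3 <;>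
  rcases occ_eq_zero_or_one ξ' (x + z) with h4 | h4 <;> simp [h1, h2, h3, h4]

lemma IsStationaryProcess.abs_fluxCorrelation_le (h : IsStationaryProcess p ρ μ ℱ η)
    (hp : HasRange p R) {z : ℤ} (hz : z ∈ Finset.Icc (-R : ℤ) R) (x : ℤ) (t : ℝ≥0) :
    |fluxCorrelation ρ μ η z x t| ≤
      2 * ((1 + 2 ^ R) * Real.exp (2 * 2 ^ R * t)) * (1 / 2) ^ x.natAbs := by
  rw [h.fluxCorrelation_eq]
  have h1 := h.abs_twoPoint_le hp x t
  have h2 := h.abs_pairCorrelation_le hp hz x t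
  refine (abs_sub _ _).trans ?_
  linarith

lemma IsStationaryProcess.twoPoint_zero (h : IsStationaryProcess p ρ μ ℱ η) (x : ℤ) :
    twoPoint ρ μ η x 0 = if x = 0 then (ρ : ℝ) * (1 - ρ) else 0 := by
  rw [h.twoPoint_eq]
  split_ifs with hx
  · subst hx
    have h1 := h.integral_initial (F := fun ξ => occMap 0 ξ * (occ ξ 0 - (ρ : ℝ)))
      ((occMap 0).continuous.mul ((occMap 0).continuous.sub continuous_const))
    rw [h1, integral_bernoulliProduct_eq ρ 0
      (f := fun ξ => occMap 0 ξ * (occ ξ 0 - (ρ : ℝ))) ((occMap 0).continuous.mul ((occMap 0).continuous.sub continuous_const))]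
    simp [occ]
  · exact h.integral_initial_mul (occMap x).continuous fun ξ a => by simp [occ, hx]

lemma IsStationaryProcess.continuous_fluxCorrelation (h : IsStationaryProcess p ρ μ ℱ η)
    (hp : HasRange p R) (z x : ℤ) :
    Continuous fun s : ℝ => fluxCorrelation ρ μ η z x s.toNNReal := by
  refine h.continuous_correlation hp (m := x.natAbs + (x + z).natAbs) ?_
  intro ξ ξ' hξ
  have hx := hξ x (pair_subset_Icc x (x + z) (by simp))
  have hy := hξ (x + z) (pair_subset_Icc x (x + z) (by simp))
  simp [occ, hx, hy]

/-- The continuity equation for the two-point function. -/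
lemma IsStationaryProcess.twoPoint_eq_add_integral (h : IsStationaryProcess p ρ μ ℱ η)
    (hp : HasRange p R) (x : ℤ) (t : ℝ≥0) :
    twoPoint ρ μ η x t = twoPoint ρ μ η x 0 +
      ∫ s in (0 : ℝ)..t, ∑ z ∈ Finset.Icc (-R : ℤ) R,
        p z * (fluxCorrelation ρ μ η z (x - z) s.toNNReal -
          fluxCorrelation ρ μ η z x s.toNNReal) := by
  have hloc : IsLocal (occMap x : C(Config 2, ℝ)) :=
    ⟨{x}, by simpa using dependsOn_of_eq_apply (fun b => ((b : ℕ) : ℝ)) fun _ => rfl⟩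
  rw [h.twoPoint_eq, h.twoPoint_eq, h.exclusion.integral_eq hloc (generator_occMap hp x)
    h.measurable_initial (fun ω => abs_occ_sub_le (η 0 ω) 0 ρ) t]
  congr 1
  refine intervalIntegral.integral_congr fun s _ => ?_
  simp only [ContinuousMap.sum_apply, Finset.sum_mul]
  rw [integral_finsetSum _ fun z _ => h.integrable_mul_initial _ _]
  refine Finset.sum_congr rfl fun z _ => ?_
  rw [fluxCorrelation, fluxCorrelation, ← integral_sub (h.integrable_mul_initial _ _)
    (h.integrable_mul_initial _ _), ← integral_const_mul]
  refine integral_congr_ae (Eventually.of_forall fun ω => ?_)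
  simp only [ContinuousMap.smul_apply, ContinuousMap.sub_apply, smul_eq_mul]
  ring

variable {Ω' : Type*} [mΩ' : MeasurableSpace Ω'] {ν : Measure Ω'} [IsProbabilityMeasure ν]
  {𝒢 : Filtration ℝ≥0 mΩ'} {ζ : ℝ≥0 → Ω' → Config 3}

lemma IsSecondClassProcess.integral_typeMap_eq_twoPoint (hζ : IsSecondClassProcess p ρ ν 𝒢 ζ)
    (h : IsStationaryProcess p ρ μ ℱ η) (hp : HasRange p R) (x : ℤ) (t : ℝ≥0) :
    ρ * (1 - ρ) * ∫ ω, typeMap 1 x (ζ t ω) ∂ν = twoPoint ρ μ η x t := by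
  rw [h.twoPoint_eq]
  simpa using hζ.integral_typeMap_one h hp 1 x t

lemma IsSecondClassProcess.jointWeight_eq (hζ : IsSecondClassProcess p ρ ν 𝒢 ζ)
    (h : IsStationaryProcess p ρ μ ℱ η) (hp : HasRange p R) {z : ℤ} (hz : z ≠ 0) (y : ℤ)
    (t : ℝ≥0) : ρ * (1 - ρ) * jointWeight ν ζ z y t =
      ∫ ω, occ (η t ω) y * ((occ (η 0 ω) 0 - ρ) * occ (η 0 ω) z) ∂μ := by
  have h1 := hζ.integral_typeMap_one h hp (typeMap 2 z) y t
  have h2 : ∀ ξ : Config 2, (typeMap 2 z : C(Config 3, ℝ)) (withSecondClass ξ) = occ ξ z := by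
    intro ξ
    simp only [typeMap_apply, withSecondClass, hz, if_false, occ]
    generalize ξ z = a
    fin_cases a <;> simp
  simp only [h2] at h1
  exact h1

/-- Correlations of pairs of sites in terms of the second-class particle. -/
theorem IsSecondClassProcess.pairCorrelation_eq (hζ : IsSecondClassProcess p ρ ν 𝒢 ζ)
    (h : IsStationaryProcess p ρ μ ℱ η) (hp : HasRange p R) {z : ℤ} (hz : z ≠ 0) (x : ℤ)
    (t : ℝ≥0) : pairCorrelation ρ μ η z x t =
      ρ * (1 - ρ) * jointWeight ν ζ z (x + z) t + ρ * twoPoint ρ μ η x t := by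
  let c : C(Config 2, ℝ) := ContinuousMap.const (Config 2) (ρ : ℝ)
  have hc : ∀ y : ℤ, DependsOn (occMap y - c : C(Config 2, ℝ))
      (Set.Icc (-(x.natAbs + (x + z).natAbs + y.natAbs : ℕ) : ℤ)
        (x.natAbs + (x + z).natAbs + y.natAbs : ℕ)) := by
    intro y ξ ξ' hξ
    have := hξ y (Set.mem_Icc.mpr ⟨by omega, by omega⟩)
    simp [occ, this, c]
  -- Time reversal brings the pair to time `0`, at the reflected sites `-x` and `-(x+z)`.
  have h1 : pairCorrelation ρ μ η z x t = ∫ ω, (occ (η t ω) 0 - ρ) *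
      (occ (η 0 ω) (-x) * occ (η 0 ω) (-(x + z))) ∂μ := by
    have := h.integral_mul_reflect hp (f := occMap x * occMap (x + z)) (g := occMap 0 - c)
      (m := x.natAbs + (x + z).natAbs + (0 : ℤ).natAbs)
      ((dependsOn_occMap_pair x (x + z)).mono (pair_subset_Icc x (x + z))) (hc 0) t
    simpa [pairCorrelation, c, occ, reflect_apply] using this
  -- Translation by `x + z` places the pair at `z` and at the origin, where the second-class
  -- particle starts.
  have h2 : pairCorrelation ρ μ η z x t = ∫ ω, (occ (η t ω) (x + z) - ρ) *
      (occ (η 0 ω) z * occ (η 0 ω) 0) ∂μ := by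
    have := h.integral_translate hp (x + z) (g := occMap (-x) * occMap (-(x + z))) (hc 0) t
    have e1 : -x + (x + z) = z := by ring
    have e2 : -z + -x + (x + z) = 0 := by ring
    rw [h1]
    simpa [c, occ, translate_apply, e1, e2] using this.symm
  have h3 : ∫ ω, (occ (η t ω) (x + z) - ρ) * occ (η 0 ω) z ∂μ = twoPoint ρ μ η x t := by
    have h4 := h.integral_translate hp z (f := occMap x - c) (g := occMap 0) (hc x) t
    have h5 : twoPoint ρ μ η x t = ∫ ω, (occMap x - c) (η t ω) * occMap 0 (η 0 ω) ∂μ -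
        ∫ ω, (occ (η t ω) x - ρ) * ρ ∂μ := by
      rw [← integral_sub]
      · simp only [twoPoint, ContinuousMap.sub_apply, occMap_apply, ContinuousMap.const_apply, c,
          mul_sub]
      · exact integrable_comp_mul (h.exclusion.measurable t)
          ((occMap 0).continuous.measurable.comp (h.exclusion.measurable 0))
          (fun ω => (occMap 0).norm_coe_le_norm _) _
      · exact integrable_comp_mul (h.exclusion.measurable t) measurable_const
          (C := |(ρ : ℝ)|) (fun ω => le_rfl) (occMap x - c)
    rw [h5, integral_mul_const, h.integral_occ_sub hp, zero_mul, sub_zero, ← h4]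
    simp [c, occ, translate_apply]
  have h6 := hζ.jointWeight_eq h hp hz (x + z) t
  have h7 : ∫ ω, (ρ : ℝ) * ((occ (η 0 ω) 0 - ρ) * occ (η 0 ω) z) ∂μ = 0 := by
    rw [integral_const_mul]
    have := h.integral_initial_mul (u := fun ξ => occ ξ z) (occMap z).continuous
      fun ξ a => by simp [occ, hz]
    simp only [mul_comm (occ _ z)] at this
    rw [this, mul_zero]
  have hm : Measurable fun ω => (occ (η 0 ω) 0 - ρ) * occ (η 0 ω) z :=
    (h.measurable_initial.mono (ℱ.le 0) le_rfl).mul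
      ((occMap z).continuous.measurable.comp (h.exclusion.measurable 0))
  have hocc : ∀ ξ : Config 2, |occ ξ z| ≤ 1 := fun ξ => by
    rcases occ_eq_zero_or_one ξ z with h | h <;> simp [h]
  have hb : ∀ ω, |(occ (η 0 ω) 0 - ρ) * occ (η 0 ω) z| ≤ 1 := fun ω => by
    rw [abs_mul]
    exact mul_le_one₀ (abs_occ_sub_le _ _ _) (abs_nonneg _) (hocc _)
  have i1 := integrable_comp_mul (μ := μ) (h.exclusion.measurable t) hm hb (occMap (x + z))
  have i2 := integrable_comp_mul (μ := μ) (h.exclusion.measurable t) hm hb c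
  have i3 : Integrable (fun ω => (occMap (x + z) - c) (η t ω) * occ (η 0 ω) z) μ :=
    integrable_comp_mul (h.exclusion.measurable t)
    ((occMap z).continuous.measurable.comp (h.exclusion.measurable 0))
    (fun ω => hocc (η 0 ω)) (occMap (x + z) - c)
  -- Split `η_0(0) = (η_0(0) - ρ) + ρ`. The first part is the joint weight `h6`, corrected by the
  -- vanishing term `h7`; the second is a translated two-point function, `h3`.
  have e : ∀ ω, (occ (η t ω) (x + z) - ρ) * (occ (η 0 ω) z * occ (η 0 ω) 0) =
      (occMap (x + z) (η t ω) * ((occ (η 0 ω) 0 - ρ) * occ (η 0 ω) z) -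
        c (η t ω) * ((occ (η 0 ω) 0 - ρ) * occ (η 0 ω) z)) +
      ρ * ((occMap (x + z) - c) (η t ω) * occ (η 0 ω) z) := fun ω => by
    simp only [c, ContinuousMap.sub_apply, ContinuousMap.const_apply, occMap_apply]
    ring
  rw [h2]
  simp_rw [e]
  have e' : ∫ ω, ((occMap (x + z) (η t ω) * ((occ (η 0 ω) 0 - ρ) * occ (η 0 ω) z) -
        c (η t ω) * ((occ (η 0 ω) 0 - ρ) * occ (η 0 ω) z)) +
      ρ * ((occMap (x + z) - c) (η t ω) * occ (η 0 ω) z)) ∂μ = _ :=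
    integral_add (i1.sub i2) (i3.const_mul (ρ : ℝ))
  have e'' := integral_sub i1 i2
  rw [e', integral_const_mul]
  rw [e'']
  simp only [c, ContinuousMap.sub_apply, ContinuousMap.const_apply, occMap_apply] at h3 ⊢
  rw [h7, h3, h6, sub_zero]

end Correlations

/-! ### Moments of the two-point function -/

lemma half_pow_natAbs_le_of_le {x y : ℤ} {R : ℕ} (h : x.natAbs ≤ y.natAbs + R) :
    (1 / 2 : ℝ) ^ y.natAbs ≤ 2 ^ R * (1 / 2) ^ x.natAbs := by
  calc (1 / 2 : ℝ) ^ y.natAbs = 2 ^ R * (1 / 2) ^ (y.natAbs + R) := by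
        rw [pow_add, mul_comm, mul_assoc, ← mul_pow]; norm_num
    _ ≤ _ := mul_le_mul_of_nonneg_left
        (pow_le_pow_of_le_one (by norm_num) (by norm_num) h) (by positivity)

lemma summable_abs_pow_mul_geometric (j : ℕ) (z : ℤ) :
    Summable fun x : ℤ => |((x + z : ℤ) : ℝ) ^ j| * (1 / 2 : ℝ) ^ x.natAbs := by
  have h1 := ((summable_natAbs_pow_mul_geometric j).mul_left (2 ^ z.natAbs)).comp_injective
    (Equiv.addRight z).injective
  refine Summable.of_nonneg_of_le (fun x => by positivity) (fun x => ?_) h1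
  have h2 : (1 / 2 : ℝ) ^ x.natAbs ≤ 2 ^ z.natAbs * (1 / 2) ^ (x + z).natAbs :=
    half_pow_natAbs_le_of_le (by omega)
  simp only [Function.comp_apply, Equiv.coe_addRight, Nat.cast_natAbs, Int.cast_abs, abs_pow]
  calc _ ≤ |((x + z : ℤ) : ℝ)| ^ j * (2 ^ z.natAbs * (1 / 2) ^ (x + z).natAbs) :=
        mul_le_mul_of_nonneg_left h2 (by positivity)
    _ = _ := by ring

lemma summable_pow_mul_of_abs_le {F : ℤ → ℝ} {C : ℝ}
    (hF : ∀ x : ℤ, |F x| ≤ C * (1 / 2 : ℝ) ^ x.natAbs) (j : ℕ) (z : ℤ) :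
    Summable fun x : ℤ => ((x + z : ℤ) : ℝ) ^ j * F x := by
  refine Summable.of_norm_bounded ((summable_abs_pow_mul_geometric j z).mul_left C) fun x => ?_
  rw [norm_mul, Real.norm_eq_abs, Real.norm_eq_abs]
  calc _ ≤ |((x + z : ℤ) : ℝ) ^ j| * (C * (1 / 2 : ℝ) ^ x.natAbs) :=
        mul_le_mul_of_nonneg_left (hF x) (abs_nonneg _)
    _ = _ := by ring

/-- The rate of change of the `j`-th moment of the two-point function. -/
def momentRate (p : ℤ → ℝ) (R : ℕ) (ρ : ℝ) {Ω : Type*} [MeasurableSpace Ω] (μ : Measure Ω)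
    (η : ℝ≥0 → Ω → Config 2) (j : ℕ) (s : ℝ) : ℝ :=
  ∑ z ∈ Finset.Icc (-R : ℤ) R, p z *
    ∑' x : ℤ, (((x + z : ℤ) : ℝ) ^ j - (x : ℝ) ^ j) * fluxCorrelation ρ μ η z x s.toNNReal

section Moments

variable {p : ℤ → ℝ} {R : ℕ} {ρ : unitInterval} {Ω : Type*} [mΩ : MeasurableSpace Ω]
  {μ : Measure Ω} [IsProbabilityMeasure μ] {ℱ : Filtration ℝ≥0 mΩ} {η : ℝ≥0 → Ω → Config 2}

lemma IsStationaryProcess.summable_pow_mul_fluxCorrelation (h : IsStationaryProcess p ρ μ ℱ η)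
    (hp : HasRange p R) {z : ℤ} (hz : z ∈ Finset.Icc (-R : ℤ) R) (j : ℕ) (y : ℤ) (t : ℝ≥0) :
    Summable fun x : ℤ => ((x + y : ℤ) : ℝ) ^ j * fluxCorrelation ρ μ η z x t :=
  summable_pow_mul_of_abs_le (fun x => h.abs_fluxCorrelation_le hp hz x t) j y

lemma IsStationaryProcess.abs_fluxCorrelation_le_of_le (h : IsStationaryProcess p ρ μ ℱ η)
    (hp : HasRange p R) {z : ℤ} (hz : z ∈ Finset.Icc (-R : ℤ) R) (x : ℤ) {s T : ℝ} (hs : s ≤ T)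
    (hT : 0 ≤ T) : |fluxCorrelation ρ μ η z x s.toNNReal| ≤
      2 * ((1 + 2 ^ R) * Real.exp (2 * 2 ^ R * T)) * (1 / 2) ^ x.natAbs := by
  refine (h.abs_fluxCorrelation_le hp hz x s.toNNReal).trans ?_
  refine mul_le_mul_of_nonneg_right ?_ (by positivity)
  refine mul_le_mul_of_nonneg_left ?_ (by norm_num)
  refine mul_le_mul_of_nonneg_left (Real.exp_le_exp.mpr ?_) (by positivity)
  refine mul_le_mul_of_nonneg_left ?_ (by positivity)
  rw [Real.coe_toNNReal']
  exact max_le hs hT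

/-- The spatial decay is uniform for bounded times, so the series converges locally uniformly.
Continuity makes the integrated moment equation differentiable. -/
lemma IsStationaryProcess.continuous_momentRate (h : IsStationaryProcess p ρ μ ℱ η)
    (hp : HasRange p R) (j : ℕ) : Continuous (momentRate p R ρ μ η j) := by
  refine continuous_finsetSum _ fun z hz => Continuous.const_mul ?_ _
  refine continuous_iff_continuousAt.mpr fun s₀ => ?_
  have hT : 0 ≤ |s₀| + 1 := by positivity
  refine ContinuousOn.continuousAt (s := Set.Iio (|s₀| + 1)) ?_
    (Iio_mem_nhds (by linarith [le_abs_self s₀]))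
  set C : ℝ := 2 * ((1 + 2 ^ R) * Real.exp (2 * 2 ^ R * (|s₀| + 1)))
  refine continuousOn_tsum (u := fun x : ℤ => C * (|((x + z : ℤ) : ℝ) ^ j| * (1 / 2) ^ x.natAbs) +
    C * (|((x + 0 : ℤ) : ℝ) ^ j| * (1 / 2) ^ x.natAbs))
    (fun x => ((h.continuous_fluxCorrelation hp z x).const_mul _).continuousOn)
    (((summable_abs_pow_mul_geometric j z).mul_left C).add
      ((summable_abs_pow_mul_geometric j 0).mul_left C)) fun x s hs => ?_
  rw [norm_mul, Real.norm_eq_abs, Real.norm_eq_abs, add_zero]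
  have h1 := h.abs_fluxCorrelation_le_of_le hp hz x (Set.mem_Iio.mp hs).le hT
  calc _ ≤ (|((x + z : ℤ) : ℝ) ^ j| + |(x : ℝ) ^ j|) * (C * (1 / 2) ^ x.natAbs) :=
        mul_le_mul (abs_sub _ _) h1 (abs_nonneg _) (by positivity)
    _ = _ := by ring

/-- The evolution of the moments of the two-point function. -/
theorem IsStationaryProcess.hasSum_moment (h : IsStationaryProcess p ρ μ ℱ η)
    (hp : HasRange p R) (j : ℕ) (t : ℝ≥0) :
    HasSum (fun x : ℤ => (x : ℝ) ^ j * twoPoint ρ μ η x t)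
      ((0 : ℝ) ^ j * (ρ * (1 - ρ)) + ∫ s in (0 : ℝ)..t, momentRate p R ρ μ η j s) := by
  have h0 : HasSum (fun x : ℤ => (x : ℝ) ^ j * twoPoint ρ μ η x 0)
      ((0 : ℝ) ^ j * (ρ * (1 - ρ))) := by
    have := hasSum_single (f := fun x : ℤ => (x : ℝ) ^ j * twoPoint ρ μ η x 0) 0 fun x hx => by
      rw [h.twoPoint_zero, if_neg hx, mul_zero]
    simpa [h.twoPoint_zero] using this
  set F : ℤ → ℝ → ℝ := fun x s => (x : ℝ) ^ j * ∑ z ∈ Finset.Icc (-R : ℤ) R,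
    p z * (fluxCorrelation ρ μ η z (x - z) s.toNNReal - fluxCorrelation ρ μ η z x s.toNNReal)
    with hF
  set C : ℝ := 2 * ((1 + 2 ^ R) * Real.exp (2 * 2 ^ R * t))
  have hFc : ∀ x, Continuous (F x) := fun x =>
    Continuous.const_mul (continuous_finsetSum _ fun z _ => Continuous.const_mul
      ((h.continuous_fluxCorrelation hp z (x - z)).sub (h.continuous_fluxCorrelation hp z x)) _) _
  have hsum := (summable_abs_pow_mul_geometric j 0).mul_left (C * (1 + 2 ^ R))
  have hint : HasSum (fun x => ∫ s in (0 : ℝ)..t, F x s)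
      (∫ s in (0 : ℝ)..t, momentRate p R ρ μ η j s) := by
    refine intervalIntegral.hasSum_integral_of_dominated_convergence
      (fun x _ => C * (1 + 2 ^ R) * (|((x + 0 : ℤ) : ℝ) ^ j| * (1 / 2) ^ x.natAbs))
      (fun x => (hFc x).aestronglyMeasurable) (fun x => Eventually.of_forall fun s hs => ?_)
      (Eventually.of_forall fun s _ => hsum) intervalIntegrable_const
      (Eventually.of_forall fun s _ => ?_)
    · rw [Set.uIoc_of_le t.coe_nonneg] at hs
      have h1 : |∑ z ∈ Finset.Icc (-R : ℤ) R, p z * (fluxCorrelation ρ μ η z (x - z) s.toNNReal -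
          fluxCorrelation ρ μ η z x s.toNNReal)| ≤ C * (1 + 2 ^ R) * (1 / 2) ^ x.natAbs := by
        calc _ ≤ ∑ z ∈ Finset.Icc (-R : ℤ) R, p z * (C * (1 + 2 ^ R) * (1 / 2) ^ x.natAbs) := by
              refine (Finset.abs_sum_le_sum_abs _ _).trans (Finset.sum_le_sum fun z hz => ?_)
              rw [abs_mul, abs_of_nonneg (hp.nonneg z)]
              refine mul_le_mul_of_nonneg_left ((abs_sub _ _).trans ?_) (hp.nonneg z)
              have h2 := h.abs_fluxCorrelation_le_of_le hp hz (x - z) hs.2 t.2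
              have h3 := h.abs_fluxCorrelation_le_of_le hp hz x hs.2 t.2
              have h4 : (1 / 2 : ℝ) ^ (x - z).natAbs ≤ 2 ^ R * (1 / 2) ^ x.natAbs :=
                half_pow_natAbs_le_of_le (by rw [Finset.mem_Icc] at hz; omega)
              have h5 : C * (1 / 2 : ℝ) ^ (x - z).natAbs ≤ C * (2 ^ R * (1 / 2) ^ x.natAbs) :=
                mul_le_mul_of_nonneg_left h4 (by positivity)
              calc _ ≤ C * (2 ^ R * (1 / 2) ^ x.natAbs) + C * (1 / 2) ^ x.natAbs :=
                    add_le_add (h2.trans h5) h3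
                _ = _ := by ring
          _ = _ := by rw [← Finset.sum_mul, hp.sum_eq_one, one_mul]
      rw [hF, norm_mul, Real.norm_eq_abs, Real.norm_eq_abs, add_zero]
      calc _ ≤ |(x : ℝ) ^ j| * (C * (1 + 2 ^ R) * (1 / 2) ^ x.natAbs) :=
            mul_le_mul_of_nonneg_left h1 (abs_nonneg _)
        _ = _ := by ring
    · have h1 : ∀ z ∈ Finset.Icc (-R : ℤ) R, HasSum (fun x : ℤ => p z * ((x : ℝ) ^ j *
          fluxCorrelation ρ μ η z (x - z) s.toNNReal -
          (x : ℝ) ^ j * fluxCorrelation ρ μ η z x s.toNNReal))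
          (p z * ∑' x : ℤ, (((x + z : ℤ) : ℝ) ^ j - (x : ℝ) ^ j) *
            fluxCorrelation ρ μ η z x s.toNNReal) := by
        intro z hz
        have hz1 := h.summable_pow_mul_fluxCorrelation hp hz j z s.toNNReal
        have hz0 := h.summable_pow_mul_fluxCorrelation hp hz j 0 s.toNNReal
        simp only [add_zero] at hz0
        have e : ∑' x : ℤ, (((x + z : ℤ) : ℝ) ^ j - (x : ℝ) ^ j) *
            fluxCorrelation ρ μ η z x s.toNNReal =
            ∑' x : ℤ, ((x + z : ℤ) : ℝ) ^ j * fluxCorrelation ρ μ η z x s.toNNReal -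
              ∑' x : ℤ, (x : ℝ) ^ j * fluxCorrelation ρ μ η z x s.toNNReal := by
          rw [← hz1.tsum_sub hz0]
          simp only [sub_mul]
        rw [e]
        refine HasSum.mul_left _ (HasSum.sub ?_ hz0.hasSum)
        -- Summation by parts: shifting the incoming flux by `z` puts the difference on the power of
        -- `x`.
        have := (Equiv.subRight z).hasSum_iff.mpr hz1.hasSum
        refine this.congr_fun ?_ |> fun q => q
        intro x
        simp
      refine (hasSum_sum h1).congr_fun fun x => ?_
      rw [hF]
      simp only [Finset.mul_sum]
      refine Finset.sum_congr rfl fun z _ => ?_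
      ring
  have hfin := h0.add hint
  refine hfin.congr_fun fun x => ?_
  rw [h.twoPoint_eq_add_integral hp x t, mul_add, hF, intervalIntegral.integral_const_mul]

/-- Conservation of mass: for `j = 0` the rate vanishes, and `0 ^ 0 = 1` keeps the initial mass. -/
lemma IsStationaryProcess.hasSum_twoPoint (h : IsStationaryProcess p ρ μ ℱ η)
    (hp : HasRange p R) (t : ℝ≥0) :
    HasSum (fun x : ℤ => twoPoint ρ μ η x t) (ρ * (1 - ρ)) := by
  simpa [momentRate] using h.hasSum_moment hp 0 t

end Moments

/-! ### The second-class particle -/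

lemma measurableSet_existsUnique_eq_one : MeasurableSet {ξ : Config 3 | ∃! x, ξ x = 1} := by
  have h1 : ∀ x : ℤ, MeasurableSet {ξ : Config 3 | ξ x = 1} := fun x =>
    measurable_pi_apply x (measurableSet_singleton _)
  have : {ξ : Config 3 | ∃! x, ξ x = 1} =
      ⋃ x : ℤ, ({ξ | ξ x = 1} ∩ ⋂ y : ℤ, ⋂ _ : y ≠ x, {ξ | ξ y = 1}ᶜ) := by
    ext ξ
    simp only [Set.mem_ofPred_eq, Set.mem_iUnion, Set.mem_inter_iff, Set.mem_iInter,
      Set.mem_compl_iff, ExistsUnique]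
    exact exists_congr fun x => and_congr_right fun _ => forall_congr' fun y => by tauto
  rw [this]
  exact MeasurableSet.iUnion fun x => (h1 x).inter
    (MeasurableSet.iInter fun y => MeasurableSet.iInter fun _ => (h1 y).compl)

lemma position_eq_iff {ξ : Config 3} (h : ∃! x, ξ x = 1) (y : ℤ) :
    position ξ = y ↔ ξ y = 1 := by
  rw [position, dif_pos h]
  exact ⟨fun e => e ▸ h.choose_spec.1, fun e => (h.choose_spec.2 y e).symm⟩

lemma measurable_position : Measurable position := by
  refine measurable_to_countable' fun y => ?_
  have : position ⁻¹' {y} = ({ξ | ∃! x, ξ x = 1} ∩ {ξ | ξ y = 1}) ∪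
      ({ξ | ∃! x, ξ x = 1}ᶜ ∩ {_ξ | 0 = y}) := by
    ext ξ
    by_cases h : ∃! x, ξ x = 1
    · simp [h, position_eq_iff h]
    · simp [h, position]
  rw [this]
  exact (measurableSet_existsUnique_eq_one.inter
    (measurable_pi_apply y (measurableSet_singleton _))).union
    (measurableSet_existsUnique_eq_one.compl.inter (MeasurableSet.const _))

section Position

variable {p : ℤ → ℝ} {R : ℕ} {ρ : unitInterval} {Ω : Type*} [mΩ : MeasurableSpace Ω]
  {μ : Measure Ω} [IsProbabilityMeasure μ] {ℱ : Filtration ℝ≥0 mΩ} {η : ℝ≥0 → Ω → Config 2}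
  {Ω' : Type*} [mΩ' : MeasurableSpace Ω'] {ν : Measure Ω'}
  {𝒢 : Filtration ℝ≥0 mΩ'} {ζ : ℝ≥0 → Ω' → Config 3}

lemma integral_typeMap {k : ℕ} {ξ : Ω' → Config k} (hξ : Measurable ξ) (a : Fin k) (y : ℤ) :
    ∫ ω, typeMap a y (ξ ω) ∂ν = ν.real {ω | ξ ω y = a} := by
  have hm : MeasurableSet {ω | ξ ω y = a} :=
    (measurable_pi_apply y).comp hξ (measurableSet_singleton a)
  rw [← integral_indicator_one hm]
  refine integral_congr_ae (Eventually.of_forall fun ω => ?_)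
  simp [Set.indicator]

lemma IsSecondClassProcess.measurableSet_initiallyOccupied
    (hζ : IsSecondClassProcess p ρ ν 𝒢 ζ) (z : ℤ) : MeasurableSet (initiallyOccupied ζ z) :=
  (measurable_pi_apply z).comp (hζ.exclusion.measurable 0) (measurableSet_singleton _)

lemma IsSecondClassProcess.measureReal_initiallyOccupied
    (hζ : IsSecondClassProcess p ρ ν 𝒢 ζ) {z : ℤ} (hz : z ≠ 0) :
    ν.real (initiallyOccupied ζ z) = ρ := by
  have h1 := integral_typeMap (ν := ν) (hζ.exclusion.measurable 0) 2 z
  rw [initiallyOccupied, ← h1, hζ.integral_initial (typeMap 2 z).continuous]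
  have h2 : ∀ ξ : Config 2, (typeMap 2 z : C(Config 3, ℝ)) (withSecondClass ξ) = occ ξ z := by
    intro ξ
    simp only [typeMap_apply, withSecondClass, hz, if_false, occ]
    generalize ξ z = a
    fin_cases a <;> simp
  simp_rw [h2]
  rw [integral_bernoulliProduct_eq (f := fun ξ => occ ξ z) ρ z (occMap z).continuous]
  simp [occ]

lemma IsSecondClassProcess.jointWeight_eq_measureReal (hζ : IsSecondClassProcess p ρ ν 𝒢 ζ)
    (z y : ℤ) (t : ℝ≥0) :
    jointWeight ν ζ z y t = ν.real ({ω | ζ t ω y = 1} ∩ initiallyOccupied ζ z) := by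
  have hA : MeasurableSet {ω | ζ t ω y = 1} :=
    (measurable_pi_apply y).comp (hζ.exclusion.measurable t) (measurableSet_singleton _)
  rw [← integral_indicator_one (hA.inter (hζ.measurableSet_initiallyOccupied z)), jointWeight]
  refine integral_congr_ae (Eventually.of_forall fun ω => ?_)
  by_cases h1 : ζ t ω y = 1 <;> by_cases h2 : ζ 0 ω z = 2 <;>
    simp [Set.indicator, initiallyOccupied, h1, h2]

variable [IsProbabilityMeasure ν]

/-- There is almost surely exactly one second-class particle. -/
theorem IsSecondClassProcess.ae_existsUnique (hζ : IsSecondClassProcess p ρ ν 𝒢 ζ)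
    (h : IsStationaryProcess p ρ μ ℱ η) (hp : HasRange p R) (hρ₀ : 0 < (ρ : ℝ))
    (hρ₁ : (ρ : ℝ) < 1) (t : ℝ≥0) : ∀ᵐ ω ∂ν, ∃! x, ζ t ω x = 1 := by
  have hχ : (ρ : ℝ) * (1 - ρ) ≠ 0 := mul_ne_zero hρ₀.ne' (by linarith)
  have hA : ∀ y : ℤ, MeasurableSet {ω | ζ t ω y = 1} := fun y =>
    (measurable_pi_apply y).comp (hζ.exclusion.measurable t) (measurableSet_singleton _)
  have hdisj : ∀ x y : ℤ, x ≠ y → ∀ᵐ ω ∂ν, ¬(ζ t ω x = 1 ∧ ζ t ω y = 1) := by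
    intro x y hxy
    have h1 := hζ.integral_typeMap_mul_eq_zero hp hxy t
    have hi : Integrable (fun ω => (typeMap 1 x * typeMap 1 y : C(Config 3, ℝ)) (ζ t ω)) ν := by
      have := integrable_comp_mul (μ := ν) (hζ.exclusion.measurable t) (G := fun _ => 1)
        (C := 1) measurable_const (by simp) (typeMap 1 x * typeMap 1 y)
      simp only [mul_one] at this
      exact this
    have h2 := (integral_eq_zero_iff_of_nonneg (fun ω => ?_) hi).mp h1
    · filter_upwards [h2] with ω hω hc
      simp [hc.1, hc.2] at hω
    · simp only [ContinuousMap.mul_apply, typeMap_apply, Pi.zero_apply]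
      positivity
  -- The expected number of second-class particles is one. As the events overlap only on null sets,
  -- their union then has full measure, so no particle escapes to infinity.
  have hsum : HasSum (fun y : ℤ => ν.real {ω | ζ t ω y = 1}) 1 := by
    have h1 := (h.hasSum_twoPoint hp t).mul_left ((ρ : ℝ) * (1 - ρ))⁻¹
    rw [inv_mul_cancel₀ hχ] at h1
    refine h1.congr_fun fun y => ?_
    rw [← hζ.integral_typeMap_eq_twoPoint h hp y t,
      integral_typeMap (hζ.exclusion.measurable t), inv_mul_cancel_left₀ hχ]
  have hU : ν (⋃ y : ℤ, {ω | ζ t ω y = 1}) = 1 := by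
    rw [measure_iUnion₀ (fun x y hxy => ?_) fun y => (hA y).nullMeasurableSet]
    · have := ENNReal.ofReal_tsum_of_nonneg (fun y => measureReal_nonneg) hsum.summable
      rw [hsum.tsum_eq, ENNReal.ofReal_one] at this
      rw [this]
      exact tsum_congr fun y => (ofReal_measureReal (measure_ne_top _ _)).symm
    · exact measure_eq_zero_iff_ae_notMem.mpr (hdisj x y hxy)
  have hex : ∀ᵐ ω ∂ν, ω ∈ ⋃ y : ℤ, {ω | ζ t ω y = 1} :=
    (mem_ae_iff_prob_eq_one (MeasurableSet.iUnion hA)).mpr hU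
  have hall : ∀ᵐ ω ∂ν, ∀ x y : ℤ, x ≠ y → ¬(ζ t ω x = 1 ∧ ζ t ω y = 1) := by
    rw [ae_all_iff]; intro x
    rw [ae_all_iff]; intro y
    by_cases hxy : x = y
    · simp [hxy]
    · filter_upwards [hdisj x y hxy] with ω hω _ using hω
  filter_upwards [hex, hall] with ω h1 h2
  obtain ⟨y, hy⟩ := Set.mem_iUnion.mp h1
  exact ⟨y, hy, fun x hx => by_contra fun hxy => h2 x y hxy ⟨hx, hy⟩⟩

/-- Dropping the condition on `z` leaves the law of the position, which is the two-point function
divided by `χ`. -/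
lemma IsSecondClassProcess.abs_jointWeight_le (hζ : IsSecondClassProcess p ρ ν 𝒢 ζ)
    (h : IsStationaryProcess p ρ μ ℱ η) (hp : HasRange p R) (hρ₀ : 0 < (ρ : ℝ))
    (hρ₁ : (ρ : ℝ) < 1) (z y : ℤ) (t : ℝ≥0) : |jointWeight ν ζ z y t| ≤
      (ρ * (1 - ρ) : ℝ)⁻¹ * ((1 + 2 ^ R) * Real.exp (2 * 2 ^ R * t)) * (1 / 2) ^ y.natAbs := by
  have hχ : 0 < (ρ : ℝ) * (1 - ρ) := mul_pos hρ₀ (by linarith)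
  rw [hζ.jointWeight_eq_measureReal, abs_of_nonneg measureReal_nonneg]
  refine (measureReal_mono Set.inter_subset_left).trans ?_
  rw [← integral_typeMap (hζ.exclusion.measurable t)]
  have h1 := hζ.integral_typeMap_eq_twoPoint h hp y t
  have h2 := (le_abs_self _).trans (h.abs_twoPoint_le hp y t)
  rw [← h1] at h2
  rw [mul_assoc, ← div_eq_inv_mul, le_div_iff₀ hχ]
  linarith

/-- Expectations of functions of the position on the event that `z` is initially occupied. -/
theorem IsSecondClassProcess.integral_position (hζ : IsSecondClassProcess p ρ ν 𝒢 ζ)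
    (h : IsStationaryProcess p ρ μ ℱ η) (hp : HasRange p R) (hρ₀ : 0 < (ρ : ℝ))
    (hρ₁ : (ρ : ℝ) < 1) (z : ℤ) (t : ℝ≥0) {g : ℤ → ℝ}
    (hg : Summable fun y => g y * jointWeight ν ζ z y t) :
    IntegrableOn (fun ω => g (position (ζ t ω))) (initiallyOccupied ζ z) ν ∧
      HasSum (fun y => g y * jointWeight ν ζ z y t)
        (∫ ω in initiallyOccupied ζ z, g (position (ζ t ω)) ∂ν) := by
  set E := initiallyOccupied ζ z with hE
  have hX : Measurable fun ω => position (ζ t ω) :=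
    measurable_position.comp (hζ.exclusion.measurable t)
  set m : Measure ℤ := (ν.restrict E).map fun ω => position (ζ t ω) with hm
  have hreal : ∀ y, m.real {y} = jointWeight ν ζ z y t := by
    intro y
    rw [hζ.jointWeight_eq_measureReal, measureReal_def, measureReal_def, hm,
      Measure.map_apply hX (measurableSet_singleton y),
      Measure.restrict_apply (hX (measurableSet_singleton y))]
    congr 1
    -- The events agree only almost everywhere: `position` takes its default value `0` on a null
    -- set.
    refine measure_congr ?_
    filter_upwards [hζ.ae_existsUnique h hp hρ₀ hρ₁ t] with ω hω
    refine propext (and_congr_left fun _ => ?_)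
    exact position_eq_iff hω y
  have hgm : Measurable g := measurable_of_countable g
  have hint : Integrable g m := by
    refine ⟨hgm.aestronglyMeasurable, ?_⟩
    rw [HasFiniteIntegral, lintegral_countable']
    have e : ∀ y, ‖g y‖ₑ * m {y} = ENNReal.ofReal ‖g y * jointWeight ν ζ z y t‖ := by
      intro y
      rw [norm_mul, ENNReal.ofReal_mul (norm_nonneg _), ofReal_norm, ← hreal,
        Real.norm_of_nonneg measureReal_nonneg, ofReal_measureReal (measure_ne_top _ _)]
    simp_rw [e]
    rw [← ENNReal.ofReal_tsum_of_nonneg (fun _ => norm_nonneg _) hg.norm]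
    exact ENNReal.ofReal_lt_top
  refine ⟨(integrable_map_measure hgm.aestronglyMeasurable hX.aemeasurable).mp hint, ?_⟩
  have h1 := integral_countable hint
  rw [hm, integral_map hX.aemeasurable hgm.aestronglyMeasurable, ← hm] at h1
  rw [h1]
  simp only [hreal, smul_eq_mul, mul_comm (jointWeight _ _ _ _ _)]
  exact hg.hasSum

end Position

/-! ### The derivative of the second moment -/

lemma HasRange.tsum_mul {p : ℤ → ℝ} {R : ℕ} (hp : HasRange p R) (f : ℤ → ℝ) :
    ∑' z : ℤ, f z * p z = ∑ z ∈ Finset.Icc (-R : ℤ) R, f z * p z :=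
  tsum_eq_sum fun z hz => by rw [hp.eq_zero z hz, mul_zero]

lemma sum_Icc_neg {M : Type*} [AddCommMonoid M] (R : ℕ) (f : ℤ → M) :
    ∑ z ∈ Finset.Icc (-R : ℤ) R, f (-z) = ∑ z ∈ Finset.Icc (-R : ℤ) R, f z :=
  Finset.sum_equiv (Equiv.neg ℤ) (fun z => by simp only [Finset.mem_Icc, Equiv.neg_apply]; omega)
    fun _ _ => rfl

/-- Folding of a sum against an even function. -/
lemma HasRange.tsum_Ioi {p : ℤ → ℝ} {R : ℕ} (hp : HasRange p R) {c : ℤ → ℝ}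
    (hc : ∀ z, z ≠ 0 → c (-z) = c z) :
    ∑' z : Set.Ioi (0 : ℤ), ((z : ℤ) : ℝ) * (p z - p (-z)) * c z =
      ∑ z ∈ Finset.Icc (-R : ℤ) R, (z : ℝ) * p z * c z := by
  rw [tsum_subtype (Set.Ioi (0 : ℤ)) fun z : ℤ => (z : ℝ) * (p z - p (-z)) * c z,
    tsum_eq_sum (s := Finset.Icc (-R : ℤ) R)]
  · set g : ℤ → ℝ := fun z => if 0 < z then (z : ℝ) * p z * c z else 0
    set g' : ℤ → ℝ := fun z => if z < 0 then (z : ℝ) * p z * c z else 0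
    -- The term `z = 0` belongs to neither half and vanishes through the factor `z`, so evenness of
    -- `c` matters only off `0`.
    have h1 : ∀ z : ℤ, (z : ℝ) * p z * c z = g z + g' z := by
      intro z
      rcases lt_trichotomy z 0 with h | h | h
      · simp [g, g', h, h.not_gt]
      · simp [g, g', h]
      · simp [g, g', h, h.not_gt]
    rw [Finset.sum_congr rfl fun z _ => h1 z, Finset.sum_add_distrib, ← sum_Icc_neg R g',
      ← Finset.sum_add_distrib]
    refine Finset.sum_congr rfl fun z _ => ?_
    by_cases h : 0 < z
    · simp only [Set.indicator, Set.mem_Ioi, h, if_true, g, g', neg_lt_zero, hc z h.ne',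
        Int.cast_neg]
      ring
    · simp [Set.indicator, h, g, g']
  · intro z hz
    have hz' : -z ∉ Finset.Icc (-R : ℤ) R := by
      rw [Finset.mem_Icc] at hz ⊢; omega
    simp [Set.indicator, hp.eq_zero z hz, hp.eq_zero _ hz']

lemma hasSum_of_eq {f g : ℤ → ℝ} {a b : ℝ} (h : HasSum f a) (hfg : ∀ x, g x = f x)
    (hab : b = a) : HasSum g b := by
  rw [hab, funext hfg]
  exact h

/-- `E[X(t); η_z(0) = 1]` for the position `X` of the second-class particle. -/
def positionMoment {Ω : Type*} [MeasurableSpace Ω] (ν : Measure Ω) (ζ : ℝ≥0 → Ω → Config 3)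
    (z : ℤ) (t : ℝ≥0) : ℝ :=
  ∫ ω in initiallyOccupied ζ z, (position (ζ t ω) : ℝ) ∂ν

section Diffusivity

variable {p : ℤ → ℝ} {R : ℕ} {ρ : unitInterval} {Ω : Type*} [mΩ : MeasurableSpace Ω]
  {μ : Measure Ω} [IsProbabilityMeasure μ] {ℱ : Filtration ℝ≥0 mΩ} {η : ℝ≥0 → Ω → Config 2}
  {Ω' : Type*} [mΩ' : MeasurableSpace Ω'] {ν : Measure Ω'} [IsProbabilityMeasure ν]
  {𝒢 : Filtration ℝ≥0 mΩ'} {ζ : ℝ≥0 → Ω' → Config 3}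

lemma IsSecondClassProcess.hasSum_jointWeight (hζ : IsSecondClassProcess p ρ ν 𝒢 ζ)
    (h : IsStationaryProcess p ρ μ ℱ η) (hp : HasRange p R) (hρ₀ : 0 < (ρ : ℝ))
    (hρ₁ : (ρ : ℝ) < 1) {z : ℤ} (hz : z ≠ 0) (t : ℝ≥0) :
    HasSum (fun y => jointWeight ν ζ z y t) ρ := by
  have h1 : Summable fun y : ℤ => (1 : ℝ) * jointWeight ν ζ z y t := by
    simpa using summable_pow_mul_of_abs_le (fun y => hζ.abs_jointWeight_le h hp hρ₀ hρ₁ z y t) 0 0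
  have h2 := (hζ.integral_position h hp hρ₀ hρ₁ z t (g := fun _ => 1) h1).2
  simpa [hζ.measureReal_initiallyOccupied hz] using h2

lemma IsSecondClassProcess.integrableOn_position (hζ : IsSecondClassProcess p ρ ν 𝒢 ζ)
    (h : IsStationaryProcess p ρ μ ℱ η) (hp : HasRange p R) (hρ₀ : 0 < (ρ : ℝ))
    (hρ₁ : (ρ : ℝ) < 1) (z : ℤ) (t : ℝ≥0) :
    IntegrableOn (fun ω => (position (ζ t ω) : ℝ)) (initiallyOccupied ζ z) ν ∧
      HasSum (fun y : ℤ => (y : ℝ) * jointWeight ν ζ z y t) (positionMoment ν ζ z t) := by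
  refine hζ.integral_position h hp hρ₀ hρ₁ z t (g := fun y => (y : ℝ)) ?_
  simpa using summable_pow_mul_of_abs_le (fun y => hζ.abs_jointWeight_le h hp hρ₀ hρ₁ z y t) 1 0

lemma IsSecondClassProcess.hasSum_pairCorrelation (hζ : IsSecondClassProcess p ρ ν 𝒢 ζ)
    (h : IsStationaryProcess p ρ μ ℱ η) (hp : HasRange p R) (hρ₀ : 0 < (ρ : ℝ))
    (hρ₁ : (ρ : ℝ) < 1) {z : ℤ} (hz : z ≠ 0) (t : ℝ≥0) :
    HasSum (fun x => pairCorrelation ρ μ η z x t) (2 * ρ * (ρ * (1 - ρ))) := by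
  have h1 := (Equiv.addRight z).hasSum_iff.mpr (hζ.hasSum_jointWeight h hp hρ₀ hρ₁ hz t)
  have h2 := (h1.mul_left ((ρ : ℝ) * (1 - ρ))).add ((h.hasSum_twoPoint hp t).mul_left (ρ : ℝ))
  refine hasSum_of_eq h2 (fun x => ?_) ?_
  · rw [hζ.pairCorrelation_eq h hp hz]
    rfl
  · ring

/-- The first moment of the two-point function, with the origin moved to `-z`. -/
lemma IsSecondClassProcess.hasSum_mul_pairCorrelation (hζ : IsSecondClassProcess p ρ ν 𝒢 ζ)
    (h : IsStationaryProcess p ρ μ ℱ η) (hp : HasRange p R) (hρ₀ : 0 < (ρ : ℝ))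
    (hρ₁ : (ρ : ℝ) < 1) {z : ℤ} (hz : z ≠ 0) (t : ℝ≥0) {M : ℝ}
    (hM : HasSum (fun x : ℤ => (x : ℝ) * twoPoint ρ μ η x t) M) :
    HasSum (fun x : ℤ => ((x + z : ℤ) : ℝ) * pairCorrelation ρ μ η z x t)
      (ρ * (1 - ρ) * positionMoment ν ζ z t + ρ * M + ρ * z * (ρ * (1 - ρ))) := by
  have h1 := (Equiv.addRight z).hasSum_iff.mpr (hζ.integrableOn_position h hp hρ₀ hρ₁ z t).2
  have h2 := ((h1.mul_left ((ρ : ℝ) * (1 - ρ))).add (hM.mul_left (ρ : ℝ))).add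
    ((h.hasSum_twoPoint hp t).mul_left ((ρ : ℝ) * z))
  refine h2.congr_fun fun x => ?_
  rw [hζ.pairCorrelation_eq h hp hz]
  simp only [Function.comp_apply, Equiv.coe_addRight]
  push_cast
  ring

/-- The same first moment of pair correlations is computed twice, from either site of the pair. The
terms with `M` cancel, and the shift by `z`, with total mass `2ρχ`, balances the terms `±ρzχ`. -/
lemma IsSecondClassProcess.positionMoment_neg (hζ : IsSecondClassProcess p ρ ν 𝒢 ζ)
    (h : IsStationaryProcess p ρ μ ℱ η) (hp : HasRange p R) (hρ₀ : 0 < (ρ : ℝ))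
    (hρ₁ : (ρ : ℝ) < 1) {z : ℤ} (hz : z ≠ 0) (t : ℝ≥0) :
    positionMoment ν ζ (-z) t = positionMoment ν ζ z t := by
  have hχ : (ρ : ℝ) * (1 - ρ) ≠ 0 := mul_ne_zero hρ₀.ne' (by linarith)
  have hM := h.hasSum_moment hp 1 t
  simp only [pow_one] at hM
  have h1 := hζ.hasSum_mul_pairCorrelation h hp hρ₀ hρ₁ hz t hM
  have h2 := (hζ.hasSum_mul_pairCorrelation h hp hρ₀ hρ₁ (neg_ne_zero.mpr hz) t hM).add
    ((hζ.hasSum_pairCorrelation h hp hρ₀ hρ₁ (neg_ne_zero.mpr hz) t).mul_left (z : ℝ))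
  have h3 := (Equiv.addRight z).hasSum_iff.mpr h2
  have h4 := h1.unique (h3.congr_fun fun x => ?_)
  · push_cast at h4
    refine mul_left_cancel₀ hχ ?_
    linarith
  · simp only [Function.comp_apply, Equiv.coe_addRight, pairCorrelation_neg]
    push_cast
    ring

/-- The response of the current to the density: `1 - 2ρ` is the derivative of `ρ(1-ρ)`. This gives
the characteristic velocity. -/
lemma IsSecondClassProcess.hasSum_fluxCorrelation (hζ : IsSecondClassProcess p ρ ν 𝒢 ζ)
    (h : IsStationaryProcess p ρ μ ℱ η) (hp : HasRange p R) (hρ₀ : 0 < (ρ : ℝ))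
    (hρ₁ : (ρ : ℝ) < 1) {z : ℤ} (hz : z ≠ 0) (t : ℝ≥0) :
    HasSum (fun x => fluxCorrelation ρ μ η z x t) ((1 - 2 * ρ) * (ρ * (1 - ρ))) := by
  have h1 := (h.hasSum_twoPoint hp t).sub (hζ.hasSum_pairCorrelation h hp hρ₀ hρ₁ hz t)
  refine hasSum_of_eq h1 (fun x => ?_) ?_
  · rw [h.fluxCorrelation_eq]
  · ring

lemma IsSecondClassProcess.hasSum_mul_fluxCorrelation (hζ : IsSecondClassProcess p ρ ν 𝒢 ζ)
    (h : IsStationaryProcess p ρ μ ℱ η) (hp : HasRange p R) (hρ₀ : 0 < (ρ : ℝ))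
    (hρ₁ : (ρ : ℝ) < 1) {z : ℤ} (hz : z ≠ 0) (t : ℝ≥0) {M : ℝ}
    (hM : HasSum (fun x : ℤ => (x : ℝ) * twoPoint ρ μ η x t) M) :
    HasSum (fun x : ℤ => (x : ℝ) * fluxCorrelation ρ μ η z x t)
      ((1 - ρ) * M - ρ * (1 - ρ) * positionMoment ν ζ z t + ρ * z * (ρ * (1 - ρ))) := by
  have h1 := (hM.sub (hζ.hasSum_mul_pairCorrelation h hp hρ₀ hρ₁ hz t hM)).add
    ((hζ.hasSum_pairCorrelation h hp hρ₀ hρ₁ hz t).mul_left (z : ℝ))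
  refine hasSum_of_eq h1 (fun x => ?_) ?_
  · rw [h.fluxCorrelation_eq]
    push_cast
    ring
  · ring

lemma IsSecondClassProcess.momentRate_one (hζ : IsSecondClassProcess p ρ ν 𝒢 ζ)
    (h : IsStationaryProcess p ρ μ ℱ η) (hp : HasRange p R) (hρ₀ : 0 < (ρ : ℝ))
    (hρ₁ : (ρ : ℝ) < 1) (s : ℝ) :
    momentRate p R ρ μ η 1 s = ρ * (1 - ρ) * ((1 - 2 * ρ) * drift p) := by
  rw [momentRate, drift, hp.tsum_mul, Finset.mul_sum, Finset.mul_sum]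
  refine Finset.sum_congr rfl fun z _ => ?_
  rcases eq_or_ne z 0 with rfl | hz
  · simp
  have h1 := (hζ.hasSum_fluxCorrelation h hp hρ₀ hρ₁ hz s.toNNReal).mul_left (z : ℝ)
  have h2 : ∀ x : ℤ, (((x + z : ℤ) : ℝ) ^ 1 - (x : ℝ) ^ 1) * fluxCorrelation ρ μ η z x s.toNNReal =
      z * fluxCorrelation ρ μ η z x s.toNNReal := by
    intro x; push_cast; ring
  simp_rw [h2]
  rw [h1.tsum_eq]
  ring

/-- The mean of the two-point function is transported with the characteristic velocity. -/
lemma IsSecondClassProcess.hasSum_firstMoment (hζ : IsSecondClassProcess p ρ ν 𝒢 ζ)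
    (h : IsStationaryProcess p ρ μ ℱ η) (hp : HasRange p R) (hρ₀ : 0 < (ρ : ℝ))
    (hρ₁ : (ρ : ℝ) < 1) (t : ℝ≥0) :
    HasSum (fun x : ℤ => (x : ℝ) * twoPoint ρ μ η x t)
      (ρ * (1 - ρ) * ((1 - 2 * ρ) * drift p * t)) := by
  have h1 := h.hasSum_moment hp 1 t
  simp only [pow_one, zero_mul, zero_add, hζ.momentRate_one h hp hρ₀ hρ₁,
    intervalIntegral.integral_const, sub_zero, smul_eq_mul] at h1
  convert h1 using 1
  ring

lemma IsSecondClassProcess.momentRate_two (hζ : IsSecondClassProcess p ρ ν 𝒢 ζ)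
    (h : IsStationaryProcess p ρ μ ℱ η) (hp : HasRange p R) (hρ₀ : 0 < (ρ : ℝ))
    (hρ₁ : (ρ : ℝ) < 1) (t : ℝ≥0) :
    momentRate p R ρ μ η 2 t = ρ * (1 - ρ) *
      (2 * (1 - ρ) * ((1 - 2 * ρ) * drift p * t) * drift p + ∑' z : ℤ, (z : ℝ) ^ 2 * p z -
        2 * ∑' z : Set.Ioi (0 : ℤ), ((z : ℤ) : ℝ) * (p z - p (-z)) * positionMoment ν ζ z t) := by
  rw [hp.tsum_Ioi (c := fun z => positionMoment ν ζ z t)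
    fun z hz => hζ.positionMoment_neg h hp hρ₀ hρ₁ hz t]
  set a := 2 * (1 - (ρ : ℝ)) * ((1 - 2 * ρ) * drift p * t) with ha
  rw [momentRate, drift, hp.tsum_mul, hp.tsum_mul, Finset.mul_sum, Finset.mul_sum,
    ← Finset.sum_add_distrib, ← Finset.sum_sub_distrib, Finset.mul_sum]
  refine Finset.sum_congr rfl fun z _ => ?_
  rcases eq_or_ne z 0 with rfl | hz
  · simp
  -- From `(x+z)² - x² = 2zx + z²`. The terms in `z²` have coefficients `2ρ` and `1 - 2ρ`, which add
  -- up to `1`.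
  have h1 := ((hζ.hasSum_mul_fluxCorrelation h hp hρ₀ hρ₁ hz t
    (hζ.hasSum_firstMoment h hp hρ₀ hρ₁ t)).mul_left (2 * (z : ℝ))).add
    ((hζ.hasSum_fluxCorrelation h hp hρ₀ hρ₁ hz t).mul_left ((z : ℝ) ^ 2))
  have h2 : ∀ x : ℤ, (((x + z : ℤ) : ℝ) ^ 2 - (x : ℝ) ^ 2) *
      fluxCorrelation ρ μ η z x (t : ℝ).toNNReal =
      2 * (z : ℝ) * ((x : ℝ) * fluxCorrelation ρ μ η z x t) +
        (z : ℝ) ^ 2 * fluxCorrelation ρ μ η z x t := by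
    intro x; rw [Real.toNNReal_coe]; push_cast; ring
  simp_rw [h2]
  rw [h1.tsum_eq, ha]
  ring

lemma IsSecondClassProcess.hasSum_centered_sq (hζ : IsSecondClassProcess p ρ ν 𝒢 ζ)
    (h : IsStationaryProcess p ρ μ ℱ η) (hp : HasRange p R) (hρ₀ : 0 < (ρ : ℝ))
    (hρ₁ : (ρ : ℝ) < 1) (t : ℝ≥0) :
    HasSum (fun x : ℤ => ((x : ℝ) - (1 - 2 * ρ) * drift p * t) ^ 2 * twoPoint ρ μ η x t)
      ((∫ s in (0 : ℝ)..t, momentRate p R ρ μ η 2 s) -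
        ρ * (1 - ρ) * ((1 - 2 * ρ) * drift p * t) ^ 2) := by
  set w := (1 - 2 * (ρ : ℝ)) * drift p * t with hw
  have h1 := ((h.hasSum_moment hp 2 t).sub
    ((hζ.hasSum_firstMoment h hp hρ₀ hρ₁ t).mul_left (2 * w))).add
    ((h.hasSum_twoPoint hp t).mul_left (w ^ 2))
  refine hasSum_of_eq h1 (fun x => ?_) ?_
  · ring
  · rw [hw]; ring

lemma IsSecondClassProcess.mul_diffusivity (hζ : IsSecondClassProcess p ρ ν 𝒢 ζ)
    (h : IsStationaryProcess p ρ μ ℱ η) (hp : HasRange p R) (hρ₀ : 0 < (ρ : ℝ))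
    (hρ₁ : (ρ : ℝ) < 1) {s : ℝ} (hs : 0 ≤ s) :
    s * diffusivity p ρ μ η s.toNNReal =
      (ρ * (1 - ρ) : ℝ)⁻¹ * (∫ r in (0 : ℝ)..s, momentRate p R ρ μ η 2 r) -
        ((1 - 2 * ρ) * drift p) ^ 2 * s ^ 2 := by
  have hχ : (ρ : ℝ) * (1 - ρ) ≠ 0 := mul_ne_zero hρ₀.ne' (by linarith)
  rw [diffusivity, (hζ.hasSum_centered_sq h hp hρ₀ hρ₁ s.toNNReal).tsum_eq, Real.coe_toNNReal s hs]
  -- At `s = 0` the prefactor `s` makes the junk value of `diffusivity` irrelevant.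
  rcases eq_or_ne s 0 with rfl | hs0
  · simp
  have h1 : s * (ρ * (1 - ρ) * s : ℝ)⁻¹ = (ρ * (1 - ρ) : ℝ)⁻¹ := by
    rw [mul_inv, mul_comm, mul_assoc, inv_mul_cancel₀ hs0, mul_one]
  rw [← mul_assoc, h1, mul_sub, inv_mul_cancel_left₀ hχ, mul_pow]

lemma IsSecondClassProcess.integrable_centeredPosition (hζ : IsSecondClassProcess p ρ ν 𝒢 ζ)
    (h : IsStationaryProcess p ρ μ ℱ η) (hp : HasRange p R) (hρ₀ : 0 < (ρ : ℝ))
    (hρ₁ : (ρ : ℝ) < 1) {z : ℤ} (hz : z ≠ 0) (t : ℝ≥0) :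
    Integrable (centeredPosition p ρ ζ t) (ν[|initiallyOccupied ζ z]) ∧
      ∫ ω, centeredPosition p ρ ζ t ω ∂(ν[|initiallyOccupied ζ z]) =
        (ρ : ℝ)⁻¹ * positionMoment ν ζ z t - (1 - 2 * ρ) * drift p * t := by
  have hE : ν (initiallyOccupied ζ z) ≠ 0 := by
    intro h0
    have := hζ.measureReal_initiallyOccupied hz
    rw [measureReal_def, h0, ENNReal.toReal_zero] at this
    exact hρ₀.ne this
  have := cond_isProbabilityMeasure hE
  have hi : Integrable (fun ω => (position (ζ t ω) : ℝ)) (ν[|initiallyOccupied ζ z]) :=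
    (hζ.integrableOn_position h hp hρ₀ hρ₁ z t).1.smul_measure (ENNReal.inv_ne_top.mpr hE)
  refine ⟨hi.sub (integrable_const _), ?_⟩
  unfold centeredPosition
  rw [integral_sub hi (integrable_const _), integral_const, probReal_univ, one_smul,
    ProbabilityTheory.cond, integral_smul_measure, ENNReal.toReal_inv, ← measureReal_def,
    hζ.measureReal_initiallyOccupied hz]
  rfl

/-- The derivative of `t D(t)` in terms of the second-class particle. -/
theorem IsSecondClassProcess.hasDerivWithinAt_mul_diffusivity
    (hζ : IsSecondClassProcess p ρ ν 𝒢 ζ) (h : IsStationaryProcess p ρ μ ℱ η)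
    (hp : HasRange p R) (hρ₀ : 0 < (ρ : ℝ)) (hρ₁ : (ρ : ℝ) < 1) (t : ℝ≥0) :
    HasDerivWithinAt (fun s : ℝ => s * diffusivity p ρ μ η s.toNNReal)
      ((∑' z : ℤ, (z : ℝ) ^ 2 * p z) -
        2 * ρ * ∑' z : Set.Ioi (0 : ℤ), ((z : ℤ) : ℝ) * (p z - p (-z)) *
          ∫ ω, centeredPosition p ρ ζ t ω ∂(ν[|initiallyOccupied ζ z]))
      (Set.Ici 0) t := by
  have hχ : (ρ : ℝ) * (1 - ρ) ≠ 0 := mul_ne_zero hρ₀.ne' (by linarith)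
  have hc := h.continuous_momentRate hp 2
  have h1 : HasDerivAt (fun s : ℝ =>
      (ρ * (1 - ρ) : ℝ)⁻¹ * (∫ r in (0 : ℝ)..s, momentRate p R ρ μ η 2 r) -
        ((1 - 2 * ρ) * drift p) ^ 2 * s ^ 2)
      ((ρ * (1 - ρ) : ℝ)⁻¹ * momentRate p R ρ μ η 2 t -
        ((1 - 2 * ρ) * drift p) ^ 2 * (2 * t)) t := by
    refine ((hc.integral_hasStrictDerivAt 0 t).hasDerivAt.const_mul _).sub ?_
    simpa using (hasDerivAt_pow 2 (t : ℝ)).const_mul (((1 - 2 * (ρ : ℝ)) * drift p) ^ 2)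
  have h2 : HasDerivWithinAt (fun s : ℝ => s * diffusivity p ρ μ η s.toNNReal)
      ((ρ * (1 - ρ) : ℝ)⁻¹ * momentRate p R ρ μ η 2 t -
        ((1 - 2 * ρ) * drift p) ^ 2 * (2 * t)) (Set.Ici 0) t :=
    h1.hasDerivWithinAt.congr (fun s hs => hζ.mul_diffusivity h hp hρ₀ hρ₁ hs)
      (hζ.mul_diffusivity h hp hρ₀ hρ₁ t.coe_nonneg)
  convert h2 using 1
  -- Centring and conditioning on an event of probability `ρ`. With `v = (1-2ρ)b`, the remaining
  -- drift terms match because `2(1-ρ)bvt - 2v²t = 2ρbvt`.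
  have h3 : ∑' z : Set.Ioi (0 : ℤ), ((z : ℤ) : ℝ) * (p z - p (-z)) *
      ∫ ω, centeredPosition p ρ ζ t ω ∂(ν[|initiallyOccupied ζ z]) =
      (ρ : ℝ)⁻¹ * (∑' z : Set.Ioi (0 : ℤ), ((z : ℤ) : ℝ) * (p z - p (-z)) *
        positionMoment ν ζ z t) - drift p * ((1 - 2 * ρ) * drift p * t) := by
    have e : ∀ z : Set.Ioi (0 : ℤ), ((z : ℤ) : ℝ) * (p z - p (-z)) *
        ∫ ω, centeredPosition p ρ ζ t ω ∂(ν[|initiallyOccupied ζ z]) =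
        ((z : ℤ) : ℝ) * (p z - p (-z)) *
          ((ρ : ℝ)⁻¹ * positionMoment ν ζ z t - (1 - 2 * ρ) * drift p * t) := fun z => by
      rw [(hζ.integrable_centeredPosition h hp hρ₀ hρ₁ (ne_of_gt z.2) t).2]
    rw [tsum_congr e,
      hp.tsum_Ioi (c := fun z => (ρ : ℝ)⁻¹ * positionMoment ν ζ z t - (1 - 2 * ρ) * drift p * t)
        fun z hz => by rw [hζ.positionMoment_neg h hp hρ₀ hρ₁ hz t],
      hp.tsum_Ioi (c := fun z => positionMoment ν ζ z t)
        fun z hz => hζ.positionMoment_neg h hp hρ₀ hρ₁ hz t]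
    simp only [mul_sub, Finset.sum_sub_distrib]
    rw [← Finset.sum_mul, ← hp.tsum_mul, drift, Finset.mul_sum]
    congr 1
    exact Finset.sum_congr rfl fun z _ => by ring
  rw [h3, hζ.momentRate_two h hp hρ₀ hρ₁, inv_mul_cancel_left₀ hχ]
  field_simp
  ring

end Diffusivity

end AEP

end

theorem lemma3p2 (p : ℤ → ℝ) (hp : AEP.IsJumpLaw p)
    (ρ : unitInterval) (hρ₀ : 0 < (ρ : ℝ)) (hρ₁ : (ρ : ℝ) < 1)
    -- the stationary process, which defines `D`
    {Ω : Type*} [mΩ : MeasurableSpace Ω] (μ : Measure Ω) [IsProbabilityMeasure μ]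
    (ℱ : Filtration ℝ≥0 mΩ) (η : ℝ≥0 → Ω → AEP.Config 2)
    (hη : AEP.IsStationaryProcess p ρ μ ℱ η)
    -- the process with a second-class particle, which defines `X`
    {Ω' : Type*} [mΩ' : MeasurableSpace Ω'] (ν : Measure Ω') [IsProbabilityMeasure ν]
    (𝒢 : Filtration ℝ≥0 mΩ') (ζ : ℝ≥0 → Ω' → AEP.Config 3)
    (hζ : AEP.IsSecondClassProcess p ρ ν 𝒢 ζ) :
    -- all quantities in the identity are well defined
    (∀ t, ∀ᵐ ω ∂ν, ∃! x, ζ t ω x = 1) ∧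
    (∀ t, Summable fun x : ℤ =>
      ((x : ℝ) - (1 - 2 * ρ) * AEP.drift p * t) ^ 2 * AEP.twoPoint ρ μ η x t) ∧
    (∀ t, ∀ z : ℤ, z ≠ 0 →
      Integrable (AEP.centeredPosition p ρ ζ t) (ν[|AEP.initiallyOccupied ζ z])) ∧
    -- the identity (at `t = 0` for the right derivative)
    ∀ t : ℝ≥0, HasDerivWithinAt
      (fun s : ℝ => s * AEP.diffusivity p ρ μ η s.toNNReal)
      ((∑' z : ℤ, (z : ℝ) ^ 2 * p z) -
        2 * ρ * ∑' z : Set.Ioi (0 : ℤ), ((z : ℤ) : ℝ) * (p z - p (-z)) *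
          ∫ ω, AEP.centeredPosition p ρ ζ t ω ∂(ν[|AEP.initiallyOccupied ζ z]))
      (Set.Ici 0) t := by
  obtain ⟨R, hR⟩ := hp.exists_hasRange
  exact ⟨fun t => hζ.ae_existsUnique hη hR hρ₀ hρ₁ t,
    fun t => (hζ.hasSum_centered_sq hη hR hρ₀ hρ₁ t).summable,
    fun t z hz => (hζ.integrable_centeredPosition hη hR hρ₀ hρ₁ hz t).1,
    fun t => hζ.hasDerivWithinAt_mul_diffusivity hη hR hρ₀ hρ₁ t⟩
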